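/- \textbf{Linear density result.} Let $s_1,s_2,s_3\ge 0$ be integers with $s_1\ge 2$ and $s_1+s_2\ge 3$ (the values $s_2=0$ and $s_3=0$ are allowed). For $i=1,2,3$ let $L_i(x_1,\dots,x_{s_i})=c^{(i)}_1x_1+\dots+c^{(i)}_{s_i}x_{s_i}$ be a linear form in $s_i$ variables with integer coefficients, all of which are non-zero, and suppose that $L_1(1,\dots,1)=0$. Write $[N]=\{1,2,\dots,N\}$ and $L_2(y^2)=L_2(y_1^2,\dots,y_{s_2}^2)$. For every real $\delta>0$ and every positive integer $r$ there exists $\eta>0$, depending only on $\delta$, $r$ and the forms $L_1,L_2,L_3$, such that the following holds. Let $W$ be a positive integer, and suppose that $W=1$ or $s_3>0$. Then there exists $N_0$, depending only on $\delta$, $r$, $W$ and the forms $L_1,L_2,L_3$, such that for every integer $N\ge N_0$, for all sets $A_1,\dots,A_r\subset[N]$ with $|A_i|\ge\delta N$ for all $i$, and for all sets of integers $C_1,\dots,C_r$ with $$C_1\cup\dots\cup C_r=\{n\in\mathbb Z:\ \eta (N/W)^{1/2}\le n\le (N/W)^{1/2}\},$$ there exists $j\in\{1,\dots,r\}$ such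 that for every $i\in\{1,\dots,r\}$ $$\#\left\{(x,y,z)\in A_i^{s_1}\times C_j^{s_2}\times C_j^{s_3}:\ L_1(x)=W L_2(y^2)+L_3(z)\right\}\ \ge\ \eta\, N^{s_1+\frac12(s_2+s_3)-1}\,W^{-\frac12(s_2+s_3)}.$$ -/

import Mathlib

/-- The value at `x` of the integral linear form `L(x₁, …, x_s) = c₁ x₁ + ⋯ + c_s x_s`. -/
def linForm {s : ℕ} (c : Fin s → ℤ) (x : Fin s → ℤ) : ℤ := ∑ i, c i * x i

/-- A linear form is non-singular if all of its coefficients are non-zero. -/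
def NonSingular {s : ℕ} (c : Fin s → ℤ) : Prop := ∀ i, c i ≠ 0

/-- The number of solutions `(x, y, z)` of `L₁(x) = W L₂(y²) + L₃(z)` with all `xᵢ ∈ A` and all
`yⱼ, zₖ ∈ B`, where `L₁, L₂, L₃` have coefficients `c₁, c₂, c₃` and
`L₂(y²) = L₂(y₁², …, y_{s₂}²)`. -/
def solutionCount {s₁ s₂ s₃ : ℕ} (c₁ : Fin s₁ → ℤ) (c₂ : Fin s₂ → ℤ) (c₃ : Fin s₃ → ℤ)
    (W : ℕ) (A B : Finset ℤ) : ℕ :=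
  (((Fintype.piFinset fun _ : Fin s₁ => A) ×ˢ
      ((Fintype.piFinset fun _ : Fin s₂ => B) ×ˢ (Fintype.piFinset fun _ : Fin s₃ => B))).filter
    fun p => linForm c₁ p.1
      = (W : ℤ) * linForm c₂ (fun j => p.2.1 j ^ 2) + linForm c₃ p.2.2).card

/-! The count is carried out modulo a prime `p` of order `N`, chosen so large that a congruence
between the quantities involved is an equality of integers. With `f` the indicator of some `A i`,
the weighted count has a Fourier expansion, and the proof splits `f` into a structured and a
Fourier-small part.

Structured part. Let `F` be the average of `f` over the Bohr set of all frequencies where the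
transform of `f` is at least `σ p`. Translating `F` by `t` changes it little in mean if `t` lies in
the Bohr set of the coarser spectrum at level `τ`, provided the frequencies of intermediate size
carry little mass (`sum_sq_translateAverage_sub_le`). Suppose the phases of `y ^ 2` and `z`, at
suitable dilates of the coarse spectrum, are close to `1`. Then the first variable can be solved for
from nearly common values of the others, with a shift under which `F` is still almost invariant. As
`L₁` is translation invariant, the weighted count in `x` is then at least about the `s₁`-th power of
the density (`almost_invariant_count_le`). The integers with such phases have positive density in
`[1, Y]` by van der Waerden's theorem (`recurrence_density`), so some colour contains a positive
proportion of them. The spectra of all the `A i` are used together, so one colour serves every `i`.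

Error part. Replacing `f` by `F` costs little (`modCount_error`). For three or more `x` variables,
Parseval applied to two of them suffices. For two variables, the exponential sum over `y` and `z`
must be large at boundedly many frequencies only (`card_large_coloured_le`). This follows from a
moment: the eighth power of a quadratic sum, controlled by an elementary count of eight squares,
times the square of a linear sum. The linear factor regains the loss of `W` caused by the
coefficient `W` of the squares, hence the condition `W = 1` or `s₃ > 0`.

Constants. The level `σ`, and with it the lower end `ω` of the band, depends on `τ`. Among boundedly
many candidate scales `τ`, one has little mass in its band (`exists_sparse_band`), and the minimum
over these scales gives an `η` independent of `W`, `N`, the sets and the colouring. -/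

open Finset ZMod

/-! ### Fourier analysis on `ZMod p` and averaging over Bohr sets. -/

section Fourier

/-- The average of `f` over the translates by elements of `B`. -/
noncomputable def translateAverage {p : ℕ} (B : Finset (ZMod p)) (f : ZMod p → ℝ) (x : ZMod p) : ℝ :=
  (∑ b ∈ B, f (x - b)) / B.card

theorem translateAverage_nonneg {p : ℕ} (B : Finset (ZMod p)) (f : ZMod p → ℝ) (hf : ∀ x, 0 ≤ f x)
    (x : ZMod p) : 0 ≤ translateAverage B f x :=
  div_nonneg (Finset.sum_nonneg fun _ _ => hf _) (Nat.cast_nonneg _)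

theorem translateAverage_le_one {p : ℕ} (B : Finset (ZMod p)) (f : ZMod p → ℝ) (hf : ∀ x, f x ≤ 1)
    (x : ZMod p) : translateAverage B f x ≤ 1 := by
  refine div_le_one_of_le₀ ?_ (Nat.cast_nonneg _)
  calc ∑ b ∈ B, f (x - b) ≤ ∑ b ∈ B, (1 : ℝ) := Finset.sum_le_sum fun _ _ => hf _
    _ = B.card := by simp

variable {p : ℕ} [NeZero p]

/-- The unnormalised Fourier transform on `ZMod p`. -/
noncomputable def fourierSum (f : ZMod p → ℂ) (ξ : ZMod p) : ℂ := ∑ x, f x * stdAddChar (ξ * x)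

theorem norm_stdAddChar (x : ZMod p) : ‖(stdAddChar x : ℂ)‖ = 1 := by
  rw [stdAddChar_apply]
  exact Circle.norm_coe _

theorem conj_stdAddChar (x : ZMod p) :
    (starRingEnd ℂ) (stdAddChar x : ℂ) = stdAddChar (-x) :=
  (AddChar.map_neg_eq_conj _ _).symm

theorem stdAddChar_sum {ι : Type*} (S : Finset ι) (f : ι → ZMod p) :
    (stdAddChar (∑ i ∈ S, f i) : ℂ) = ∏ i ∈ S, stdAddChar (f i) := by
  classical
  induction S using Finset.induction_on with
  | empty => simp
  | insert a S ha ih => rw [Finset.sum_insert ha, Finset.prod_insert ha, AddChar.map_add_eq_mul, ih]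

theorem sum_stdAddChar_mul (b : ZMod p) :
    ∑ ξ : ZMod p, (stdAddChar (ξ * b) : ℂ) = if b = 0 then (p : ℂ) else 0 := by
  rw [AddChar.sum_mulShift b (isPrimitive_stdAddChar p)]
  simp [ZMod.card]

/-- Orthogonality of characters, in the form behind Parseval, the counting formula and the moment
formula alike. -/
theorem sum_sum_stdAddChar {ι : Type*} (S : Finset ι) (m : ι → ZMod p) (g : ι → ℂ) :
    ∑ ξ : ZMod p, ∑ s ∈ S, g s * (stdAddChar (ξ * m s) : ℂ)
      = p * ∑ s ∈ S, if m s = 0 then g s else 0 := by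
  rw [Finset.sum_comm, Finset.mul_sum]
  refine Finset.sum_congr rfl fun s _ => ?_
  rw [← Finset.mul_sum, sum_stdAddChar_mul]
  split_ifs <;> ring

theorem sum_norm_sq_fourierSum (f : ZMod p → ℂ) :
    ∑ ξ, ‖fourierSum f ξ‖ ^ 2 = p * ∑ x, ‖f x‖ ^ 2 := by
  have h1 : ∀ ξ : ZMod p, ((‖fourierSum f ξ‖ ^ 2 : ℝ) : ℂ)
      = ∑ s ∈ (univ ×ˢ univ : Finset (ZMod p × ZMod p)),
        (f s.1 * (starRingEnd ℂ) (f s.2)) * stdAddChar (ξ * (s.1 - s.2)) := by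
    intro ξ
    have : ((‖fourierSum f ξ‖ ^ 2 : ℝ) : ℂ) = fourierSum f ξ * (starRingEnd ℂ) (fourierSum f ξ) := by
      rw [Complex.mul_conj, Complex.normSq_eq_norm_sq]
    rw [this, fourierSum, map_sum, Finset.sum_mul_sum, ← Finset.sum_product']
    refine Finset.sum_congr rfl fun s _ => ?_
    rw [map_mul (starRingEnd ℂ), conj_stdAddChar, mul_sub, sub_eq_add_neg,
      AddChar.map_add_eq_mul]
    ring
  have h2 : ((∑ ξ, ‖fourierSum f ξ‖ ^ 2 : ℝ) : ℂ) = ((p * ∑ x, ‖f x‖ ^ 2 : ℝ) : ℂ) := by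
    rw [Complex.ofReal_sum]
    simp_rw [h1]
    rw [sum_sum_stdAddChar, Finset.sum_product]
    push_cast
    congr 1
    refine Finset.sum_congr rfl fun x _ => ?_
    simp only [sub_eq_zero]
    rw [Finset.sum_ite_eq]
    simp [Complex.mul_conj, Complex.normSq_eq_norm_sq]
  exact_mod_cast h2

theorem norm_fourierSum_le (f : ZMod p → ℂ) (hf : ∀ x, ‖f x‖ ≤ 1) (ξ : ZMod p) :
    ‖fourierSum f ξ‖ ≤ p := by
  calc ‖fourierSum f ξ‖ ≤ ∑ x : ZMod p, ‖f x * stdAddChar (ξ * x)‖ := norm_sum_le _ _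
    _ ≤ ∑ x : ZMod p, 1 := by
        refine Finset.sum_le_sum fun x _ => ?_
        rw [norm_mul, norm_stdAddChar, mul_one]
        exact hf x
    _ = p := by simp [ZMod.card]

theorem sum_norm_sq_fourierSum_le (f : ZMod p → ℂ) (hf : ∀ x, ‖f x‖ ≤ 1) :
    ∑ ξ, ‖fourierSum f ξ‖ ^ 2 ≤ (p : ℝ) ^ 2 := by
  rw [sum_norm_sq_fourierSum, sq]
  refine mul_le_mul_of_nonneg_left ?_ (Nat.cast_nonneg _)
  calc ∑ x, ‖f x‖ ^ 2 ≤ ∑ x : ZMod p, (1 : ℝ) :=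
        Finset.sum_le_sum fun x _ => pow_le_one₀ (norm_nonneg _) (hf x)
    _ = p := by simp [ZMod.card]

theorem fourierSum_sub (f g : ZMod p → ℂ) (ξ : ZMod p) :
    fourierSum (fun x => f x - g x) ξ = fourierSum f ξ - fourierSum g ξ := by
  simp only [fourierSum, sub_mul, Finset.sum_sub_distrib]

theorem fourierSum_translate (f : ZMod p → ℂ) (t ξ : ZMod p) :
    fourierSum (fun x => f (x + t)) ξ = stdAddChar (-(ξ * t)) * fourierSum f ξ := by
  unfold fourierSum
  rw [Finset.mul_sum, ← Equiv.sum_comp (Equiv.addRight t)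
    (fun x => (stdAddChar (-(ξ * t)) : ℂ) * (f x * stdAddChar (ξ * x)))]
  refine Finset.sum_congr rfl fun x _ => ?_
  rw [Equiv.coe_addRight, mul_add, AddChar.map_add_eq_mul, AddChar.map_neg_eq_inv]
  have : (stdAddChar (ξ * t) : ℂ) ≠ 0 := fun h => by
    have := norm_stdAddChar (ξ * t); rw [h] at this; simp at this
  field_simp

/-- The number of solutions of a linear equation, weighted by `h`, through Fourier inversion. -/
theorem weighted_count_eq {s : ℕ} {ι : Type*} (S : Finset ι) (m : ι → ZMod p)
    (c : Fin s → ZMod p) (h : Fin s → ZMod p → ℂ) :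
    (p : ℂ) * ∑ w ∈ S, ∑ x : Fin s → ZMod p, (if ∑ k, c k * x k = m w then ∏ k, h k (x k) else 0)
      = ∑ ξ : ZMod p, (∏ k, fourierSum (h k) (c k * ξ)) * ∑ w ∈ S, stdAddChar (-(ξ * m w)) := by
  have h1 : ∀ ξ : ZMod p, (∏ k, fourierSum (h k) (c k * ξ)) * ∑ w ∈ S, stdAddChar (-(ξ * m w))
      = ∑ q ∈ S ×ˢ (univ : Finset (Fin s → ZMod p)),
        (∏ k, h k (q.2 k)) * stdAddChar (ξ * (∑ k, c k * q.2 k - m q.1)) := by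
    intro ξ
    unfold fourierSum
    rw [Finset.prod_univ_sum, Finset.sum_product, Finset.sum_mul_sum, Finset.sum_comm]
    refine Finset.sum_congr rfl fun w _ => ?_
    rw [Fintype.piFinset_univ]
    refine Finset.sum_congr rfl fun x _ => ?_
    rw [Finset.prod_mul_distrib, mul_assoc]
    congr 1
    rw [mul_sub, sub_eq_add_neg, AddChar.map_add_eq_mul, Finset.mul_sum, stdAddChar_sum]
    congr 1
    refine Finset.prod_congr rfl fun k _ => ?_
    congr 1
    ring
  simp_rw [h1]
  rw [sum_sum_stdAddChar, Finset.sum_product]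
  simp only [sub_eq_zero]

theorem sum_translateAverage (B : Finset (ZMod p)) (hB : B.Nonempty) (f : ZMod p → ℝ) :
    ∑ x, translateAverage B f x = ∑ x, f x := by
  unfold translateAverage
  rw [← Finset.sum_div, Finset.sum_comm]
  have : ∀ b ∈ B, ∑ x, f (x - b) = ∑ x, f x := fun b _ => Equiv.sum_comp (Equiv.subRight b) f
  rw [Finset.sum_congr rfl this, Finset.sum_const, nsmul_eq_mul]
  have : (B.card : ℝ) ≠ 0 := by exact_mod_cast hB.card_pos.ne'
  field_simp

/-- The Fourier transform of the uniform probability measure on `B`. -/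
noncomputable def uniformFourier (B : Finset (ZMod p)) (ξ : ZMod p) : ℂ :=
  (∑ b ∈ B, (stdAddChar (ξ * b) : ℂ)) / B.card

theorem norm_uniformFourier_le_one (B : Finset (ZMod p)) (ξ : ZMod p) :
    ‖uniformFourier B ξ‖ ≤ 1 := by
  unfold uniformFourier
  rw [norm_div, Complex.norm_natCast]
  refine div_le_one_of_le₀ ?_ (Nat.cast_nonneg _)
  refine (norm_sum_le _ _).trans ?_
  simp

/-- Averaging over translates is convolution with the uniform measure on `B`, so transforms
multiply. In particular averaging never increases a Fourier coefficient in modulus. -/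
theorem fourierSum_translateAverage (B : Finset (ZMod p)) (f : ZMod p → ℝ) (ξ : ZMod p) :
    fourierSum (fun x => (translateAverage B f x : ℂ)) ξ
      = fourierSum (fun x => (f x : ℂ)) ξ * uniformFourier B ξ := by
  have h1 : ∀ b, ∑ x : ZMod p, (f (x - b) : ℂ) * stdAddChar (ξ * x)
      = fourierSum (fun x => (f x : ℂ)) ξ * stdAddChar (ξ * b) := by
    intro b
    have := fourierSum_translate (fun x => (f x : ℂ)) (-b) ξ
    simp only [fourierSum, ← sub_eq_add_neg] at this ⊢
    rw [this]
    rw [mul_neg, neg_neg, mul_comm]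
  unfold uniformFourier
  rw [mul_div_assoc', Finset.mul_sum, ← Finset.sum_congr rfl fun b _ => h1 b, Finset.sum_comm]
  rw [fourierSum, Finset.sum_div]
  refine Finset.sum_congr rfl fun x _ => ?_
  rw [translateAverage, ← Finset.sum_mul]
  push_cast
  ring

/-- Parseval for the normalised indicator of `B`. For dense `B` the sum is bounded, which later
controls the frequencies where `f` has a small coefficient. -/
theorem sum_norm_sq_uniformFourier (B : Finset (ZMod p)) (hB : B.Nonempty) :
    ∑ ξ, ‖uniformFourier B ξ‖ ^ 2 = (p : ℝ) / B.card := by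
  have h0 : (B.card : ℝ) ≠ 0 := by exact_mod_cast hB.card_pos.ne'
  have h1 : ∀ ξ, uniformFourier B ξ
      = fourierSum (fun x => if x ∈ B then ((B.card : ℂ))⁻¹ else 0) ξ := by
    intro ξ
    unfold uniformFourier fourierSum
    simp only [ite_mul, zero_mul]
    rw [Finset.sum_ite_mem, Finset.univ_inter, ← Finset.mul_sum, div_eq_inv_mul]
  simp_rw [h1]
  rw [sum_norm_sq_fourierSum]
  have h2 : ∀ x : ZMod p, ‖(if x ∈ B then ((B.card : ℂ))⁻¹ else 0)‖ ^ 2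
      = if x ∈ B then ((B.card : ℝ))⁻¹ ^ 2 else 0 := by
    intro x
    split_ifs <;> simp
  simp_rw [h2]
  rw [Finset.sum_ite_mem, Finset.univ_inter, Finset.sum_const, nsmul_eq_mul]
  field_simp

theorem norm_uniformFourier_sub_one_le (B : Finset (ZMod p)) (hB : B.Nonempty) (ξ : ZMod p) (σ : ℝ)
    (h : ∀ b ∈ B, ‖(stdAddChar (ξ * b) : ℂ) - 1‖ ≤ σ) : ‖uniformFourier B ξ - 1‖ ≤ σ := by
  have h0 : (B.card : ℂ) ≠ 0 := by exact_mod_cast hB.card_pos.ne'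
  have h0' : (0 : ℝ) < B.card := by exact_mod_cast hB.card_pos
  have h1 : uniformFourier B ξ - 1 = (∑ b ∈ B, ((stdAddChar (ξ * b) : ℂ) - 1)) / B.card := by
    unfold uniformFourier
    rw [Finset.sum_sub_distrib, sub_div]
    simp [h0]
  rw [h1, norm_div, Complex.norm_natCast, div_le_iff₀ h0']
  refine (norm_sum_le _ _).trans ((Finset.sum_le_sum h).trans ?_)
  simp [mul_comm]

/-- A function differs from its average over a Bohr set of its large spectrum by a function
with small Fourier transform. -/
theorem norm_fourierSum_sub_translateAverage_le (f : ZMod p → ℝ) (hf : ∀ x, |f x| ≤ 1)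
    (B : Finset (ZMod p)) (hB : B.Nonempty) (σ : ℝ) (hσ : 0 ≤ σ)
    (h : ∀ b ∈ B, ∀ ξ, σ * p ≤ ‖fourierSum (fun x => (f x : ℂ)) ξ‖ →
      ‖(stdAddChar (ξ * b) : ℂ) - 1‖ ≤ σ) (ξ : ZMod p) :
    ‖fourierSum (fun x => (f x : ℂ)) ξ
      - fourierSum (fun x => (translateAverage B f x : ℂ)) ξ‖ ≤ 2 * σ * p := by
  rw [fourierSum_translateAverage]
  set a := fourierSum (fun x => (f x : ℂ)) ξ with ha
  have h1 : a - a * uniformFourier B ξ = -(a * (uniformFourier B ξ - 1)) := by ring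
  have hp : (0 : ℝ) ≤ p := Nat.cast_nonneg _
  have ha1 : ‖a‖ ≤ p := norm_fourierSum_le _ (by simpa using hf) ξ
  rw [h1, norm_neg, norm_mul]
  -- On the large spectrum the averaging factor is within `σ` of `1`; off it the coefficient itself
  -- is below `σ p`, and the trivial bound `2` for the other factor suffices.
  by_cases hl : σ * p ≤ ‖a‖
  · have := norm_uniformFourier_sub_one_le B hB ξ σ fun b hb => h b hb ξ hl
    calc ‖a‖ * ‖uniformFourier B ξ - 1‖ ≤ p * σ := by gcongr
      _ ≤ 2 * σ * p := by nlinarith [mul_nonneg hσ hp]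
  · have h2 : ‖uniformFourier B ξ - 1‖ ≤ 2 := by
      refine (norm_sub_le _ _).trans ?_
      have := norm_uniformFourier_le_one B ξ
      rw [norm_one]; linarith
    calc ‖a‖ * ‖uniformFourier B ξ - 1‖ ≤ (σ * p) * 2 := by
          gcongr
          exact (not_le.mp hl).le
      _ = 2 * σ * p := by ring

/-- The average of a function over a Bohr set is almost invariant under translations from the
Bohr set of its very large spectrum, if few frequencies are of intermediate size. -/
theorem sum_sq_translateAverage_sub_le (f : ZMod p → ℝ) (hf : ∀ x, |f x| ≤ 1)
    (B : Finset (ZMod p)) (τ ω ρ ε β : ℝ) (hβ : 0 < β)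
    (hB : β * p ≤ B.card)
    (hmass : ∑ ξ with ω * p ≤ ‖fourierSum (fun x => (f x : ℂ)) ξ‖ ∧
      ‖fourierSum (fun x => (f x : ℂ)) ξ‖ < τ * p, ‖fourierSum (fun x => (f x : ℂ)) ξ‖ ^ 2
        ≤ ε * (p : ℝ) ^ 2)
    (t : ZMod p)
    (ht : ∀ ξ, τ * p ≤ ‖fourierSum (fun x => (f x : ℂ)) ξ‖ →
      ‖(stdAddChar (ξ * t) : ℂ) - 1‖ ≤ ρ) :
    ∑ x, (translateAverage B f (x + t) - translateAverage B f x) ^ 2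
      ≤ p * (ρ ^ 2 + 4 * ε + 4 * ω ^ 2 / β) := by
  have hp : (0 : ℝ) < p := by exact_mod_cast NeZero.pos p
  have hBpos : (0 : ℝ) < B.card := lt_of_lt_of_le (mul_pos hβ hp) hB
  have hBne : B.Nonempty := by
    rw [← Finset.card_pos]; exact_mod_cast hBpos
  set a := fun ξ => fourierSum (fun x => (f x : ℂ)) ξ with ha
  set κ := fun ξ => uniformFourier B ξ with hκ
  have hκ1 : ∀ ξ, ‖κ ξ‖ ^ 2 ≤ 1 := fun ξ =>
    pow_le_one₀ (norm_nonneg _) (norm_uniformFourier_le_one B ξ)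
  have hκsum : ∑ ξ, ‖κ ξ‖ ^ 2 ≤ 1 / β := by
    rw [sum_norm_sq_uniformFourier B hBne, div_le_div_iff₀ hBpos hβ]
    linarith
  have hasum : ∑ ξ, ‖a ξ‖ ^ 2 ≤ (p : ℝ) ^ 2 := sum_norm_sq_fourierSum_le _ (by simpa using hf)
  -- Parseval: a translation multiplies each coefficient by a phase, so the difference carries the
  -- factor phase minus one.
  have hpars : p * ∑ x, (translateAverage B f (x + t) - translateAverage B f x) ^ 2
      = ∑ ξ, ‖a ξ‖ ^ 2 * ‖κ ξ‖ ^ 2 * ‖(stdAddChar (-(ξ * t)) : ℂ) - 1‖ ^ 2 := by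
    have h1 := sum_norm_sq_fourierSum (p := p)
      (fun x => (translateAverage B f (x + t) : ℂ) - (translateAverage B f x : ℂ))
    have h2 : ∀ x, ‖(translateAverage B f (x + t) : ℂ) - (translateAverage B f x : ℂ)‖ ^ 2
        = (translateAverage B f (x + t) - translateAverage B f x) ^ 2 := by
      intro x
      rw [← Complex.ofReal_sub, Complex.norm_real, Real.norm_eq_abs, sq_abs]
    simp_rw [h2] at h1
    rw [← h1]
    refine Finset.sum_congr rfl fun ξ _ => ?_
    rw [fourierSum_sub, fourierSum_translate (fun x => (translateAverage B f x : ℂ)),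
      fourierSum_translateAverage]
    have : ∀ u v w : ℂ, w * (u * v) - u * v = u * v * (w - 1) := fun u v w => by ring
    rw [this, norm_mul, norm_mul, mul_pow, mul_pow]
  have hneg : ∀ ξ, ‖(stdAddChar (-(ξ * t)) : ℂ) - 1‖ = ‖(stdAddChar (ξ * t) : ℂ) - 1‖ := by
    intro ξ
    rw [← conj_stdAddChar, ← map_one (starRingEnd ℂ), ← map_sub, RCLike.norm_conj, map_one]
  have htwo : ∀ ξ, ‖(stdAddChar (ξ * t) : ℂ) - 1‖ ^ 2 ≤ 4 := by
    intro ξ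
    have : ‖(stdAddChar (ξ * t) : ℂ) - 1‖ ≤ 2 := by
      refine (norm_sub_le _ _).trans ?_
      rw [norm_stdAddChar, norm_one]; norm_num
    nlinarith [norm_nonneg ((stdAddChar (ξ * t) : ℂ) - 1)]
  -- Three ranges of frequencies. At large ones the phase is within `ρ` of `1`; intermediate ones
  -- have small total mass by `hmass`; at small ones the coefficient is at most `ω p`, and the sum
  -- of `‖κ ξ‖ ^ 2` is at most `1 / β`.
  have hterm : ∀ ξ, ‖a ξ‖ ^ 2 * ‖κ ξ‖ ^ 2 * ‖(stdAddChar (-(ξ * t)) : ℂ) - 1‖ ^ 2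
      ≤ ρ ^ 2 * ‖a ξ‖ ^ 2 + 4 * (if ω * p ≤ ‖a ξ‖ ∧ ‖a ξ‖ < τ * p then ‖a ξ‖ ^ 2 else 0)
        + 4 * (ω * p) ^ 2 * ‖κ ξ‖ ^ 2 := by
    intro ξ
    rw [hneg]
    have h1 := hκ1 ξ
    have h4 := htwo ξ
    have ha0 : 0 ≤ ‖a ξ‖ ^ 2 := by positivity
    have hk0 : 0 ≤ ‖κ ξ‖ ^ 2 := by positivity
    have hc0 : 0 ≤ ‖(stdAddChar (ξ * t) : ℂ) - 1‖ ^ 2 := by positivity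
    have hak : ‖a ξ‖ ^ 2 * ‖κ ξ‖ ^ 2 ≤ ‖a ξ‖ ^ 2 := mul_le_of_le_one_right ha0 h1
    by_cases hτ : τ * p ≤ ‖a ξ‖
    · have h5 := ht ξ hτ
      have h6 : ‖(stdAddChar (ξ * t) : ℂ) - 1‖ ^ 2 ≤ ρ ^ 2 := by gcongr
      rw [if_neg (by intro h; exact absurd hτ (not_le.mpr h.2))]
      have : ‖a ξ‖ ^ 2 * ‖κ ξ‖ ^ 2 * ‖(stdAddChar (ξ * t) : ℂ) - 1‖ ^ 2
          ≤ ‖a ξ‖ ^ 2 * ρ ^ 2 := by gcongr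
      have h7 : 0 ≤ 4 * (ω * p) ^ 2 * ‖κ ξ‖ ^ 2 := by positivity
      linarith
    · have h8 : 0 ≤ ρ ^ 2 * ‖a ξ‖ ^ 2 := by positivity
      have h7 : 0 ≤ 4 * (ω * p) ^ 2 * ‖κ ξ‖ ^ 2 := by positivity
      by_cases hω' : ω * p ≤ ‖a ξ‖
      · rw [if_pos ⟨hω', not_le.mp hτ⟩]
        have : ‖a ξ‖ ^ 2 * ‖κ ξ‖ ^ 2 * ‖(stdAddChar (ξ * t) : ℂ) - 1‖ ^ 2
          ≤ ‖a ξ‖ ^ 2 * 4 := by gcongr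
        linarith
      · rw [if_neg (by intro h; exact hω' h.1)]
        have h9 : ‖a ξ‖ ^ 2 ≤ (ω * p) ^ 2 := by
          gcongr
          exact (not_le.mp hω').le
        have : ‖a ξ‖ ^ 2 * ‖κ ξ‖ ^ 2 * ‖(stdAddChar (ξ * t) : ℂ) - 1‖ ^ 2
          ≤ (ω * p) ^ 2 * ‖κ ξ‖ ^ 2 * 4 := by gcongr
        linarith
  have hsum := Finset.sum_le_sum fun ξ (_ : ξ ∈ (univ : Finset (ZMod p))) => hterm ξ
  rw [← hpars, Finset.sum_add_distrib, Finset.sum_add_distrib, ← Finset.mul_sum, ← Finset.mul_sum,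
    ← Finset.mul_sum, ← Finset.sum_filter] at hsum
  have hfin : p * ∑ x, (translateAverage B f (x + t) - translateAverage B f x) ^ 2
      ≤ p * (p * (ρ ^ 2 + 4 * ε + 4 * ω ^ 2 / β)) := by
    refine hsum.trans ?_
    have e1 : ρ ^ 2 * ∑ ξ, ‖a ξ‖ ^ 2 ≤ ρ ^ 2 * (p : ℝ) ^ 2 := by gcongr
    have e2 : 4 * (ω * p) ^ 2 * ∑ ξ, ‖κ ξ‖ ^ 2 ≤ 4 * (ω * p) ^ 2 * (1 / β) := by gcongr
    have e3 : (p : ℝ) * (p * (ρ ^ 2 + 4 * ε + 4 * ω ^ 2 / β))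
        = ρ ^ 2 * (p : ℝ) ^ 2 + 4 * (ε * (p : ℝ) ^ 2) + 4 * (ω * p) ^ 2 * (1 / β) := by
      field_simp
    rw [e3]
    linarith
  exact le_of_mul_le_mul_left hfin hp

end Fourier

/-! ### Quadratic and linear recurrence, and pigeonholing of scales. -/

section Recurrence

/-- Van der Waerden's theorem for progressions of length three, with bounded difference. -/
theorem exists_mono_progression (κ : Type) [Finite κ] :
    ∃ M : ℕ, ∀ C : ℕ → κ, ∃ a d : ℕ, 0 < d ∧ d ≤ M ∧ C (a + d) = C a ∧ C (a + 2 * d) = C a := by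
  -- Hales–Jewett over the alphabet `{0, 1, 2}`: adding up coordinates turns a combinatorial line
  -- into a three-term progression whose difference is the number of active coordinates, hence
  -- positive and at most `Fintype.card ι`.
  obtain ⟨ι, _, hι⟩ := Combinatorics.Line.exists_mono_in_high_dimension (Fin 3) κ
  refine ⟨Fintype.card ι, fun C => ?_⟩
  obtain ⟨l, c, hl⟩ := hι fun v => C (∑ i, (v i : ℕ))
  classical
  set s : Finset ι := {i | l.idxFun i = none} with hs
  have key : ∀ x : Fin 3, ∑ i, ((l x i : Fin 3) : ℕ)
      = (∑ i, (((l.idxFun i).getD 0 : Fin 3) : ℕ)) + x * s.card := by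
    intro x
    have h1 : (x : ℕ) * s.card = ∑ i, if l.idxFun i = none then (x : ℕ) else 0 := by
      rw [← Finset.sum_filter, Finset.sum_const, smul_eq_mul, mul_comm]
    rw [h1, ← Finset.sum_add_distrib]
    refine Finset.sum_congr rfl fun i _ => ?_
    cases h : l.idxFun i <;> simp [h]
  have hl' : ∀ x : Fin 3, C ((∑ i, (((l.idxFun i).getD 0 : Fin 3) : ℕ)) + x * s.card) = c := by
    intro x
    rw [← key x]
    exact hl x
  refine ⟨∑ i, (((l.idxFun i).getD 0 : Fin 3) : ℕ), s.card, ?_, Finset.card_le_univ s, ?_, ?_⟩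
  · obtain ⟨i, hi⟩ := l.proper
    exact Finset.card_pos.mpr ⟨i, by simp [hs, hi]⟩
  · have h0 := hl' 0
    have h1 := hl' 1
    simp at h0 h1
    rw [h0, h1]
  · have h0 := hl' 0
    have h2 := hl' 2
    simp at h0 h2
    rw [h0, h2]

/-- The unit circle can be coloured with finitely many colours so that points of the same colour
are close. -/
theorem exists_circle_colouring (ρ : ℝ) (hρ : 0 < ρ) :
    ∃ (m : ℕ) (q : ℂ → Fin (m + 1)), ∀ z w : ℂ, ‖z‖ = 1 → ‖w‖ = 1 → q z = q w → ‖z - w‖ ≤ ρ := by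
  have hc : TotallyBounded (Metric.sphere (0 : ℂ) 1) := (isCompact_sphere _ _).totallyBounded
  obtain ⟨t, ht, hcov⟩ := Metric.totallyBounded_iff.mp hc (ρ / 2) (by positivity)
  classical
  set T := ht.toFinset with hT
  have hz : ∀ z : ℂ, ‖z‖ = 1 → ∃ y ∈ T, dist z y < ρ / 2 := by
    intro z hz
    have := hcov (show z ∈ Metric.sphere (0 : ℂ) 1 by simpa using hz)
    simpa [hT] using this
  let g : ℂ → ℂ := fun z => if h : ∃ y ∈ T, dist z y < ρ / 2 then h.choose else 0
  have hg : ∀ z : ℂ, ‖z‖ = 1 → g z ∈ T ∧ dist z (g z) < ρ / 2 := by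
    intro z h
    have := hz z h
    simp only [g, dif_pos this]
    exact this.choose_spec
  -- A point is coloured by a nearby centre of a finite net. The extra last colour is a default that
  -- no point of the unit circle receives.
  refine ⟨T.card, fun z => if h : g z ∈ T then (T.equivFin ⟨g z, h⟩).castSucc else Fin.last _, ?_⟩
  intro z w hz1 hw1 hq
  obtain ⟨hz2, hz3⟩ := hg z hz1
  obtain ⟨hw2, hw3⟩ := hg w hw1
  simp only [dif_pos hz2, dif_pos hw2] at hq
  have := T.equivFin.injective (Fin.castSucc_injective _ hq)
  have hgg : g z = g w := congrArg Subtype.val this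
  rw [← dist_eq_norm]
  rw [hgg] at hz3
  have := dist_triangle_right z w (g w)
  linarith

theorem norm_sq_sub_one_le (z : ℂ) (hz : ‖z‖ = 1) : ‖z ^ 2 - 1‖ ≤ 2 * ‖z - 1‖ := by
  have : z ^ 2 - 1 = (z + 1) * (z - 1) := by ring
  rw [this, norm_mul]
  gcongr
  refine (norm_add_le _ _).trans ?_
  rw [hz, norm_one]; norm_num

/-- Simultaneous quadratic and linear recurrence with a uniform bound. -/
theorem exists_bounded_recurrence (K : ℕ) (ρ : ℝ) (hρ : 0 < ρ) :
    ∃ M : ℕ, 0 < M ∧ ∀ (p : ℕ) [NeZero p] (θ φ : Fin K → ZMod p), ∃ y : ℕ, 0 < y ∧ y ≤ M ∧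
      ∀ i, ‖(stdAddChar (θ i * (y : ZMod p) ^ 2) : ℂ) - 1‖ ≤ ρ ∧
        ‖(stdAddChar (φ i * (y : ZMod p)) : ℂ) - 1‖ ≤ ρ := by
  obtain ⟨m, q, hq⟩ := exists_circle_colouring (ρ / 8) (by positivity)
  obtain ⟨M, hM⟩ := exists_mono_progression (Fin K → Fin (m + 1) × Fin (m + 1))
  refine ⟨2 * M + 1, by omega, fun p _ θ φ => ?_⟩
  obtain ⟨a, d, hd, hdM, h1, h2⟩ := hM fun n i =>
    (q (stdAddChar (θ i * (n : ZMod p) ^ 2)), q (stdAddChar (φ i * (n : ZMod p))))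
  -- The second difference of `θ n ^ 2` along the progression is `2 θ d ^ 2`, and doubling it gives
  -- `θ (2 d) ^ 2`; hence `2 * d` rather than `d`.
  refine ⟨2 * d, by omega, by omega, fun i => ?_⟩
  have h1i := congrFun h1 i
  have h2i := congrFun h2 i
  simp only [Prod.mk.injEq] at h1i h2i
  have A1 := hq _ _ (norm_stdAddChar _) (norm_stdAddChar _) h1i.1
  have A2 := hq _ _ (norm_stdAddChar _) (norm_stdAddChar _) h2i.1
  have A4 := hq _ _ (norm_stdAddChar _) (norm_stdAddChar _) h2i.2
  constructor
  · set z0 : ℂ := stdAddChar (θ i * (a : ZMod p) ^ 2) with hz0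
    set z1 : ℂ := stdAddChar (θ i * ((a + d : ℕ) : ZMod p) ^ 2) with hz1
    set z2 : ℂ := stdAddChar (θ i * ((a + 2 * d : ℕ) : ZMod p) ^ 2) with hz2
    set w : ℂ := stdAddChar (θ i * 2 * (d : ZMod p) ^ 2) with hw
    have n0 : ‖z0‖ = 1 := norm_stdAddChar _
    have n1 : ‖z1‖ = 1 := norm_stdAddChar _
    have nw : ‖w‖ = 1 := norm_stdAddChar _
    -- From `(a + 2 d) ^ 2 + a ^ 2 = 2 (a + d) ^ 2 + 2 d ^ 2`. Since `z0`, `z1`, `z2` pairwise share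
    -- a colour with `z0`, this forces `w` close to `1`.
    have e1 : z2 * z0 = z1 ^ 2 * w := by
      rw [hz0, hz1, hz2, hw, ← AddChar.map_nsmul_eq_pow, ← AddChar.map_add_eq_mul,
        ← AddChar.map_add_eq_mul]
      congr 1
      push_cast
      rw [nsmul_eq_mul]
      push_cast
      ring
    have e2 : (stdAddChar (θ i * ((2 * d : ℕ) : ZMod p) ^ 2) : ℂ) = w ^ 2 := by
      rw [hw, ← AddChar.map_nsmul_eq_pow]
      congr 1
      push_cast
      rw [nsmul_eq_mul]
      push_cast
      ring
    have e3 : ‖w - 1‖ ≤ ρ / 2 := by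
      have : ‖z1 ^ 2 * (w - 1)‖ = ‖w - 1‖ := by rw [norm_mul, norm_pow, n1]; simp
      rw [← this, mul_sub, ← e1]
      have : z2 * z0 - z1 ^ 2 * 1 = (z2 - z0) * z0 - (z1 - z0) * (z1 + z0) := by ring
      rw [this]
      refine (norm_sub_le _ _).trans ?_
      rw [norm_mul, norm_mul, n0, mul_one]
      have : ‖z1 + z0‖ ≤ 2 := by
        refine (norm_add_le _ _).trans ?_
        rw [n0, n1]; norm_num
      have h3 : ‖z1 - z0‖ * ‖z1 + z0‖ ≤ ‖z1 - z0‖ * 2 := by gcongr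
      linarith
    rw [e2]
    have := norm_sq_sub_one_le w nw
    linarith
  · have e1 : (stdAddChar (φ i * ((a + 2 * d : ℕ) : ZMod p)) : ℂ)
        = stdAddChar (φ i * (a : ZMod p)) * stdAddChar (φ i * ((2 * d : ℕ) : ZMod p)) := by
      rw [← AddChar.map_add_eq_mul]
      congr 1
      push_cast
      ring
    rw [e1] at A4
    have : ∀ u v : ℂ, u * v - u = u * (v - 1) := fun u v => by ring
    rw [this, norm_mul, norm_stdAddChar, one_mul] at A4
    linarith

/-- The integers in `[1, Y]` at which the linear and quadratic phases with frequencies in `Λ` are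
within `ρ` of `1`. -/
noncomputable def recurrenceSet {p : ℕ} [NeZero p] (Λ : Finset (ZMod p)) (ρ : ℝ) (Y : ℕ) :
    Finset ℕ :=
  (Icc 1 Y).filter fun y : ℕ => ∀ ξ ∈ Λ,
    ‖(stdAddChar (ξ * (y : ZMod p) ^ 2) : ℂ) - 1‖ ≤ ρ ∧
    ‖(stdAddChar (ξ * (y : ZMod p)) : ℂ) - 1‖ ≤ ρ

/-- The integers up to `Y` at which finitely many linear and quadratic phases are all close to `1`
have positive density, bounded below independently of the phases. -/
theorem recurrence_density (K : ℕ) (ρ : ℝ) (hρ : 0 < ρ) :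
    ∃ D : ℝ, 0 < D ∧ ∃ Y₀ : ℕ, ∀ (p : ℕ) [NeZero p] (Λ : Finset (ZMod p)), Λ.card ≤ K →
      ∀ Y : ℕ, Y₀ ≤ Y → D * Y ≤ ((recurrenceSet Λ ρ Y).card : ℝ) := by
  obtain ⟨M, hM0, hM⟩ := exists_bounded_recurrence K ρ hρ
  have hM' : (0 : ℝ) < M := by exact_mod_cast hM0
  refine ⟨1 / (2 * M ^ 2), by positivity, M, fun p _ Λ hΛ Y hY => ?_⟩
  -- Enumerates `Λ` by `Fin K`, padding with the frequency `0`.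
  have hex : ∃ e : Fin K → ZMod p, ∀ ξ ∈ Λ, ∃ i, e i = ξ := by
    refine ⟨fun i => Λ.toList.getD i 0, fun ξ hξ => ?_⟩
    obtain ⟨i, hi, h⟩ := List.mem_iff_getElem.mp (Finset.mem_toList.mpr hξ)
    refine ⟨⟨i, ?_⟩, ?_⟩
    · rw [Finset.length_toList] at hi
      omega
    · rw [← h]
      exact List.getD_eq_getElem _ _ hi
  obtain ⟨e, he⟩ := hex
  -- Bounded recurrence at the dilated frequencies `e i * d ^ 2` and `e i * d` yields a recurrence
  -- time `d * g d` for the original ones, for every `d`.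
  choose g hg0 hgM hg using fun d : ℕ =>
    hM p (fun i => e i * (d : ZMod p) ^ 2) (fun i => e i * (d : ZMod p))
  set G := recurrenceSet Λ ρ Y with hG
  have hmaps : ∀ d ∈ Icc 1 (Y / M), d * g d ∈ G := by
    intro d hd
    rw [Finset.mem_Icc] at hd
    rw [hG, recurrenceSet, Finset.mem_filter, Finset.mem_Icc]
    refine ⟨⟨Nat.mul_pos hd.1 (hg0 d), ?_⟩, fun ξ hξ => ?_⟩
    · calc d * g d ≤ (Y / M) * M := Nat.mul_le_mul hd.2 (hgM d)
        _ ≤ Y := Nat.div_mul_le_self _ _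
    · obtain ⟨i, rfl⟩ := he ξ hξ
      have := hg d i
      push_cast
      rwa [mul_pow, ← mul_assoc, ← mul_assoc]
  -- Each product `d * g d` arises at most `M` times, since `g d ≤ M` and `g d` determines `d` once
  -- the product is known.
  have hcard := Finset.card_le_mul_card_image_of_maps_to hmaps M (fun n _ => by
    have : #{d ∈ Icc 1 (Y / M) | d * g d = n} ≤ #(Icc 1 M) := by
      refine Finset.card_le_card_of_injOn g (fun d _ => ?_) (fun d hd d' hd' hdd => ?_)
      · exact Finset.mem_coe.mpr (Finset.mem_Icc.mpr ⟨hg0 d, hgM d⟩)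
      · simp only [Finset.coe_filter, Set.mem_ofPred_eq] at hd hd'
        have h1 : d * g d = d' * g d := by rw [hd.2, hdd, hd'.2]
        exact Nat.eq_of_mul_eq_mul_right (hg0 d) h1
    simpa using this)
  rw [Nat.card_Icc, Nat.add_sub_cancel] at hcard
  have h1 : (Y : ℝ) / (2 * M) ≤ (Y / M : ℕ) := by
    have h2 : Y < M * (Y / M + 1) := by
      rw [mul_add, mul_one]
      have := Nat.div_add_mod Y M
      have := Nat.mod_lt Y hM0
      omega
    have h3 : 1 ≤ Y / M := (Nat.one_le_div_iff hM0).mpr hY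
    have h4 : Y ≤ 2 * M * (Y / M) := by nlinarith
    rw [div_le_iff₀ (by positivity)]
    calc (Y : ℝ) ≤ ((2 * M * (Y / M) : ℕ) : ℝ) := by exact_mod_cast h4
      _ = _ := by push_cast; ring
  have h5 : ((Y / M : ℕ) : ℝ) ≤ M * G.card := by exact_mod_cast hcard
  have h6 : (Y : ℝ) / (2 * M) ≤ M * G.card := h1.trans h5
  rw [div_le_iff₀ (by positivity)] at h6
  rw [one_div, inv_mul_le_iff₀ (by positivity)]
  calc (Y : ℝ) ≤ M * G.card * (2 * M) := h6
    _ = _ := by ring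

/-- Among sufficiently many disjoint bands, one carries little of a given square sum. -/
theorem exists_sparse_band (Ψ : ℝ → ℝ) (hΨ : ∀ τ, 0 < τ → 0 < Ψ τ) (R ε : ℝ) (hε : 0 < ε) :
    ∃ (n : ℕ) (τ : ℕ → ℝ), (∀ k, 0 < τ k) ∧ ∀ {ι : Type} (S : Finset ι) (a : ι → ℝ),
      ∑ s ∈ S, a s ^ 2 ≤ R →
      ∃ k < n, ∑ s ∈ S with Ψ (τ k) ≤ a s ∧ a s < τ k, a s ^ 2 ≤ ε := by
  -- Each scale lies below the lower end of the preceding band, so the bands `[Ψ (τ k), τ k)` are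
  -- disjoint and fewer than `R / ε + 1` of them can each carry more than `ε`.
  obtain ⟨τ, hτz, hτs⟩ : ∃ τ : ℕ → ℝ, τ 0 = 1 ∧ ∀ k, τ (k + 1) = min (Ψ (τ k)) (τ k) :=
    ⟨fun k => Nat.rec (motive := fun _ => ℝ) 1 (fun _ x => min (Ψ x) x) k, rfl, fun _ => rfl⟩
  have hτ0 : ∀ k, 0 < τ k := by
    intro k
    induction k with
    | zero => rw [hτz]; exact one_pos
    | succ k ih => rw [hτs]; exact lt_min (hΨ _ ih) ih
  have hanti : Antitone τ := antitone_nat_of_succ_le fun k => by rw [hτs]; exact min_le_right _ _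
  obtain ⟨n, hn⟩ := exists_nat_gt (R / ε)
  refine ⟨n, τ, hτ0, fun {ι} S a hS => ?_⟩
  by_contra! hcon
  classical
  let band : ℕ → Finset ι := fun k => S.filter fun s => Ψ (τ k) ≤ a s ∧ a s < τ k
  have key : ∀ k k' : ℕ, k < k' → Disjoint (band k) (band k') := by
    intro k k' hkk
    rw [Finset.disjoint_left]
    intro s hs hs'
    rw [Finset.mem_filter] at hs hs'
    have h1 : τ k' ≤ τ (k + 1) := hanti hkk
    have h2 : τ (k + 1) ≤ Ψ (τ k) := by rw [hτs]; exact min_le_left _ _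
    linarith [hs.2.1, hs'.2.2]
  have hdisj : ((Finset.range n : Finset ℕ) : Set ℕ).PairwiseDisjoint band := by
    intro k _ k' _ hne
    rcases lt_or_gt_of_ne hne with h | h
    · exact key k k' h
    · exact (key k' k h).symm
  have h1 : ∑ k ∈ Finset.range n, ε ≤ ∑ s ∈ S, a s ^ 2 := by
    calc ∑ k ∈ Finset.range n, ε
        ≤ ∑ k ∈ Finset.range n, ∑ s ∈ S with Ψ (τ k) ≤ a s ∧ a s < τ k, a s ^ 2 :=
          Finset.sum_le_sum fun k hk => (hcon k (Finset.mem_range.mp hk)).le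
      _ = ∑ s ∈ (Finset.range n).biUnion band, a s ^ 2 := (Finset.sum_biUnion hdisj).symm
      _ ≤ ∑ s ∈ S, a s ^ 2 := by
          refine Finset.sum_le_sum_of_subset_of_nonneg ?_ fun _ _ _ => sq_nonneg _
          exact Finset.biUnion_subset.mpr fun k _ => Finset.filter_subset _ _
  rw [Finset.sum_const, Finset.card_range, nsmul_eq_mul] at h1
  rw [div_lt_iff₀ hε] at hn
  linarith

end Recurrence

/-! ### An elementary count of solutions of an equation in eight squares. -/

section SquareMoments

theorem card_Icc_filter_modEq_le (lo hi v r : ℤ) (hr : 0 < r) (h : lo ≤ hi + 1) :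
    (#{x ∈ Icc lo hi | x ≡ v [ZMOD r]} : ℝ) ≤ ((hi - lo + 1 : ℤ) : ℝ) / r + 1 := by
  have h1 : Icc lo hi = Ioc (lo - 1) hi := by
    ext x; simp only [Finset.mem_Icc, Finset.mem_Ioc]; omega
  have h2 := Int.Ioc_filter_modEq_card (lo - 1) hi hr v
  rw [h1]
  have hrq : (0 : ℚ) < r := by exact_mod_cast hr
  have h3 : ((#{x ∈ Ioc (lo - 1) hi | x ≡ v [ZMOD r]} : ℤ) : ℚ)
      ≤ ((hi - lo + 1 : ℤ) : ℚ) / r + 1 := by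
    rw [h2]
    push_cast
    refine max_le ?_ ?_
    · have a1 := Int.floor_le (((hi : ℚ) - v) / r)
      have a2 := Int.lt_floor_add_one ((((lo : ℚ) - 1) - v) / r)
      have e : ((hi : ℚ) - lo + 1) / r = ((hi : ℚ) - v) / r - (((lo : ℚ) - 1) - v) / r := by
        field_simp; ring
      rw [e]
      linarith
    · have : (0 : ℚ) ≤ (hi : ℚ) - lo + 1 := by
        have : (lo : ℚ) ≤ hi + 1 := by exact_mod_cast h
        linarith
      positivity
  exact_mod_cast h3

/-- The number of points of a box on the line `a v + b w = n`. -/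
noncomputable def lineCount (V : ℕ) (a b n : ℤ) : ℕ :=
  #{q ∈ Icc (-(V : ℤ)) V ×ˢ Icc (-(V : ℤ)) V | a * q.1 + b * q.2 = n}

theorem lineCount_comm (V : ℕ) (a b n : ℤ) : lineCount V a b n = lineCount V b a n := by
  unfold lineCount
  refine Finset.card_bij (fun q _ => (q.2, q.1)) ?_ ?_ ?_
  · intro q hq
    simp only [Finset.mem_filter, Finset.mem_product] at hq ⊢
    exact ⟨⟨hq.1.2, hq.1.1⟩, by linarith [hq.2]⟩
  · rintro ⟨a, b⟩ _ ⟨c, d⟩ _ h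
    simp only [Prod.mk.injEq] at h ⊢
    exact ⟨h.2, h.1⟩
  · rintro ⟨x, y⟩ hq
    simp only [Finset.mem_filter, Finset.mem_product] at hq
    refine ⟨(y, x), ?_, rfl⟩
    simp only [Finset.mem_filter, Finset.mem_product]
    exact ⟨⟨hq.1.2, hq.1.1⟩, by linarith [hq.2]⟩

/-- Coprimality fixes the second coordinate modulo `a`, and the second coordinate determines the
first. The rounding term `1` in counting a residue class is absorbed because `a.natAbs ≤ V`. -/
theorem lineCount_le_of_coprime (V : ℕ) (g a b n : ℤ) (hg : g ≠ 0) (hab : IsCoprime a b)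
    (ha : a ≠ 0) (haV : a.natAbs ≤ V) :
    (lineCount V (g * a) (g * b) n : ℝ) ≤ 4 * V / a.natAbs := by
  have hpos : 0 < a.natAbs := Int.natAbs_pos.mpr ha
  have hposR : (0 : ℝ) < a.natAbs := by exact_mod_cast hpos
  rcases Nat.eq_zero_or_pos (lineCount V (g * a) (g * b) n) with h0 | h0
  · rw [h0, Nat.cast_zero]; positivity
  obtain ⟨⟨v₀, w₀⟩, hq₀⟩ := Finset.card_pos.mp h0
  rw [Finset.mem_filter] at hq₀
  have hle : lineCount V (g * a) (g * b) n
      ≤ #{x ∈ Icc (-(V : ℤ)) V | x ≡ w₀ [ZMOD (a.natAbs : ℤ)]} := by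
    refine Finset.card_le_card_of_injOn (fun q => q.2) ?_ ?_
    · rintro ⟨v, w⟩ hq
      simp only [Finset.coe_filter, Finset.mem_product, Set.mem_ofPred_eq] at hq ⊢
      refine ⟨hq.1.2, ?_⟩
      have h1 : g * (a * (v - v₀) + b * (w - w₀)) = 0 := by linarith [hq.2, hq₀.2]
      have h2 := (mul_eq_zero.mp h1).resolve_left hg
      have h3 : a ∣ b * (w - w₀) := ⟨v₀ - v, by linarith⟩
      have h4 := hab.dvd_of_dvd_mul_left h3
      exact (Int.modEq_iff_dvd.mpr (Int.natAbs_dvd.mpr h4)).symm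
    · rintro ⟨v, w⟩ hq ⟨v', w'⟩ hq' (rfl : w = w')
      simp only [Finset.coe_filter, Finset.mem_product, Set.mem_ofPred_eq] at hq hq'
      have h1 : (g * a) * (v - v') = 0 := by linarith [hq.2, hq'.2]
      have h2 := (mul_eq_zero.mp h1).resolve_left (mul_ne_zero hg ha)
      rw [sub_eq_zero.mp h2]
  have h5 := card_Icc_filter_modEq_le (-(V : ℤ)) V w₀ a.natAbs (by exact_mod_cast hpos) (by omega)
  have h6 : (lineCount V (g * a) (g * b) n : ℝ)
      ≤ #{x ∈ Icc (-(V : ℤ)) V | x ≡ w₀ [ZMOD (a.natAbs : ℤ)]} := by exact_mod_cast hle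
  refine (h6.trans h5).trans ?_
  have hV : (a.natAbs : ℝ) ≤ V := by exact_mod_cast haV
  have h1a : (1 : ℝ) ≤ a.natAbs := by exact_mod_cast hpos
  rw [div_add_one (by exact_mod_cast hpos.ne')]
  have e : (((a.natAbs : ℤ)) : ℝ) = (a.natAbs : ℝ) := Int.cast_natCast _
  rw [e]
  gcongr
  have e2 : (((V : ℤ) - -(V : ℤ) + 1 : ℤ) : ℝ) = 2 * V + 1 := by push_cast; ring
  rw [e2]
  linarith

/-- The height of the primitive vector proportional to `(a, b)`. -/
noncomputable def primitiveHeight (a b : ℤ) : ℕ := max a.natAbs b.natAbs / Int.gcd a b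

/-- Reduces to the coprime case by taking out the gcd and, by symmetry, arranging that the first
coefficient is the larger one. -/
theorem lineCount_le (V : ℕ) (a b n : ℤ) (hab : 0 < Int.gcd a b) (ha : a.natAbs ≤ V)
    (hb : b.natAbs ≤ V) : (lineCount V a b n : ℝ) ≤ 4 * V / primitiveHeight a b := by
  wlog h : b.natAbs ≤ a.natAbs generalizing a b
  · have := this b a (by rwa [Int.gcd_comm]) hb ha (by omega)
    rw [lineCount_comm]
    refine this.trans (le_of_eq ?_)
    rw [primitiveHeight, primitiveHeight, max_comm, Int.gcd_comm]
  obtain ⟨a', b', hcop, ha', hb'⟩ := Int.exists_gcd_one hab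
  set g := Int.gcd a b with hg
  have hg0 : (g : ℤ) ≠ 0 := by exact_mod_cast hab.ne'
  have hcop' : IsCoprime a' b' := Int.isCoprime_iff_gcd_eq_one.mpr hcop
  have hna : a.natAbs = a'.natAbs * g := by rw [ha', Int.natAbs_mul, Int.natAbs_natCast]
  have hmax : primitiveHeight a b = a'.natAbs := by
    rw [primitiveHeight, max_eq_left h, ← hg, hna, Nat.mul_div_cancel _ hab]
  have ha0 : a' ≠ 0 := by
    rintro rfl
    have h1 : a = 0 := by simpa using ha'
    have h2 : b = 0 := by
      rw [h1] at h; simpa using h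
    rw [h1, h2] at hg
    simp at hg
    omega
  rw [hmax]
  have := lineCount_le_of_coprime V g a' b' n hg0 hcop' ha0 ?_
  · rwa [mul_comm (g : ℤ) a', mul_comm (g : ℤ) b', ← ha', ← hb'] at this
  · refine le_trans ?_ ha
    rw [hna]
    exact Nat.le_mul_of_pos_right _ hab

theorem lineCount_le_sq (V : ℕ) (a b n : ℤ) : lineCount V a b n ≤ (2 * V + 1) ^ 2 := by
  refine (Finset.card_filter_le _ _).trans ?_
  rw [Finset.card_product, Int.card_Icc, sq]
  have : ((V : ℤ) + 1 - -(V : ℤ)).toNat = 2 * V + 1 := by omega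
  rw [this]

/-- Division by the gcd embeds these pairs in the boundary of the square of side `2 m`, which is
covered by four segments of `2 m + 1` points. -/
theorem card_primitiveHeight_le (V g m : ℕ) (hm : 0 < m) :
    #{q ∈ Icc (-(V : ℤ)) V ×ˢ Icc (-(V : ℤ)) V |
      0 < Int.gcd q.1 q.2 ∧ Int.gcd q.1 q.2 = g ∧ primitiveHeight q.1 q.2 = m} ≤ 12 * m := by
  have hle : #{q ∈ Icc (-(V : ℤ)) V ×ˢ Icc (-(V : ℤ)) V |
      0 < Int.gcd q.1 q.2 ∧ Int.gcd q.1 q.2 = g ∧ primitiveHeight q.1 q.2 = m}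
      ≤ #((({(m : ℤ), -(m : ℤ)} : Finset ℤ) ×ˢ Icc (-(m : ℤ)) m)
          ∪ (Icc (-(m : ℤ)) m ×ˢ ({(m : ℤ), -(m : ℤ)} : Finset ℤ))) := by
    refine Finset.card_le_card_of_injOn (fun q => (q.1 / g, q.2 / g)) ?_ ?_
    · rintro ⟨a, b⟩ hq
      simp only [Finset.coe_filter, Set.mem_ofPred_eq] at hq
      obtain ⟨-, hpos, hgcd, hh⟩ := hq
      obtain ⟨a', ha'⟩ := Int.gcd_dvd_left a b
      obtain ⟨b', hb'⟩ := Int.gcd_dvd_right a b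
      rw [hgcd] at ha' hb' hpos
      have hgz : (g : ℤ) ≠ 0 := by exact_mod_cast hpos.ne'
      have hm' : max a'.natAbs b'.natAbs = m := by
        rw [← hh, primitiveHeight, hgcd, ha', hb', Int.natAbs_mul, Int.natAbs_mul,
          Int.natAbs_natCast, Nat.mul_max_mul_left, Nat.mul_div_cancel_left _ hpos]
      simp only [Finset.coe_union, Set.mem_union, Finset.mem_coe, Finset.mem_product,
        Finset.mem_insert, Finset.mem_singleton, Finset.mem_Icc]
      rw [ha', hb', Int.mul_ediv_cancel_left _ hgz, Int.mul_ediv_cancel_left _ hgz]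
      omega
    · rintro ⟨a, b⟩ hq ⟨c, d⟩ hq' h
      simp only [Finset.coe_filter, Set.mem_ofPred_eq] at hq hq'
      simp only [Prod.mk.injEq] at h ⊢
      obtain ⟨-, -, h1, -⟩ := hq
      obtain ⟨-, -, h2, -⟩ := hq'
      have a1 : (g : ℤ) ∣ a := h1 ▸ Int.gcd_dvd_left a b
      have a2 : (g : ℤ) ∣ b := h1 ▸ Int.gcd_dvd_right a b
      have a3 : (g : ℤ) ∣ c := h2 ▸ Int.gcd_dvd_left c d
      have a4 : (g : ℤ) ∣ d := h2 ▸ Int.gcd_dvd_right c d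
      exact ⟨(Int.ediv_left_inj a1 a3).mp h.1, (Int.ediv_left_inj a2 a4).mp h.2⟩
  refine hle.trans ((Finset.card_union_le _ _).trans ?_)
  rw [Finset.card_product, Finset.card_product, Int.card_Icc]
  have h1 : #({(m : ℤ), -(m : ℤ)} : Finset ℤ) ≤ 2 := Finset.card_le_two
  have h2 : ((m : ℤ) + 1 - -(m : ℤ)).toNat = 2 * m + 1 := by omega
  rw [h2]
  nlinarith

/-- Lines through the box are shorter the larger their primitive height, so the typical square root
is bounded. The right hand side may vary with the pair so that the worst one can be inserted later.
-/
theorem sum_sqrt_lineCount_le :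
    ∃ C : ℝ, 0 < C ∧ ∀ V : ℕ, 0 < V → ∀ n : ℤ × ℤ → ℤ,
      ∑ q ∈ Icc (-(V : ℤ)) V ×ˢ Icc (-(V : ℤ)) V, √(lineCount V q.1 q.2 (n q) : ℝ)
        ≤ C * V ^ 2 := by
  have hs : Summable fun g : ℕ => 1 / (g : ℝ) ^ (3 / 2 : ℝ) :=
    Real.summable_one_div_nat_rpow.mpr (by norm_num)
  set C₀ := ∑' g : ℕ, 1 / (g : ℝ) ^ (3 / 2 : ℝ) with hC₀
  have hC₀0 : 0 ≤ C₀ := tsum_nonneg fun _ => by positivity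
  refine ⟨24 * C₀ + 3, by positivity, fun V hV n => ?_⟩
  have hV1 : (1 : ℝ) ≤ V := by exact_mod_cast hV
  set P := Icc (-(V : ℤ)) V ×ˢ Icc (-(V : ℤ)) V with hP
  rw [← Finset.sum_filter_add_sum_filter_not P (fun q => 0 < Int.gcd q.1 q.2)]
  -- Only the pair `(0, 0)` has gcd zero, and it contributes at most `3 V`.
  have hzero : ∑ q ∈ P with ¬ 0 < Int.gcd q.1 q.2, √(lineCount V q.1 q.2 (n q) : ℝ)
      ≤ 3 * V ^ 2 := by
    have hsub : P.filter (fun q => ¬ 0 < Int.gcd q.1 q.2) ⊆ {(0, 0)} := by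
      rintro ⟨a, b⟩ hq
      rw [Finset.mem_filter] at hq
      have := Int.gcd_eq_zero_iff.mp (Nat.eq_zero_of_not_pos hq.2)
      simpa using this
    refine (Finset.sum_le_sum_of_subset_of_nonneg hsub fun _ _ _ => Real.sqrt_nonneg _).trans ?_
    rw [Finset.sum_singleton]
    have h1 : (lineCount V 0 0 (n (0, 0)) : ℝ) ≤ (3 * V) ^ 2 := by
      have := lineCount_le_sq V 0 0 (n (0, 0))
      have h2 : (lineCount V 0 0 (n (0, 0)) : ℝ) ≤ (2 * V + 1) ^ 2 := by exact_mod_cast this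
      refine h2.trans ?_
      gcongr
      linarith
    refine (Real.sqrt_le_left (by positivity)).mpr h1 |>.trans ?_
    nlinarith
  have hmain : ∑ q ∈ P with 0 < Int.gcd q.1 q.2, √(lineCount V q.1 q.2 (n q) : ℝ)
      ≤ 24 * C₀ * V ^ 2 := by
    set T := (Icc 1 V ×ˢ Icc 1 V).filter fun t : ℕ × ℕ => t.1 * t.2 ≤ V with hT
    have hmap : ∀ q ∈ P.filter (fun q => 0 < Int.gcd q.1 q.2),
        (Int.gcd q.1 q.2, primitiveHeight q.1 q.2) ∈ T := by
      rintro ⟨a, b⟩ hq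
      rw [Finset.mem_filter, hP, Finset.mem_product, Finset.mem_Icc, Finset.mem_Icc] at hq
      obtain ⟨⟨ha, hb⟩, hg⟩ := hq
      simp only at ha hb hg
      have hmaxV : max a.natAbs b.natAbs ≤ V := by omega
      have h1 : Int.gcd a b * primitiveHeight a b ≤ max a.natAbs b.natAbs := Nat.mul_div_le _ _
      have hd1 : Int.gcd a b ∣ a.natAbs := Nat.gcd_dvd_left _ _
      have hd2 : Int.gcd a b ∣ b.natAbs := Nat.gcd_dvd_right _ _
      have h2 : Int.gcd a b ≤ max a.natAbs b.natAbs := by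
        rcases Nat.eq_zero_or_pos a.natAbs with h0 | h0
        · rcases Nat.eq_zero_or_pos b.natAbs with h0' | h0'
          · exfalso
            rw [Int.natAbs_eq_zero] at h0 h0'
            rw [h0, h0'] at hg
            simp at hg
          · exact (Nat.le_of_dvd h0' hd2).trans (le_max_right _ _)
        · exact (Nat.le_of_dvd h0 hd1).trans (le_max_left _ _)
      have h3 : 0 < primitiveHeight a b := Nat.div_pos h2 hg
      have h4 : primitiveHeight a b ≤ Int.gcd a b * primitiveHeight a b :=
        Nat.le_mul_of_pos_left _ hg
      rw [hT, Finset.mem_filter, Finset.mem_product, Finset.mem_Icc, Finset.mem_Icc]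
      simp only
      omega
    rw [← Finset.sum_fiberwise_of_maps_to hmap]
    -- At gcd `g` and height `m` there are at most `12 m` pairs, each contributing at most `2 √V /
    -- √m`.
    have hfib : ∀ t ∈ T, ∑ q ∈ P.filter (fun q => 0 < Int.gcd q.1 q.2) with
        (Int.gcd q.1 q.2, primitiveHeight q.1 q.2) = t, √(lineCount V q.1 q.2 (n q) : ℝ)
          ≤ 24 * (√V * √t.2) := by
      rintro ⟨g, m⟩ ht
      rw [hT, Finset.mem_filter, Finset.mem_product, Finset.mem_Icc, Finset.mem_Icc] at ht
      simp only at ht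
      have hm : 0 < m := by omega
      have hmR : (0 : ℝ) < m := by exact_mod_cast hm
      have hb : ∀ q ∈ (P.filter (fun q => 0 < Int.gcd q.1 q.2)).filter (fun q =>
          (Int.gcd q.1 q.2, primitiveHeight q.1 q.2) = (g, m)),
          √(lineCount V q.1 q.2 (n q) : ℝ) ≤ 2 * √V / √m := by
        rintro ⟨a, b⟩ hq
        rw [Finset.mem_filter, Finset.mem_filter, hP, Finset.mem_product, Finset.mem_Icc,
          Finset.mem_Icc, Prod.mk.injEq] at hq
        obtain ⟨⟨⟨ha, hb⟩, hg⟩, -, hh⟩ := hq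
        simp only at ha hb hg hh
        have h1 := lineCount_le V a b (n (a, b)) hg (by omega) (by omega)
        rw [hh] at h1
        calc √(lineCount V a b (n (a, b)) : ℝ) ≤ √(4 * V / m) := Real.sqrt_le_sqrt h1
          _ = 2 * √V / √m := by
            rw [Real.sqrt_div (by positivity), Real.sqrt_mul (by norm_num)]
            congr 2
            rw [show (4 : ℝ) = 2 ^ 2 by norm_num, Real.sqrt_sq (by norm_num)]
      refine (Finset.sum_le_sum hb).trans ?_
      rw [Finset.sum_const, nsmul_eq_mul]
      have hcard := card_primitiveHeight_le V g m hm
      have hc : (#((P.filter (fun q => 0 < Int.gcd q.1 q.2)).filter (fun q =>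
          (Int.gcd q.1 q.2, primitiveHeight q.1 q.2) = (g, m))) : ℝ) ≤ 12 * m := by
        rw [Finset.filter_filter]
        simp only [Prod.mk.injEq]
        exact_mod_cast hcard
      calc _ ≤ 12 * (m : ℝ) * (2 * √V / √m) := by gcongr
        _ = 24 * (√V * √m) := by
          have h5 : √(m : ℝ) * √m = m := Real.mul_self_sqrt hmR.le
          have h6 : √(m : ℝ) ≠ 0 := (Real.sqrt_pos.mpr hmR).ne'
          field_simp
          rw [sq, h5]
          ring
    refine (Finset.sum_le_sum hfib).trans ?_
    rw [← Finset.mul_sum, ← Finset.mul_sum, hT, Finset.sum_filter, Finset.sum_product]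
    -- At most `V / g` values of `m`, each with `√m ≤ √(V / g)`: the total `(V / g) ^ (3 / 2)` is
    -- summable over `g`.
    have hinner : ∀ g ∈ Icc 1 V, ∑ m ∈ Icc 1 V, (if g * m ≤ V then √(m : ℝ) else 0)
        ≤ V * √V * (1 / (g : ℝ) ^ (3 / 2 : ℝ)) := by
      intro g hg
      rw [Finset.mem_Icc] at hg
      have hgR : (0 : ℝ) < g := by exact_mod_cast hg.1
      have hdiv : ∀ m : ℕ, g * m ≤ V → (m : ℝ) ≤ V / g := by
        intro m hm
        rw [le_div_iff₀ hgR, mul_comm]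
        exact_mod_cast hm
      rw [← Finset.sum_filter]
      have hle : ∀ m ∈ (Icc 1 V).filter (fun m => g * m ≤ V), √(m : ℝ) ≤ √(V / g) := by
        intro m hm
        exact Real.sqrt_le_sqrt (hdiv m (Finset.mem_filter.mp hm).2)
      refine (Finset.sum_le_sum hle).trans ?_
      rw [Finset.sum_const, nsmul_eq_mul]
      have hsub : (Icc 1 V).filter (fun m => g * m ≤ V) ⊆ Icc 1 (V / g) := by
        intro m hm
        rw [Finset.mem_filter, Finset.mem_Icc] at hm
        rw [Finset.mem_Icc, Nat.le_div_iff_mul_le hg.1, mul_comm]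
        exact ⟨hm.1.1, hm.2⟩
      have hcard := Finset.card_le_card hsub
      rw [Nat.card_Icc, Nat.add_sub_cancel] at hcard
      have hc2 : (#((Icc 1 V).filter (fun m => g * m ≤ V)) : ℝ) ≤ V / g :=
        (Nat.cast_le.mpr hcard).trans Nat.cast_div_le
      calc _ ≤ (V : ℝ) / g * √(V / g) := by gcongr
        _ = V * √V * (1 / (g : ℝ) ^ (3 / 2 : ℝ)) := by
          have h7 : (g : ℝ) ^ (3 / 2 : ℝ) = g * √g := by
            rw [Real.sqrt_eq_rpow, show (3 / 2 : ℝ) = 1 + 1 / 2 by norm_num,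
              Real.rpow_add hgR, Real.rpow_one]
          rw [h7, Real.sqrt_div (by positivity)]
          field_simp
    have hsum : ∑ g ∈ Icc 1 V, ∑ m ∈ Icc 1 V, (if g * m ≤ V then √(m : ℝ) else 0)
        ≤ V * √V * C₀ := by
      refine (Finset.sum_le_sum hinner).trans ?_
      rw [← Finset.mul_sum]
      gcongr
      exact hs.sum_le_tsum _ fun _ _ => by positivity
    calc _ ≤ 24 * (√V * (V * √V * C₀)) := by gcongr
      _ = 24 * C₀ * V * (√V * √V) := by ring
      _ = 24 * C₀ * V ^ 2 := by rw [Real.mul_self_sqrt (by positivity)]; ring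
  calc _ ≤ 24 * C₀ * V ^ 2 + 3 * V ^ 2 := add_le_add hmain hzero
    _ = _ := by ring

theorem exists_max_lineCount (V : ℕ) (a b : ℤ) :
    ∃ n₀, ∀ n, lineCount V a b n ≤ lineCount V a b n₀ := by
  have hb : BddAbove (Set.range (lineCount V a b)) :=
    ⟨(2 * V + 1) ^ 2, by rintro _ ⟨n, rfl⟩; exact lineCount_le_sq V a b n⟩
  obtain ⟨n₀, hn₀⟩ := Nat.sSup_mem (Set.range_nonempty _) hb
  exact ⟨n₀, fun n => hn₀ ▸ le_csSup hb ⟨n, rfl⟩⟩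

/-- Few points of a box lie on the quadric `u₁v₁ + u₂v₂ + u₃v₃ + u₄v₄ = n`. -/
theorem card_bilinear_le :
    ∃ C : ℝ, 0 < C ∧ ∀ V : ℕ, 0 < V → ∀ n : ℤ, ∀ P : Finset (ℤ × ℤ),
      P = Icc (-(V : ℤ)) V ×ˢ Icc (-(V : ℤ)) V →
      (#{t ∈ (P ×ˢ P) ×ˢ (P ×ˢ P) |
        (t.1.1.1 * t.2.1.1 + t.1.1.2 * t.2.1.2) + (t.1.2.1 * t.2.2.1 + t.1.2.2 * t.2.2.2) = n} : ℝ)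
        ≤ C * V ^ 6 := by
  obtain ⟨C, hC, hsum⟩ := sum_sqrt_lineCount_le
  refine ⟨9 * C ^ 2, by positivity, fun V hV n P hP => ?_⟩
  choose n₀ hn₀ using fun q : ℤ × ℤ => exists_max_lineCount V q.1 q.2
  have hV1 : (1 : ℝ) ≤ V := by exact_mod_cast hV
  set L : ℤ × ℤ → ℕ := fun q => lineCount V q.1 q.2 (n₀ q) with hL
  have hPcard : (P.card : ℝ) ≤ 9 * V ^ 2 := by
    have : P.card = (2 * V + 1) ^ 2 := by
      rw [hP, Finset.card_product, Int.card_Icc, sq]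
      have : ((V : ℤ) + 1 - -(V : ℤ)).toNat = 2 * V + 1 := by omega
      rw [this]
    rw [this]
    push_cast
    nlinarith
  have hfix : ∀ u : (ℤ × ℤ) × (ℤ × ℤ), (#{v ∈ P ×ˢ P |
      (u.1.1 * v.1.1 + u.1.2 * v.1.2) + (u.2.1 * v.2.1 + u.2.2 * v.2.2) = n} : ℝ)
        ≤ 9 * V ^ 2 * (√(L u.1) * √(L u.2)) := by
    -- With `u` and one of the two pairs in `v` fixed, the other pair runs over a line. This gives
    -- two bounds for the count, whose geometric mean separates `u.1` from `u.2`, so that the sum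
    -- over `u` factors into a square.
    intro u
    set A := #{v ∈ P ×ˢ P |
      (u.1.1 * v.1.1 + u.1.2 * v.1.2) + (u.2.1 * v.2.1 + u.2.2 * v.2.2) = n} with hA
    have h1 : A ≤ P.card * L u.1 := by
      rw [hA, Finset.card_filter, Finset.sum_product_right, ← smul_eq_mul]
      refine Finset.sum_le_card_nsmul _ _ _ fun v₂ _ => ?_
      rw [← Finset.card_filter]
      refine le_trans (le_of_eq ?_) (hn₀ u.1 (n - (u.2.1 * v₂.1 + u.2.2 * v₂.2)))
      unfold lineCount
      rw [← hP]
      congr 1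
      refine Finset.filter_congr fun v _ => ?_
      constructor <;> intro h <;> linarith
    have h2 : A ≤ P.card * L u.2 := by
      rw [hA, Finset.card_filter, Finset.sum_product, ← smul_eq_mul]
      refine Finset.sum_le_card_nsmul _ _ _ fun v₂ _ => ?_
      rw [← Finset.card_filter]
      refine le_trans (le_of_eq ?_) (hn₀ u.2 (n - (u.1.1 * v₂.1 + u.1.2 * v₂.2)))
      unfold lineCount
      rw [← hP]
      congr 1
      refine Finset.filter_congr fun v _ => ?_
      constructor <;> intro h <;> linarith
    have h1' : (A : ℝ) ≤ P.card * L u.1 := by exact_mod_cast h1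
    have h2' : (A : ℝ) ≤ P.card * L u.2 := by exact_mod_cast h2
    have h3 : (A : ℝ) ≤ P.card * (√(L u.1) * √(L u.2)) := by
      calc (A : ℝ) = √A * √A := (Real.mul_self_sqrt (Nat.cast_nonneg _)).symm
        _ ≤ √(P.card * L u.1) * √(P.card * L u.2) := by gcongr
        _ = (√(P.card : ℝ) * √(P.card : ℝ)) * (√(L u.1) * √(L u.2)) := by
          rw [Real.sqrt_mul (Nat.cast_nonneg _), Real.sqrt_mul (Nat.cast_nonneg _)]
          ring
        _ = _ := by rw [Real.mul_self_sqrt (Nat.cast_nonneg _)]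
    refine h3.trans ?_
    gcongr
  have hcount : (#{t ∈ (P ×ˢ P) ×ˢ (P ×ˢ P) |
        (t.1.1.1 * t.2.1.1 + t.1.1.2 * t.2.1.2) + (t.1.2.1 * t.2.2.1 + t.1.2.2 * t.2.2.2) = n} : ℝ)
      = ∑ u ∈ P ×ˢ P, (#{v ∈ P ×ˢ P |
      (u.1.1 * v.1.1 + u.1.2 * v.1.2) + (u.2.1 * v.2.1 + u.2.2 * v.2.2) = n} : ℝ) := by
    rw [← Nat.cast_sum]
    congr 1
    rw [Finset.card_filter, Finset.sum_product]
    refine Finset.sum_congr rfl fun u _ => ?_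
    rw [Finset.card_filter]
  rw [hcount]
  refine (Finset.sum_le_sum fun u _ => hfix u).trans ?_
  rw [← Finset.mul_sum, Finset.sum_product]
  simp_rw [← Finset.mul_sum]
  rw [← Finset.sum_mul]
  have hs1 := hsum V hV n₀
  rw [← hP] at hs1
  have hs0 : 0 ≤ ∑ q ∈ P, √(L q : ℝ) := Finset.sum_nonneg fun _ _ => Real.sqrt_nonneg _
  calc 9 * (V : ℝ) ^ 2 * ((∑ q ∈ P, √(L q : ℝ)) * ∑ q ∈ P, √(L q : ℝ))
      ≤ 9 * (V : ℝ) ^ 2 * ((C * V ^ 2) * (C * V ^ 2)) := by gcongr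
    _ = 9 * C ^ 2 * V ^ 6 := by ring

/-- Few eight-tuples of integers up to `Y` have a given value of an alternating sum of eight
squares. -/
theorem card_eight_squares_le :
    ∃ C : ℝ, 0 < C ∧ ∀ Y : ℕ, 0 < Y → ∀ n : ℤ, ∀ B : Finset ℤ, B ⊆ Icc 1 (Y : ℤ) →
      (#{t ∈ ((B ×ˢ B) ×ˢ (B ×ˢ B)) ×ˢ ((B ×ˢ B) ×ˢ (B ×ˢ B)) |
        ((t.1.1.1 ^ 2 - t.1.1.2 ^ 2) + (t.1.2.1 ^ 2 - t.1.2.2 ^ 2))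
          + ((t.2.1.1 ^ 2 - t.2.1.2 ^ 2) + (t.2.2.1 ^ 2 - t.2.2.2 ^ 2)) = n} : ℝ) ≤ C * Y ^ 6 := by
  obtain ⟨C, hC, h⟩ := card_bilinear_le
  refine ⟨C * 2 ^ 6, by positivity, fun Y hY n B hB => ?_⟩
  have h1 := h (2 * Y) (by omega) n _ rfl
  have e : C * 2 ^ 6 * (Y : ℝ) ^ 6 = C * ((2 * Y : ℕ) : ℝ) ^ 6 := by push_cast; ring
  rw [e]
  refine le_trans ?_ h1
  rw [Nat.cast_le]
  -- A difference of squares is the product of difference and sum, and these determine both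
  -- variables. They are bounded by `2 Y`, hence the box of size `2 * Y`.
  refine Finset.card_le_card_of_injOn (fun t =>
    (((t.1.1.1 - t.1.1.2, t.1.2.1 - t.1.2.2), (t.2.1.1 - t.2.1.2, t.2.2.1 - t.2.2.2)),
     ((t.1.1.1 + t.1.1.2, t.1.2.1 + t.1.2.2), (t.2.1.1 + t.2.1.2, t.2.2.1 + t.2.2.2)))) ?_ ?_
  · rintro ⟨⟨⟨a, b⟩, ⟨c, d⟩⟩, ⟨⟨a', b'⟩, ⟨c', d'⟩⟩⟩ ht
    have hm : ∀ x ∈ B, 1 ≤ x ∧ x ≤ (Y : ℤ) := fun x hx => Finset.mem_Icc.mp (hB hx)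
    simp only [Finset.coe_filter, Set.mem_ofPred_eq, Finset.mem_product] at ht
    obtain ⟨⟨⟨⟨ha, hb⟩, hc, hd⟩, ⟨ha', hb'⟩, hc', hd'⟩, heq⟩ := ht
    have := hm _ ha; have := hm _ hb; have := hm _ hc; have := hm _ hd
    have := hm _ ha'; have := hm _ hb'; have := hm _ hc'; have := hm _ hd'
    simp only [Finset.coe_filter, Set.mem_ofPred_eq, Finset.mem_product, Finset.mem_Icc]
    push_cast
    refine ⟨⟨⟨⟨⟨?_, ?_⟩, ?_, ?_⟩, ⟨?_, ?_⟩, ?_, ?_⟩, ⟨⟨?_, ?_⟩, ?_, ?_⟩, ⟨?_, ?_⟩, ?_, ?_⟩, ?_⟩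
    all_goals first | omega | linarith
  · rintro ⟨⟨⟨a, b⟩, ⟨c, d⟩⟩, ⟨⟨a', b'⟩, ⟨c', d'⟩⟩⟩ - ⟨⟨⟨x, y⟩, ⟨z, w⟩⟩, ⟨⟨x', y'⟩, ⟨z', w'⟩⟩⟩ - heq
    simp only [Prod.mk.injEq] at heq ⊢
    omega

end SquareMoments

/-! ### Moments of exponential sums and the frequencies where they are large. -/

section LevelSets

/-- The exponential sum with phases `f y` for `y` in `B`. -/
noncomputable def phaseSum {p : ℕ} [NeZero p] {ι : Type*} (B : Finset ι) (f : ι → ZMod p)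
    (ξ : ZMod p) : ℂ := ∑ y ∈ B, stdAddChar (ξ * f y)

variable {p : ℕ} [NeZero p]

theorem norm_phaseSum_le {ι : Type*} (B : Finset ι) (f : ι → ZMod p) (ξ : ZMod p) :
    ‖phaseSum B f ξ‖ ≤ B.card := by
  refine (norm_sum_le _ _).trans ?_
  simp

theorem phaseSum_mul_phaseSum {ι κ : Type*} (B : Finset ι) (B' : Finset κ) (f : ι → ZMod p)
    (g : κ → ZMod p) (ξ : ZMod p) :
    phaseSum B f ξ * phaseSum B' g ξ = phaseSum (B ×ˢ B') (fun q => f q.1 + g q.2) ξ := by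
  unfold phaseSum
  rw [Finset.sum_mul_sum, ← Finset.sum_product']
  refine Finset.sum_congr rfl fun q _ => ?_
  rw [mul_add, AddChar.map_add_eq_mul]

theorem norm_sq_phaseSum {ι : Type*} (B : Finset ι) (f : ι → ZMod p) (ξ : ZMod p) :
    ((‖phaseSum B f ξ‖ ^ 2 : ℝ) : ℂ) = phaseSum (B ×ˢ B) (fun q => f q.1 - f q.2) ξ := by
  have h : (starRingEnd ℂ) (phaseSum B f ξ) = phaseSum B (fun y => -f y) ξ := by
    unfold phaseSum
    rw [map_sum]
    refine Finset.sum_congr rfl fun y _ => ?_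
    rw [conj_stdAddChar, mul_neg]
  have h2 : ((‖phaseSum B f ξ‖ ^ 2 : ℝ) : ℂ)
      = phaseSum B f ξ * (starRingEnd ℂ) (phaseSum B f ξ) := by
    rw [Complex.mul_conj, Complex.normSq_eq_norm_sq]
  rw [h2, h, phaseSum_mul_phaseSum]
  simp only [← sub_eq_add_neg]

theorem sum_phaseSum {ι : Type*} (B : Finset ι) (f : ι → ZMod p) :
    ∑ ξ, phaseSum B f ξ = p * (#{y ∈ B | f y = 0} : ℂ) := by
  have := sum_sum_stdAddChar B f (fun _ => 1)
  simp only [one_mul] at this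
  unfold phaseSum
  rw [this, Finset.card_filter]
  push_cast
  rfl

/-- Each squared modulus is an exponential sum over differences, so the product is a single
exponential sum and orthogonality counts its zero phases. -/
theorem sum_moment_eq {ι κ : Type*} (B : Finset ι) (D : Finset κ) (f : ι → ZMod p)
    (g : κ → ZMod p) :
    ∑ ξ, ‖phaseSum B f ξ‖ ^ 8 * ‖phaseSum D g ξ‖ ^ 2
      = p * (#{t ∈ (((B ×ˢ B) ×ˢ (B ×ˢ B)) ×ˢ ((B ×ˢ B) ×ˢ (B ×ˢ B))) ×ˢ (D ×ˢ D) |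
        (((f t.1.1.1.1 - f t.1.1.1.2) + (f t.1.1.2.1 - f t.1.1.2.2))
          + ((f t.1.2.1.1 - f t.1.2.1.2) + (f t.1.2.2.1 - f t.1.2.2.2)))
          + (g t.2.1 - g t.2.2) = 0} : ℝ) := by
  have key : ∀ ξ, ((‖phaseSum B f ξ‖ ^ 8 * ‖phaseSum D g ξ‖ ^ 2 : ℝ) : ℂ)
      = phaseSum ((((B ×ˢ B) ×ˢ (B ×ˢ B)) ×ˢ ((B ×ˢ B) ×ˢ (B ×ˢ B))) ×ˢ (D ×ˢ D))
        (fun t => (((f t.1.1.1.1 - f t.1.1.1.2) + (f t.1.1.2.1 - f t.1.1.2.2))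
          + ((f t.1.2.1.1 - f t.1.2.1.2) + (f t.1.2.2.1 - f t.1.2.2.2)))
          + (g t.2.1 - g t.2.2)) ξ := by
    intro ξ
    have e : ‖phaseSum B f ξ‖ ^ 8 = ((‖phaseSum B f ξ‖ ^ 2) * (‖phaseSum B f ξ‖ ^ 2))
        * ((‖phaseSum B f ξ‖ ^ 2) * (‖phaseSum B f ξ‖ ^ 2)) := by ring
    rw [e, Complex.ofReal_mul, Complex.ofReal_mul, Complex.ofReal_mul, norm_sq_phaseSum,
      norm_sq_phaseSum, phaseSum_mul_phaseSum, phaseSum_mul_phaseSum, phaseSum_mul_phaseSum]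
  have h : ((∑ ξ, ‖phaseSum B f ξ‖ ^ 8 * ‖phaseSum D g ξ‖ ^ 2 : ℝ) : ℂ)
      = ((p * (#{t ∈ (((B ×ˢ B) ×ˢ (B ×ˢ B)) ×ˢ ((B ×ˢ B) ×ˢ (B ×ˢ B))) ×ˢ (D ×ˢ D) |
        (((f t.1.1.1.1 - f t.1.1.1.2) + (f t.1.1.2.1 - f t.1.1.2.2))
          + ((f t.1.2.1.1 - f t.1.2.1.2) + (f t.1.2.2.1 - f t.1.2.2.2)))
          + (g t.2.1 - g t.2.2) = 0} : ℝ) : ℝ) : ℂ) := by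
    rw [Complex.ofReal_sum]
    simp_rw [key]
    rw [sum_phaseSum]
    push_cast
    rfl
  exact_mod_cast h

/-- A mixed moment of a quadratic and a linear exponential sum. -/
theorem moment_le :
    ∃ C : ℝ, 0 < C ∧ ∀ (p : ℕ) [NeZero p] (Y : ℕ) (B D : Finset ℤ) (a b Z : ℤ) (R : ℝ),
      0 < Y → B ⊆ Icc 1 (Y : ℤ) → a ≠ 0 → (∀ z ∈ D, ∀ z' ∈ D, |z - z'| ≤ Z) →
      4 * |a| * Y ^ 2 + |b| * Z < p → (#{w ∈ D ×ˢ D | a ∣ b * (w.1 - w.2)} : ℝ) ≤ R →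
      ∑ ξ : ZMod p, ‖phaseSum B (fun y : ℤ => ((a * y ^ 2 : ℤ) : ZMod p)) ξ‖ ^ 8
        * ‖phaseSum D (fun z : ℤ => ((b * z : ℤ) : ZMod p)) ξ‖ ^ 2 ≤ p * (C * Y ^ 6 * R) := by
  obtain ⟨C, hC, h8⟩ := card_eight_squares_le
  refine ⟨C, hC, fun p _ Y B D a b Z R hY hB ha hD hp hR => ?_⟩
  rw [sum_moment_eq]
  refine mul_le_mul_of_nonneg_left ?_ (Nat.cast_nonneg _)
  set S := ((B ×ˢ B) ×ˢ (B ×ˢ B)) ×ˢ ((B ×ˢ B) ×ˢ (B ×ˢ B)) with hS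
  let Q : ((ℤ × ℤ) × (ℤ × ℤ)) × ((ℤ × ℤ) × (ℤ × ℤ)) → ℤ := fun t =>
    ((t.1.1.1 ^ 2 - t.1.1.2 ^ 2) + (t.1.2.1 ^ 2 - t.1.2.2 ^ 2))
          + ((t.2.1.1 ^ 2 - t.2.1.2 ^ 2) + (t.2.2.1 ^ 2 - t.2.2.2 ^ 2))
  have hQ : ∀ t ∈ S, |Q t| ≤ 4 * Y ^ 2 := by
    rintro ⟨⟨⟨x, y⟩, ⟨c, d⟩⟩, ⟨⟨x', y'⟩, ⟨c', d'⟩⟩⟩ ht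
    have hm : ∀ x ∈ B, 0 ≤ x ^ 2 ∧ x ^ 2 ≤ (Y : ℤ) ^ 2 := fun x hx => by
      have := Finset.mem_Icc.mp (hB hx)
      exact ⟨sq_nonneg _, pow_le_pow_left₀ (by linarith) this.2 2⟩
    simp only [hS, Finset.mem_product] at ht
    obtain ⟨⟨⟨ha, hb⟩, hc, hd⟩, ⟨ha', hb'⟩, hc', hd'⟩ := ht
    have := hm _ ha; have := hm _ hb; have := hm _ hc; have := hm _ hd
    have := hm _ ha'; have := hm _ hb'; have := hm _ hc'; have := hm _ hd'
    rw [abs_le]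
    constructor <;> simp only [Q] <;> linarith
  -- The integer in question is smaller than `p` in absolute value, so vanishing modulo `p` means
  -- vanishing.
  have hfilter : ((S ×ˢ (D ×ˢ D)).filter fun t =>
        ((((((a * t.1.1.1.1 ^ 2 : ℤ) : ZMod p) - ((a * t.1.1.1.2 ^ 2 : ℤ) : ZMod p))
          + (((a * t.1.1.2.1 ^ 2 : ℤ) : ZMod p) - ((a * t.1.1.2.2 ^ 2 : ℤ) : ZMod p)))
          + ((((a * t.1.2.1.1 ^ 2 : ℤ) : ZMod p) - ((a * t.1.2.1.2 ^ 2 : ℤ) : ZMod p))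
          + (((a * t.1.2.2.1 ^ 2 : ℤ) : ZMod p) - ((a * t.1.2.2.2 ^ 2 : ℤ) : ZMod p))))
          + (((b * t.2.1 : ℤ) : ZMod p) - ((b * t.2.2 : ℤ) : ZMod p)) = 0))
      ⊆ (S ×ˢ (D ×ˢ D)).filter fun t => a * Q t.1 + b * (t.2.1 - t.2.2) = 0 := by
    intro t ht
    rw [Finset.mem_filter] at ht ⊢
    refine ⟨ht.1, ?_⟩
    have hmem := Finset.mem_product.mp ht.1
    have hmem2 := Finset.mem_product.mp hmem.2
    have h1 : ((a * Q t.1 + b * (t.2.1 - t.2.2) : ℤ) : ZMod p) = 0 := by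
      rw [← ht.2]
      simp only [Q]
      push_cast
      ring
    rw [ZMod.intCast_zmod_eq_zero_iff_dvd] at h1
    refine Int.eq_zero_of_abs_lt_dvd h1 ?_
    calc |a * Q t.1 + b * (t.2.1 - t.2.2)| ≤ |a * Q t.1| + |b * (t.2.1 - t.2.2)| := abs_add_le _ _
      _ = |a| * |Q t.1| + |b| * |t.2.1 - t.2.2| := by rw [abs_mul, abs_mul]
      _ ≤ |a| * (4 * Y ^ 2) + |b| * Z := by
          have := hQ _ hmem.1
          have := hD _ hmem2.1 _ hmem2.2
          gcongr
      _ = 4 * |a| * Y ^ 2 + |b| * Z := by ring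
      _ < p := hp
  refine (Nat.cast_le.mpr (Finset.card_le_card hfilter)).trans ?_
  rw [Finset.card_filter, Finset.sum_product_right]
  push_cast
  -- For given linear variables the combination of eight squares is prescribed when `a` divides `b *
  -- (w.1 - w.2)`, and no solution exists otherwise. Hence `R` counts the admissible pairs.
  have hw : ∀ w ∈ D ×ˢ D, ∑ t ∈ S, (if a * Q t + b * (w.1 - w.2) = 0 then (1 : ℝ) else 0)
      ≤ if a ∣ b * (w.1 - w.2) then C * Y ^ 6 else 0 := by
    intro w _
    split_ifs with hd
    · obtain ⟨k, hk⟩ := hd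
      refine le_trans (le_of_eq ?_) (h8 Y hY (-k) B hB)
      rw [Finset.card_filter]
      push_cast
      refine Finset.sum_congr rfl fun t _ => ?_
      refine if_congr ?_ rfl rfl
      rw [hk, ← mul_add, mul_eq_zero, or_iff_right ha]
      simp only [Q]
      constructor <;> intro h <;> linarith
    · refine le_of_eq (Finset.sum_eq_zero fun t _ => if_neg fun h => hd ⟨-Q t, ?_⟩)
      linarith
  refine (Finset.sum_le_sum hw).trans ?_
  rw [← Finset.sum_filter, Finset.sum_const, nsmul_eq_mul, mul_comm]
  gcongr

/-- The frequencies at which both exponential sums are large are few. -/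
theorem card_level_le :
    ∃ C : ℝ, 0 < C ∧ ∀ (p : ℕ) [NeZero p] (Y : ℕ) (B D : Finset ℤ) (a b Z : ℤ) (R X lam : ℝ),
      0 < Y → B ⊆ Icc 1 (Y : ℤ) → a ≠ 0 → (∀ z ∈ D, ∀ z' ∈ D, |z - z'| ≤ Z) →
      4 * |a| * Y ^ 2 + |b| * Z < p → (#{w ∈ D ×ˢ D | a ∣ b * (w.1 - w.2)} : ℝ) ≤ R →
      0 < X → (D.card : ℝ) ≤ X → 0 < lam →
      (#{ξ : ZMod p | lam * (Y * X) < ‖phaseSum B (fun y : ℤ => ((a * y ^ 2 : ℤ) : ZMod p)) ξ‖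
        * ‖phaseSum D (fun z : ℤ => ((b * z : ℤ) : ZMod p)) ξ‖} : ℝ)
        ≤ C * (p * R / (Y ^ 2 * X ^ 2)) / lam ^ 10 := by
  obtain ⟨C, hC, hmom⟩ := moment_le
  refine ⟨C, hC, fun p _ Y B D a b Z R X lam hY hB ha hD hp hR hX hDX hlam => ?_⟩
  have hm := hmom p Y B D a b Z R hY hB ha hD hp hR
  have hYR : (0 : ℝ) < Y := by exact_mod_cast hY
  set T := phaseSum B (fun y : ℤ => ((a * y ^ 2 : ℤ) : ZMod p)) with hT
  set U := phaseSum D (fun z : ℤ => ((b * z : ℤ) : ZMod p)) with hU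
  have hTY : ∀ ξ, ‖T ξ‖ ≤ Y := by
    intro ξ
    refine (norm_phaseSum_le _ _ _).trans ?_
    have := Finset.card_le_card hB
    rw [Int.card_Icc] at this
    exact_mod_cast (this.trans (by omega))
  have hUX : ∀ ξ, ‖U ξ‖ ≤ X := fun ξ => (norm_phaseSum_le _ _ _).trans hDX
  set L := ({ξ : ZMod p | lam * (Y * X) < ‖T ξ‖ * ‖U ξ‖} : Finset (ZMod p)) with hL
  -- As neither factor exceeds its trivial bound, a large product makes each factor at least `lam`
  -- times its own bound. Markov's inequality for the moment of order `8 + 2` then explains the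
  -- exponent `10`.
  have hlow : ∀ ξ ∈ L, (lam * Y) ^ 8 * (lam * X) ^ 2 ≤ ‖T ξ‖ ^ 8 * ‖U ξ‖ ^ 2 := by
    intro ξ hξ
    rw [hL, Finset.mem_filter] at hξ
    have h1 : lam * Y ≤ ‖T ξ‖ := by
      by_contra! hcon
      have : ‖T ξ‖ * ‖U ξ‖ ≤ lam * Y * X := mul_le_mul hcon.le (hUX ξ) (norm_nonneg _) (by positivity)
      linarith [hξ.2]
    have h2 : lam * X ≤ ‖U ξ‖ := by
      by_contra! hcon
      have : ‖T ξ‖ * ‖U ξ‖ ≤ Y * (lam * X) := mul_le_mul (hTY ξ) hcon.le (norm_nonneg _) (by positivity)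
      linarith [hξ.2]
    gcongr
  have h3 : (L.card : ℝ) * ((lam * Y) ^ 8 * (lam * X) ^ 2) ≤ p * (C * Y ^ 6 * R) := by
    rw [← nsmul_eq_mul]
    refine (Finset.card_nsmul_le_sum _ _ _ hlow).trans (le_trans ?_ hm)
    exact Finset.sum_le_univ_sum_of_nonneg fun _ => by positivity
  rw [← le_div_iff₀ (by positivity)] at h3
  refine h3.trans (le_of_eq ?_)
  field_simp

end LevelSets

/-! ### The main term from almost invariance, and the error of replacing a weight. -/

section Counting

theorem prod_sub_sum_abs_le_prod {ι : Type*} (S : Finset ι) (a b : ι → ℝ)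
    (ha0 : ∀ i, 0 ≤ a i) (ha1 : ∀ i, a i ≤ 1) (hb0 : ∀ i, 0 ≤ b i) (hb1 : ∀ i, b i ≤ 1) :
    ∏ i ∈ S, b i - ∑ i ∈ S, |a i - b i| ≤ ∏ i ∈ S, a i := by
  classical
  induction S using Finset.induction_on with
  | empty => simp
  | insert i S hi ih =>
    rw [Finset.prod_insert hi, Finset.prod_insert hi, Finset.sum_insert hi]
    have hA0 : 0 ≤ ∏ i ∈ S, a i := Finset.prod_nonneg fun i _ => ha0 i
    have hB0 : 0 ≤ ∏ i ∈ S, b i := Finset.prod_nonneg fun i _ => hb0 i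
    have hB1 : ∏ i ∈ S, b i ≤ 1 := Finset.prod_le_one (fun i _ => hb0 i) fun i _ => hb1 i
    have hs : 0 ≤ ∑ i ∈ S, |a i - b i| := Finset.sum_nonneg fun _ _ => abs_nonneg _
    have h1 : (b i - a i) * ∏ i ∈ S, b i ≤ |a i - b i| := by
      calc (b i - a i) * ∏ i ∈ S, b i ≤ |a i - b i| * ∏ i ∈ S, b i := by
            gcongr
            rw [abs_sub_comm]
            exact le_abs_self _
        _ ≤ |a i - b i| := mul_le_of_le_one_right (abs_nonneg _) hB1
    have h2 : a i * (∏ i ∈ S, b i - ∏ i ∈ S, a i) ≤ ∑ i ∈ S, |a i - b i| := by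
      calc a i * (∏ i ∈ S, b i - ∏ i ∈ S, a i) ≤ a i * ∑ i ∈ S, |a i - b i| := by
            have := ha0 i
            gcongr
            linarith
        _ ≤ _ := mul_le_of_le_one_left hs (ha1 i)
    nlinarith

/-- Telescoping. The hypothesis lets every untouched factor be bounded by that of `a`, so only
products of the `a j` remain, to which Parseval applies. -/
theorem norm_prod_sub_prod_le_sum {ι : Type*} [DecidableEq ι] (S : Finset ι) (a b : ι → ℂ)
    (h : ∀ i, ‖b i‖ ≤ ‖a i‖) :
    ‖∏ i ∈ S, a i - ∏ i ∈ S, b i‖ ≤ ∑ i ∈ S, ‖a i - b i‖ * ∏ j ∈ S.erase i, ‖a j‖ := by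
  induction S using Finset.induction_on with
  | empty => simp
  | insert i S hi ih =>
    rw [Finset.prod_insert hi, Finset.prod_insert hi, Finset.sum_insert hi, Finset.erase_insert hi]
    have e : a i * ∏ j ∈ S, a j - b i * ∏ j ∈ S, b j
        = (a i - b i) * ∏ j ∈ S, a j + b i * (∏ j ∈ S, a j - ∏ j ∈ S, b j) := by ring
    rw [e]
    refine (norm_add_le _ _).trans (add_le_add ?_ ?_)
    · rw [norm_mul, norm_prod]
    · rw [norm_mul]
      refine (mul_le_mul (h i) ih (norm_nonneg _) (norm_nonneg _)).trans (le_of_eq ?_)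
      rw [Finset.mul_sum]
      refine Finset.sum_congr rfl fun j hj => ?_
      have hne : i ≠ j := fun h => hi (h ▸ hj)
      rw [Finset.erase_insert_of_ne hne, Finset.prod_insert (by simp [hi])]
      ring

variable {p : ℕ} [hp : Fact p.Prime]

/-- A lower bound for the number of solutions of a translation invariant linear equation with a
right hand side, weighted by a function that is almost invariant under translations. -/
theorem almost_invariant_count_le {n : ℕ} (F : ZMod p → ℝ) (hF0 : ∀ x, 0 ≤ F x)
    (hF1 : ∀ x, F x ≤ 1) (c : Fin (n + 2) → ZMod p) (hc0 : c 0 ≠ 0) (hsum : ∑ k, c k = 0)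
    (B : Finset (ZMod p)) (m : ZMod p) (ε δ : ℝ) (hδ : 0 ≤ δ) (hε : 0 ≤ ε)
    (havg : δ * p ≤ ∑ x, F x)
    (hB : ∀ b ∈ B, ∑ x, |F (x + b) - F x| ≤ ε * p)
    (hm : ∀ u : Fin n → ZMod p, (∀ k, u k ∈ B) →
      ∑ x, |F (x + (c 0)⁻¹ * (m - ∑ k : Fin n, c k.succ.succ * u k)) - F x| ≤ ε * p) :
    (B.card : ℝ) ^ n * ((δ ^ (n + 2) - (n + 2) * ε) * p)
      ≤ ∑ x : Fin (n + 2) → ZMod p, if ∑ k, c k * x k = m then ∏ k, F (x k) else 0 := by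
  have hp0 : (0 : ℝ) < p := by exact_mod_cast hp.out.pos
  -- The solutions have all coordinates near a common point: the second has shift `0`, the later
  -- ones are shifted by `u`, and the first has the shift that solves the equation, since the
  -- coefficients sum to zero.
  let t : (Fin n → ZMod p) → Fin (n + 2) → ZMod p := fun u =>
    Fin.cons ((c 0)⁻¹ * (m - ∑ k : Fin n, c k.succ.succ * u k)) (Fin.cons 0 u)
  have ht : ∀ u, (∀ k, u k ∈ B) → ∀ k, ∑ x, |F (x + t u k) - F x| ≤ ε * p := by
    intro u hu k
    refine Fin.cases ?_ (fun k => Fin.cases ?_ (fun k => ?_) k) k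
    · simpa [t] using hm u hu
    · simp only [t, Fin.cons_succ, Fin.cons_zero, add_zero, sub_self, abs_zero,
        Finset.sum_const_zero]
      positivity
    · simpa [t] using hB _ (hu k)
  have hsol : ∀ u x, ∑ k, c k * (x + t u k) = m := by
    intro u x
    simp only [mul_add, Finset.sum_add_distrib, ← Finset.sum_mul, hsum, zero_mul, zero_add]
    rw [Fin.sum_univ_succ, Fin.sum_univ_succ]
    simp only [t, Fin.cons_zero, Fin.cons_succ, mul_zero, zero_add]
    rw [mul_inv_cancel_left₀ hc0]
    ring
  have hlow : ∀ u ∈ Fintype.piFinset fun _ : Fin n => B,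
      (δ ^ (n + 2) - (n + 2) * ε) * p ≤ ∑ x, ∏ k, F (x + t u k) := by
    intro u hu
    rw [Fintype.mem_piFinset] at hu
    have h1 : ∀ x, F x ^ (n + 2) - ∑ k, |F (x + t u k) - F x| ≤ ∏ k, F (x + t u k) := by
      intro x
      have := prod_sub_sum_abs_le_prod (univ : Finset (Fin (n + 2))) (fun k => F (x + t u k))
        (fun _ => F x) (fun _ => hF0 _) (fun _ => hF1 _) (fun _ => hF0 _) (fun _ => hF1 _)
      simpa using this
    have h2 := Finset.sum_le_sum fun x (_ : x ∈ (univ : Finset (ZMod p))) => h1 x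
    rw [Finset.sum_sub_distrib, Finset.sum_comm] at h2
    have h3 : ∑ k : Fin (n + 2), ∑ x, |F (x + t u k) - F x| ≤ (n + 2) * (ε * p) := by
      refine (Finset.sum_le_sum fun k _ => ht u hu k).trans (le_of_eq ?_)
      simp
    -- Convexity: a power mean is at least the power of the mean.
    have h4 : δ ^ (n + 2) * p ≤ ∑ x, F x ^ (n + 2) := by
      have := pow_sum_div_card_le_sum_pow (s := (univ : Finset (ZMod p))) (f := F)
        (fun x _ => hF0 x) (n + 1)
      rw [Finset.card_univ, ZMod.card] at this
      refine le_trans ?_ this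
      rw [le_div_iff₀ (by positivity)]
      calc δ ^ (n + 2) * p * (p : ℝ) ^ (n + 1) = (δ * p) ^ (n + 1 + 1) := by ring
        _ ≤ _ := by gcongr
    linarith
  have hinj : ∑ q ∈ (univ : Finset (ZMod p)) ×ˢ (Fintype.piFinset fun _ : Fin n => B),
      ∏ k, F (q.1 + t q.2 k)
      ≤ ∑ x : Fin (n + 2) → ZMod p, if ∑ k, c k * x k = m then ∏ k, F (x k) else 0 := by
    rw [← Finset.sum_filter]
    -- Distinct pairs give distinct solutions: the coordinate of shift `0` recovers the base point,
    -- and the later ones then recover `u`.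
    let φ : ZMod p × (Fin n → ZMod p) → Fin (n + 2) → ZMod p := fun q k => q.1 + t q.2 k
    have hφ : Function.Injective φ := by
      rintro ⟨x, u⟩ ⟨y, v⟩ h
      have h1 := congrFun h 1
      have hx : x = y := by
        have e : ∀ u, t u 1 = 0 := fun u => rfl
        simpa [φ, e] using h1
      subst hx
      have hu : u = v := by
        funext k
        have := congrFun h k.succ.succ
        simpa [φ, t] using this
      rw [hu]
    rw [← Finset.sum_image (f := fun x : Fin (n + 2) → ZMod p => ∏ k, F (x k)) (g := φ)
      (fun a _ b _ h => hφ h)]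
    refine Finset.sum_le_sum_of_subset_of_nonneg ?_ fun x _ _ =>
      Finset.prod_nonneg fun k _ => hF0 _
    intro x hx
    obtain ⟨q, -, rfl⟩ := Finset.mem_image.mp hx
    rw [Finset.mem_filter]
    exact ⟨Finset.mem_univ _, hsol q.2 q.1⟩
  refine le_trans ?_ hinj
  rw [Finset.sum_product_right]
  refine le_trans (le_of_eq ?_) (Finset.card_nsmul_le_sum _ _ _ hlow)
  rw [nsmul_eq_mul, Fintype.card_piFinset]
  simp

/-- Multiplication by a nonzero element permutes `ZMod p`; primality of `p` enters here. -/
theorem sum_norm_sq_fourierSum_dilate_le (f : ZMod p → ℂ) (hf : ∀ x, ‖f x‖ ≤ 1) (c : ZMod p)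
    (hc : c ≠ 0) : ∑ ξ, ‖fourierSum f (c * ξ)‖ ^ 2 ≤ (p : ℝ) ^ 2 :=
  (Equiv.sum_comp (Equiv.mulLeft₀ c hc) fun ξ => ‖fourierSum f ξ‖ ^ 2).trans_le
    (sum_norm_sq_fourierSum_le f hf)

theorem sum_norm_mul_norm_fourierSum_le (f : ZMod p → ℂ) (hf : ∀ x, ‖f x‖ ≤ 1) (c d : ZMod p)
    (hc : c ≠ 0) (hd : d ≠ 0) :
    ∑ ξ, ‖fourierSum f (c * ξ)‖ * ‖fourierSum f (d * ξ)‖ ≤ (p : ℝ) ^ 2 := by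
  have h1 := sum_norm_sq_fourierSum_dilate_le f hf c hc
  have h2 := sum_norm_sq_fourierSum_dilate_le f hf d hd
  have h3 : ∀ ξ, ‖fourierSum f (c * ξ)‖ * ‖fourierSum f (d * ξ)‖
      ≤ (‖fourierSum f (c * ξ)‖ ^ 2 + ‖fourierSum f (d * ξ)‖ ^ 2) / 2 := by
    intro ξ
    nlinarith [sq_nonneg (‖fourierSum f (c * ξ)‖ - ‖fourierSum f (d * ξ)‖)]
  refine (Finset.sum_le_sum fun ξ _ => h3 ξ).trans ?_
  rw [← Finset.sum_div, Finset.sum_add_distrib]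
  linarith

/-- In at least three variables, replacing a function by one with nearby Fourier transform
changes the number of solutions little. -/
theorem count_error_of_three_le {s : ℕ} (hs : 3 ≤ s) (f F : ZMod p → ℂ) (hf : ∀ x, ‖f x‖ ≤ 1)
    (hF : ∀ ξ, ‖fourierSum F ξ‖ ≤ ‖fourierSum f ξ‖) (σ : ℝ)
    (hσ : ∀ ξ, ‖fourierSum f ξ - fourierSum F ξ‖ ≤ 2 * σ * p)
    (c : Fin s → ZMod p) (hc : ∀ k, c k ≠ 0) (V : ZMod p → ℂ) (X : ℝ) (hV : ∀ ξ, ‖V ξ‖ ≤ X) :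
    ‖∑ ξ, (∏ k, fourierSum f (c k * ξ) - ∏ k, fourierSum F (c k * ξ)) * V ξ‖
      ≤ 2 * s * σ * X * (p : ℝ) ^ s := by
  have hp0 : (0 : ℝ) < p := by exact_mod_cast hp.out.pos
  have hX : 0 ≤ X := (norm_nonneg _).trans (hV 0)
  have hσ0 : 0 ≤ 2 * σ * p := (norm_nonneg _).trans (hσ 0)
  -- With one factor removed at least two remain: these two are summed by Parseval, the others are
  -- bounded by `p`.
  have hterm : ∀ i : Fin s, ∑ ξ, ∏ j ∈ univ.erase i, ‖fourierSum f (c j * ξ)‖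
      ≤ (p : ℝ) ^ (s - 1) := by
    intro i
    have hcard : (univ.erase i).card = s - 1 := by
      rw [Finset.card_erase_of_mem (Finset.mem_univ _), Finset.card_univ, Fintype.card_fin]
    obtain ⟨j₁, hj₁, j₂, hj₂, hne⟩ := Finset.one_lt_card.mp (by rw [hcard]; omega :
      1 < (univ.erase i).card)
    have hj₂' : j₂ ∈ (univ.erase i).erase j₁ := Finset.mem_erase.mpr ⟨hne.symm, hj₂⟩
    have hb : ∀ ξ, ∏ j ∈ univ.erase i, ‖fourierSum f (c j * ξ)‖
        ≤ (p : ℝ) ^ (s - 3) * (‖fourierSum f (c j₁ * ξ)‖ * ‖fourierSum f (c j₂ * ξ)‖) := by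
      intro ξ
      rw [← Finset.mul_prod_erase _ _ hj₁, ← Finset.mul_prod_erase _ _ hj₂']
      have hcard2 : (((univ.erase i).erase j₁).erase j₂).card = s - 3 := by
        rw [Finset.card_erase_of_mem hj₂', Finset.card_erase_of_mem hj₁, hcard]
        omega
      have : ∏ j ∈ ((univ.erase i).erase j₁).erase j₂, ‖fourierSum f (c j * ξ)‖
          ≤ (p : ℝ) ^ (s - 3) := by
        rw [← hcard2, ← Finset.prod_const]
        exact Finset.prod_le_prod (fun _ _ => norm_nonneg _) fun j _ => norm_fourierSum_le f hf _
      calc _ = (∏ j ∈ ((univ.erase i).erase j₁).erase j₂, ‖fourierSum f (c j * ξ)‖)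
            * (‖fourierSum f (c j₁ * ξ)‖ * ‖fourierSum f (c j₂ * ξ)‖) := by ring
        _ ≤ _ := by gcongr
    refine (Finset.sum_le_sum fun ξ _ => hb ξ).trans ?_
    rw [← Finset.mul_sum]
    calc _ ≤ (p : ℝ) ^ (s - 3) * (p : ℝ) ^ 2 := by
          gcongr
          exact sum_norm_mul_norm_fourierSum_le f hf _ _ (hc _) (hc _)
      _ = (p : ℝ) ^ (s - 1) := by
          rw [← pow_add]
          congr 1
          omega
  have hpt : ∀ ξ, ‖(∏ k, fourierSum f (c k * ξ) - ∏ k, fourierSum F (c k * ξ)) * V ξ‖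
      ≤ ∑ i : Fin s, (2 * σ * p * X) * ∏ j ∈ univ.erase i, ‖fourierSum f (c j * ξ)‖ := by
    intro ξ
    rw [norm_mul]
    refine (mul_le_mul (norm_prod_sub_prod_le_sum univ _ _ fun k => hF _) (hV ξ) (norm_nonneg _)
      (Finset.sum_nonneg fun _ _ => mul_nonneg (norm_nonneg _)
        (Finset.prod_nonneg fun _ _ => norm_nonneg _))).trans ?_
    rw [Finset.sum_mul]
    refine Finset.sum_le_sum fun i _ => ?_
    have h0 : 0 ≤ ∏ j ∈ univ.erase i, ‖fourierSum f (c j * ξ)‖ :=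
      Finset.prod_nonneg fun _ _ => norm_nonneg _
    calc _ ≤ (2 * σ * p) * (∏ j ∈ univ.erase i, ‖fourierSum f (c j * ξ)‖) * X := by
          gcongr
          exact hσ _
      _ = _ := by ring
  refine (norm_sum_le _ _).trans ((Finset.sum_le_sum fun ξ _ => hpt ξ).trans ?_)
  rw [Finset.sum_comm]
  simp_rw [← Finset.mul_sum]
  calc _ ≤ (2 * σ * p * X) * ∑ i : Fin s, (p : ℝ) ^ (s - 1) := by
        gcongr with i
        exact hterm i
    _ = 2 * s * σ * X * ((p : ℝ) ^ (s - 1) * p) := by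
        rw [Finset.sum_const, Finset.card_univ, Fintype.card_fin, nsmul_eq_mul]
        ring
    _ = _ := by
        rw [← pow_succ]
        congr 2
        omega

/-- In two variables, replacing a function by one with nearby Fourier transform changes the number
of solutions little, provided that the remaining exponential sum is rarely large. -/
theorem count_error_of_two (f F : ZMod p → ℂ) (hf : ∀ x, ‖f x‖ ≤ 1)
    (hF : ∀ ξ, ‖fourierSum F ξ‖ ≤ ‖fourierSum f ξ‖) (σ : ℝ)
    (hσ : ∀ ξ, ‖fourierSum f ξ - fourierSum F ξ‖ ≤ 2 * σ * p)
    (c : Fin 2 → ZMod p) (hc : ∀ k, c k ≠ 0) (V : ZMod p → ℂ) (X : ℝ) (hV : ∀ ξ, ‖V ξ‖ ≤ X)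
    (lam K : ℝ) (hlam : 0 ≤ lam) (hK : (#{ξ : ZMod p | lam * X < ‖V ξ‖} : ℝ) ≤ K) :
    ‖∑ ξ, (∏ k, fourierSum f (c k * ξ) - ∏ k, fourierSum F (c k * ξ)) * V ξ‖
      ≤ (4 * lam + 4 * σ * K) * X * (p : ℝ) ^ 2 := by
  have hp0 : (0 : ℝ) < p := by exact_mod_cast hp.out.pos
  have hX : 0 ≤ X := (norm_nonneg _).trans (hV 0)
  have hσ0 : 0 ≤ 2 * σ * p := (norm_nonneg _).trans (hσ 0)
  have h2f : ∀ ξ, ‖fourierSum f ξ - fourierSum F ξ‖ ≤ 2 * ‖fourierSum f ξ‖ := fun ξ => by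
    have := norm_sub_le (fourierSum f ξ) (fourierSum F ξ)
    linarith [hF ξ]
  have hfp := norm_fourierSum_le f hf
  -- Where `V` is small, the difference of products is bounded by the products of coefficients of
  -- `f` and summed by Parseval. Where `V` is large, closeness of the transforms is used pointwise,
  -- at no more than `K` frequencies.
  have hpt : ∀ ξ, ‖(∏ k, fourierSum f (c k * ξ) - ∏ k, fourierSum F (c k * ξ)) * V ξ‖
      ≤ 4 * lam * X * (‖fourierSum f (c 0 * ξ)‖ * ‖fourierSum f (c 1 * ξ)‖)
        + if lam * X < ‖V ξ‖ then 4 * σ * p * p * X else 0 := by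
    intro ξ
    have h1 : ‖∏ k, fourierSum f (c k * ξ) - ∏ k, fourierSum F (c k * ξ)‖
        ≤ ‖fourierSum f (c 0 * ξ) - fourierSum F (c 0 * ξ)‖ * ‖fourierSum f (c 1 * ξ)‖
          + ‖fourierSum f (c 0 * ξ)‖ * ‖fourierSum f (c 1 * ξ) - fourierSum F (c 1 * ξ)‖ := by
      rw [Fin.prod_univ_two, Fin.prod_univ_two]
      have e : ∀ a b a' b' : ℂ, a * b - a' * b' = (a - a') * b + a' * (b - b') :=
        fun a b a' b' => by ring
      rw [e]
      refine (norm_add_le _ _).trans (add_le_add (norm_mul_le _ _) ?_)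
      rw [norm_mul]
      gcongr
      exact hF _
    rw [norm_mul]
    set a := ‖fourierSum f (c 0 * ξ)‖
    set b := ‖fourierSum f (c 1 * ξ)‖
    have ha0 : 0 ≤ a := norm_nonneg _
    have hb0 : 0 ≤ b := norm_nonneg _
    split_ifs with hl
    · have h2 : ‖∏ k, fourierSum f (c k * ξ) - ∏ k, fourierSum F (c k * ξ)‖ ≤ 4 * σ * p * p := by
        calc _ ≤ (2 * σ * p) * p + p * (2 * σ * p) := by
              refine h1.trans ?_
              gcongr
              · exact hσ _
              · exact hfp _
              · exact hfp _
              · exact hσ _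
          _ = _ := by ring
      have h3 : 0 ≤ 4 * lam * X * (a * b) := by positivity
      have h4 := mul_le_mul h2 (hV ξ) (norm_nonneg _) ((norm_nonneg _).trans h2)
      linarith
    · have h2 : ‖∏ k, fourierSum f (c k * ξ) - ∏ k, fourierSum F (c k * ξ)‖ ≤ 4 * (a * b) := by
        calc _ ≤ (2 * a) * b + a * (2 * b) := by
              refine h1.trans ?_
              gcongr
              · exact h2f _
              · exact h2f _
          _ = _ := by ring
      have h4 := mul_le_mul h2 (not_lt.mp hl) (norm_nonneg _) ((norm_nonneg _).trans h2)
      linarith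
  refine (norm_sum_le _ _).trans ((Finset.sum_le_sum fun ξ _ => hpt ξ).trans ?_)
  rw [Finset.sum_add_distrib, ← Finset.mul_sum, ← Finset.sum_filter, Finset.sum_const,
    nsmul_eq_mul]
  have h5 := sum_norm_mul_norm_fourierSum_le f hf _ _ (hc 0) (hc 1)
  have hσ1 : 0 ≤ 4 * σ * p * p * X := by
    have : 4 * σ * p * p * X = 2 * (2 * σ * p) * p * X := by ring
    rw [this]; positivity
  calc _ ≤ 4 * lam * X * (p : ℝ) ^ 2 + K * (4 * σ * p * p * X) := by gcongr
    _ = _ := by ring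

end Counting

/-! ### Stability of the number of solutions under a Fourier-small change of weight. -/

section Error

/-- Every integer occurring in the equation is smaller than this constant times `N`. -/
def sizeBound {s₁ s₂ s₃ : ℕ} (c₁ : Fin s₁ → ℤ) (c₂ : Fin s₂ → ℤ) (c₃ : Fin s₃ → ℤ) : ℕ :=
  8 * (∑ k, (c₁ k).natAbs + ∑ l, (c₂ l).natAbs + ∑ l, (c₃ l).natAbs + 1)

/-- The right hand side of the equation modulo `p`. -/
def rhsMod {s₂ s₃ : ℕ} (p : ℕ) (c₂ : Fin s₂ → ℤ) (c₃ : Fin s₃ → ℤ) (W : ℕ)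
    (w : (Fin s₂ → ℤ) × (Fin s₃ → ℤ)) : ZMod p :=
  (((W : ℤ) * linForm c₂ (fun j => w.1 j ^ 2) + linForm c₃ w.2 : ℤ) : ZMod p)

/-- The tuples of variables `(y, z)` with entries in `B`. -/
def coloured (s₂ s₃ : ℕ) (B : Finset ℤ) : Finset ((Fin s₂ → ℤ) × (Fin s₃ → ℤ)) :=
  (Fintype.piFinset fun _ => B) ×ˢ (Fintype.piFinset fun _ => B)

/-- The number of solutions modulo `p`, where each `x` variable is weighted by `h`. -/
noncomputable def modCount {s₁ s₂ s₃ : ℕ} {p : ℕ} [NeZero p] (c₁ : Fin s₁ → ℤ) (c₂ : Fin s₂ → ℤ)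
    (c₃ : Fin s₃ → ℤ) (W : ℕ) (B : Finset ℤ) (h : ZMod p → ℝ) : ℝ :=
  ∑ w ∈ coloured s₂ s₃ B, ∑ x : Fin s₁ → ZMod p,
    if ∑ k, (c₁ k : ZMod p) * x k = rhsMod p c₂ c₃ W w then ∏ k, h (x k) else 0

theorem card_coloured (s₂ s₃ : ℕ) (B : Finset ℤ) :
    (coloured s₂ s₃ B).card = B.card ^ (s₂ + s₃) := by
  simp [coloured, Finset.card_product, Fintype.card_piFinset, pow_add]

/-- The exponential sum over the coloured variables splits as a product. -/
theorem sum_coloured_eq_prod {s₂ s₃ : ℕ} {p : ℕ} [NeZero p] (c₂ : Fin s₂ → ℤ) (c₃ : Fin s₃ → ℤ)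
    (W : ℕ) (B : Finset ℤ) (ξ : ZMod p) :
    ∑ w ∈ coloured s₂ s₃ B, (stdAddChar (-(ξ * rhsMod p c₂ c₃ W w)) : ℂ)
      = (∏ l, phaseSum B (fun y : ℤ => (((-(W : ℤ) * c₂ l) * y ^ 2 : ℤ) : ZMod p)) ξ)
        * ∏ l, phaseSum B (fun z : ℤ => ((-c₃ l * z : ℤ) : ZMod p)) ξ := by
  unfold phaseSum coloured
  rw [Finset.prod_univ_sum, Finset.prod_univ_sum, Finset.sum_mul_sum, ← Finset.sum_product']
  refine Finset.sum_congr rfl fun w _ => ?_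
  rw [← stdAddChar_sum, ← stdAddChar_sum, ← AddChar.map_add_eq_mul]
  congr 1
  rw [← Finset.mul_sum, ← Finset.mul_sum, ← mul_add, ← mul_neg]
  congr 1
  simp only [rhsMod, linForm]
  push_cast
  rw [neg_add, Finset.mul_sum, ← Finset.sum_neg_distrib, ← Finset.sum_neg_distrib]
  congr 1 <;> refine Finset.sum_congr rfl fun _ _ => ?_ <;> ring

theorem card_le_of_subset_Icc {B : Finset ℤ} {Y : ℕ} (hB : B ⊆ Icc 1 (Y : ℤ)) : B.card ≤ Y := by
  have := Finset.card_le_card hB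
  rw [Int.card_Icc] at this
  omega

theorem norm_sum_coloured_le {s₂ s₃ : ℕ} {p : ℕ} [NeZero p] (c₂ : Fin s₂ → ℤ) (c₃ : Fin s₃ → ℤ)
    (W Y : ℕ) (B : Finset ℤ) (hB : B ⊆ Icc 1 (Y : ℤ)) (ξ : ZMod p) :
    ‖∑ w ∈ coloured s₂ s₃ B, (stdAddChar (-(ξ * rhsMod p c₂ c₃ W w)) : ℂ)‖
      ≤ (Y : ℝ) ^ (s₂ + s₃) := by
  refine (norm_sum_le _ _).trans ?_
  simp only [norm_stdAddChar, Finset.sum_const, nsmul_eq_mul, mul_one]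
  rw [card_coloured]
  push_cast
  gcongr
  exact card_le_of_subset_Icc hB

theorem norm_prod_phaseSum_le {ι : Type*} (S : Finset ι) {p : ℕ} [NeZero p] (B : Finset ℤ) (Y : ℕ)
    (hB : B ⊆ Icc 1 (Y : ℤ)) (f : ι → ℤ → ZMod p) (ξ : ZMod p) :
    ‖∏ l ∈ S, phaseSum B (f l) ξ‖ ≤ (Y : ℝ) ^ S.card := by
  rw [norm_prod, ← Finset.prod_const]
  refine Finset.prod_le_prod (fun _ _ => norm_nonneg _) fun l _ => ?_
  exact (norm_phaseSum_le _ _ _).trans (by exact_mod_cast card_le_of_subset_Icc hB)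

/-- The differences of integers up to `Y` rarely become divisible by `W` on multiplication by a
fixed integer. -/
theorem card_dvd_mul_sub_le (B : Finset ℤ) (Y W : ℕ) (hB : B ⊆ Icc 1 (Y : ℤ)) (hW : 0 < W)
    (hWY : W ≤ Y) (a b : ℤ) (ha : (W : ℤ) ∣ a) (hb : b ≠ 0) :
    (#{w ∈ B ×ˢ B | a ∣ b * (w.1 - w.2)} : ℝ) ≤ Y ^ 2 * (b.natAbs + 1) / W := by
  have hWR : (0 : ℝ) < W := by exact_mod_cast hW
  set g := Int.gcd W b with hg
  have hg0 : 0 < g := Int.gcd_pos_of_ne_zero_right _ hb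
  have hgW : (g : ℤ) ∣ W := Int.gcd_dvd_left _ _
  have hgb : g ≤ b.natAbs := Nat.le_of_dvd (Int.natAbs_pos.mpr hb) (Nat.gcd_dvd_right _ _)
  -- Cancelling `b` from a congruence modulo `W` leaves one modulo `W / gcd(W, b)`, which is at
  -- least `W / |b|`.
  set m : ℤ := (W : ℤ) / g with hm
  have hmg : m * g = W := Int.ediv_mul_cancel hgW
  have hm0 : 0 < m := by
    have : 0 < m * g := by rw [hmg]; exact_mod_cast hW
    exact pos_of_mul_pos_left this (by positivity)
  have hmod : ∀ x y : ℤ, a ∣ b * (x - y) → x ≡ y [ZMOD m] := by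
    intro x y h
    have h1 : b * x ≡ b * y [ZMOD W] := by
      refine (Int.modEq_iff_dvd.mpr ?_).symm
      rw [← mul_sub]
      exact ha.trans h
    exact Int.ModEq.cancel_left_div_gcd (by exact_mod_cast hW) h1
  have hY0 : 0 < Y := lt_of_lt_of_le hW hWY
  have hfib : ∀ y ∈ B, (#{x ∈ B | a ∣ b * (x - y)} : ℝ) ≤ Y * (b.natAbs + 1) / W := by
    intro y _
    have h1 : #{x ∈ B | a ∣ b * (x - y)} ≤ #{x ∈ Icc 1 (Y : ℤ) | x ≡ y [ZMOD m]} := by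
      refine Finset.card_le_card fun x hx => ?_
      rw [Finset.mem_filter] at hx ⊢
      exact ⟨hB hx.1, hmod _ _ hx.2⟩
    have h2 := card_Icc_filter_modEq_le 1 (Y : ℤ) y m hm0 (by omega)
    refine (Nat.cast_le.mpr h1).trans (h2.trans ?_)
    have e1 : ((((Y : ℤ) - 1 + 1 : ℤ)) : ℝ) = Y := by push_cast; ring
    rw [e1]
    have hmR : (0 : ℝ) < m := by exact_mod_cast hm0
    have hmgR : (m : ℝ) * g = W := by exact_mod_cast hmg
    have h3 : (Y : ℝ) / m ≤ Y * b.natAbs / W := by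
      rw [div_le_div_iff₀ hmR hWR, ← hmgR]
      have : (g : ℝ) ≤ (b.natAbs : ℝ) := by exact_mod_cast hgb
      calc (Y : ℝ) * (m * g) = Y * m * g := by ring
        _ ≤ Y * m * (b.natAbs : ℝ) := by gcongr
        _ = _ := by ring
    have h4 : (1 : ℝ) ≤ Y / W := by
      rw [one_le_div hWR]
      exact_mod_cast hWY
    calc (Y : ℝ) / m + 1 ≤ Y * b.natAbs / W + Y / W := add_le_add h3 h4
      _ = _ := by ring
  rw [Finset.card_filter, Finset.sum_product_right]
  push_cast
  have h5 : ∀ y ∈ B, ∑ x ∈ B, (if a ∣ b * (x - y) then (1 : ℝ) else 0)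
      ≤ Y * (b.natAbs + 1) / W := by
    intro y hy
    have := hfib y hy
    rw [Finset.card_filter] at this
    push_cast at this
    exact this
  refine (Finset.sum_le_sum h5).trans ?_
  rw [Finset.sum_const, nsmul_eq_mul]
  have hc : (B.card : ℝ) ≤ Y := by exact_mod_cast card_le_of_subset_Icc hB
  calc (B.card : ℝ) * (Y * (b.natAbs + 1) / W) ≤ Y * (Y * (b.natAbs + 1) / W) := by gcongr
    _ = _ := by ring

theorem natAbs_lt_sizeBound {s₁ s₂ s₃ : ℕ} (c₁ : Fin s₁ → ℤ) (c₂ : Fin s₂ → ℤ) (c₃ : Fin s₃ → ℤ) :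
    (∀ k, (c₁ k).natAbs < sizeBound c₁ c₂ c₃) ∧
    (∀ l, 8 * (c₂ l).natAbs < sizeBound c₁ c₂ c₃) ∧ ∀ l m, 4 * (c₂ l).natAbs + (c₃ m).natAbs
      < sizeBound c₁ c₂ c₃ := by
  have h1 : ∀ k, (c₁ k).natAbs ≤ ∑ k, (c₁ k).natAbs := fun k =>
    Finset.single_le_sum (f := fun k => (c₁ k).natAbs) (fun _ _ => Nat.zero_le _) (Finset.mem_univ k)
  have h2 : ∀ k, (c₂ k).natAbs ≤ ∑ k, (c₂ k).natAbs := fun k =>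
    Finset.single_le_sum (f := fun k => (c₂ k).natAbs) (fun _ _ => Nat.zero_le _) (Finset.mem_univ k)
  have h3 : ∀ k, (c₃ k).natAbs ≤ ∑ k, (c₃ k).natAbs := fun k =>
    Finset.single_le_sum (f := fun k => (c₃ k).natAbs) (fun _ _ => Nat.zero_le _) (Finset.mem_univ k)
  unfold sizeBound
  refine ⟨fun k => ?_, fun l => ?_, fun l m => ?_⟩
  · have := h1 k; omega
  · have := h2 l; omega
  · have := h2 l; have := h3 m; omega

/-- Both roundings in `Y` together cost at most a factor `4`, because `Y + 1 ≤ 2 Y` once `Y` is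
positive. -/
theorem sqrt_div_bounds {N W Y : ℕ} (hW : 0 < W) (hY : Y = Nat.sqrt (N / W)) (hY0 : 0 < Y) :
    W * Y ^ 2 ≤ N ∧ N ≤ 4 * (W * Y ^ 2) := by
  have h1 : Y * Y ≤ N / W := hY ▸ Nat.sqrt_le (N / W)
  have h2 : N / W < (Y + 1) * (Y + 1) := hY ▸ Nat.lt_succ_sqrt (N / W)
  have h3 : Y * Y * W ≤ N := (Nat.le_div_iff_mul_le hW).mp h1
  have h4 : N < (Y + 1) * (Y + 1) * W := (Nat.div_lt_iff_lt_mul hW).mp h2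
  refine ⟨by nlinarith, ?_⟩
  have h5 : (Y + 1) * (Y + 1) ≤ 4 * (Y * Y) := by nlinarith
  have h6 : (Y + 1) * (Y + 1) * W ≤ 4 * (Y * Y) * W := Nat.mul_le_mul_right _ h5
  nlinarith

/-- The exponential sum over the coloured variables is large at boundedly many frequencies only,
when there is a quadratic variable and, unless `W = 1`, a linear one. -/
theorem card_large_coloured_le {s₁ s₂ s₃ : ℕ} (c₁ : Fin s₁ → ℤ) (c₂ : Fin s₂ → ℤ)
    (c₃ : Fin s₃ → ℤ) (hc₂ : NonSingular c₂) (hc₃ : NonSingular c₃) (hs₂ : 0 < s₂)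
    (lam : ℝ) (hlam : 0 < lam) :
    ∃ K : ℝ, 0 < K ∧ ∀ W : ℕ, 0 < W → (W = 1 ∨ 0 < s₃) → ∀ (N Y p : ℕ) [NeZero p] (B : Finset ℤ),
      Y = Nat.sqrt (N / W) → W ≤ Y → sizeBound c₁ c₂ c₃ * N < p → p ≤ 2 * (sizeBound c₁ c₂ c₃ * N) →
      B ⊆ Icc 1 (Y : ℤ) →
      (#{ξ : ZMod p | lam * (Y : ℝ) ^ (s₂ + s₃)
        < ‖∑ w ∈ coloured s₂ s₃ B, (stdAddChar (-(ξ * rhsMod p c₂ c₃ W w)) : ℂ)‖} : ℝ) ≤ K := by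
  obtain ⟨C, hC, hlev⟩ := card_level_le
  obtain ⟨s, rfl⟩ : ∃ s, s₂ = s + 1 := ⟨s₂ - 1, by omega⟩
  set A := sizeBound c₁ c₂ c₃ with hA
  have hA0 : 0 < A := by rw [hA]; unfold sizeBound; omega
  refine ⟨C * (8 * A * (A + 1)) / lam ^ 10, by positivity, ?_⟩
  intro W hW hWs N Y p _ B hY hWY hp1 hp2 hB
  have hY0 : 0 < Y := lt_of_lt_of_le hW hWY
  obtain ⟨hb1, hb2⟩ := sqrt_div_bounds hW hY hY0
  have hYR : (0 : ℝ) < Y := by exact_mod_cast hY0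
  have hWR : (0 : ℝ) < W := by exact_mod_cast hW
  have hpR : (p : ℝ) ≤ 8 * A * (W * Y ^ 2) := by
    have : p ≤ 8 * A * (W * Y ^ 2) := by
      calc p ≤ 2 * (A * N) := hp2
        _ ≤ 2 * (A * (4 * (W * Y ^ 2))) := by gcongr
        _ = _ := by ring
    exact_mod_cast this
  obtain ⟨hn1, hn2, hn3⟩ := natAbs_lt_sizeBound c₁ c₂ c₃
  -- One quadratic sum, and one linear sum when needed, is kept; all other factors are bounded by
  -- `Y`. Since `p` has order `W Y ^ 2`, the quadratic moment alone gives a bound of order `W`. For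
  -- `W = 1` this is enough, and the linear sum is the trivial one over `{0}`. Otherwise a linear
  -- variable over `B` saves the factor `W`, as differences divisible by `W` up to a bounded factor
  -- are that rare.
  have hbound : ∃ (D : Finset ℤ) (b Z : ℤ) (R X : ℝ) (e : ℕ),
      (∀ z ∈ D, ∀ z' ∈ D, |z - z'| ≤ Z) ∧ 4 * |-(W : ℤ) * c₂ 0| * Y ^ 2 + |b| * Z < p ∧
      (#{w ∈ D ×ˢ D | -(W : ℤ) * c₂ 0 ∣ b * (w.1 - w.2)} : ℝ) ≤ R ∧ 0 < X ∧ (D.card : ℝ) ≤ X ∧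
      (p : ℝ) * R / (Y ^ 2 * X ^ 2) ≤ 8 * A * (A + 1) ∧
      X * Y ^ e = (Y : ℝ) ^ (s + s₃) ∧
      ∀ ξ : ZMod p, ‖(∏ l : Fin s, phaseSum B
          (fun y : ℤ => (((-(W : ℤ) * c₂ l.succ) * y ^ 2 : ℤ) : ZMod p)) ξ)
        * ∏ l, phaseSum B (fun z : ℤ => ((-c₃ l * z : ℤ) : ZMod p)) ξ‖
        ≤ ‖phaseSum D (fun z : ℤ => ((b * z : ℤ) : ZMod p)) ξ‖ * Y ^ e := by
    have hquad : ∀ ξ : ZMod p, ‖∏ l : Fin s, phaseSum B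
          (fun y : ℤ => (((-(W : ℤ) * c₂ l.succ) * y ^ 2 : ℤ) : ZMod p)) ξ‖ ≤ (Y : ℝ) ^ s := by
      intro ξ
      refine (norm_prod_phaseSum_le univ B Y hB _ ξ).trans (le_of_eq ?_)
      rw [Finset.card_univ, Fintype.card_fin]
    have habs : 4 * |-(W : ℤ) * c₂ 0| * Y ^ 2 = 4 * (c₂ 0).natAbs * (W * Y ^ 2 : ℕ) := by
      rw [abs_mul, abs_neg, Nat.abs_cast, Int.abs_eq_natAbs]
      push_cast
      ring
    rcases hWs with rfl | hs₃
    · refine ⟨{0}, 0, 0, 1, 1, s + s₃, by simp, ?_, ?_, one_pos, by simp, ?_, by ring, ?_⟩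
      · rw [habs]
        have h1 : 4 * (c₂ 0).natAbs * (1 * Y ^ 2) ≤ A * N := by
          have := hn2 0
          exact Nat.mul_le_mul (by omega) hb1
        have h2 : 4 * (c₂ 0).natAbs * (1 * Y ^ 2) < p := lt_of_le_of_lt h1 hp1
        simp only [mul_zero, add_zero]
        exact_mod_cast h2
      · simp
      · rw [mul_one, one_pow, mul_one, div_le_iff₀ (by positivity)]
        refine hpR.trans ?_
        have : (0 : ℝ) ≤ 8 * A * A * Y ^ 2 := by positivity
        push_cast
        linarith
      · intro ξ
        rw [norm_mul]
        have h1 : ‖phaseSum ({0} : Finset ℤ) (fun z : ℤ => ((0 * z : ℤ) : ZMod p)) ξ‖ = 1 := by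
          simp [phaseSum]
        rw [h1, one_mul, pow_add]
        refine mul_le_mul (hquad ξ) ?_ (norm_nonneg _) (by positivity)
        refine (norm_prod_phaseSum_le univ B Y hB _ ξ).trans (le_of_eq ?_)
        rw [Finset.card_univ, Fintype.card_fin]
    · obtain ⟨t, rfl⟩ : ∃ t, s₃ = t + 1 := ⟨s₃ - 1, by omega⟩
      refine ⟨B, -c₃ 0, Y, Y ^ 2 * ((-c₃ 0).natAbs + 1) / W, Y, s + t, ?_, ?_, ?_, hYR, ?_, ?_, ?_,
        ?_⟩
      · intro z hz z' hz'
        have := Finset.mem_Icc.mp (hB hz)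
        have := Finset.mem_Icc.mp (hB hz')
        rw [abs_le]
        constructor <;> linarith
      · rw [habs, abs_neg, Int.abs_eq_natAbs (c₃ 0)]
        have hYN : Y ≤ N := by nlinarith
        have h1 : 4 * (c₂ 0).natAbs * (W * Y ^ 2) + (c₃ 0).natAbs * Y ≤ A * N := by
          have := hn3 0 0
          calc _ ≤ 4 * (c₂ 0).natAbs * N + (c₃ 0).natAbs * N := by gcongr
            _ = (4 * (c₂ 0).natAbs + (c₃ 0).natAbs) * N := by ring
            _ ≤ A * N := Nat.mul_le_mul_right _ this.le
        exact_mod_cast lt_of_le_of_lt h1 hp1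
      · refine card_dvd_mul_sub_le B Y W hB hW hWY _ _ ?_ ?_
        · exact Dvd.dvd.mul_right (by simp) _
        · exact neg_ne_zero.mpr (hc₃ 0)
      · exact_mod_cast card_le_of_subset_Icc hB
      · rw [Int.natAbs_neg, div_le_iff₀ (by positivity)]
        have h1 : ((c₃ 0).natAbs : ℝ) ≤ A := by
          have := hn3 0 0
          exact_mod_cast (by omega : (c₃ 0).natAbs ≤ A)
        calc (p : ℝ) * (Y ^ 2 * ((c₃ 0).natAbs + 1) / W)
            ≤ (8 * A * (W * Y ^ 2)) * (Y ^ 2 * (A + 1) / W) := by gcongr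
          _ = _ := by field_simp
      · rw [← pow_succ']
        congr 1
      · intro ξ
        rw [norm_mul, Fin.prod_univ_succ, norm_mul, pow_add]
        have h2 : ‖∏ l : Fin t, phaseSum B
            (fun z : ℤ => ((-c₃ l.succ * z : ℤ) : ZMod p)) ξ‖ ≤ (Y : ℝ) ^ t := by
          refine (norm_prod_phaseSum_le univ B Y hB _ ξ).trans (le_of_eq ?_)
          rw [Finset.card_univ, Fintype.card_fin]
        calc _ ≤ (Y : ℝ) ^ s * (‖phaseSum B (fun z : ℤ => ((-c₃ 0 * z : ℤ) : ZMod p)) ξ‖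
              * (Y : ℝ) ^ t) := by
              gcongr
              exact hquad ξ
          _ = _ := by ring
  obtain ⟨D, b, Z, R, X, e, hD, hlt, hR, hX, hDX, hK, hXe, hV⟩ := hbound
  have hl := hlev p Y B D (-(W : ℤ) * c₂ 0) b Z R X lam hY0 hB
    (mul_ne_zero (neg_ne_zero.mpr (by exact_mod_cast hW.ne')) (hc₂ 0)) hD hlt hR hX hDX hlam
  have hsub : ({ξ : ZMod p | lam * (Y : ℝ) ^ (s + 1 + s₃)
        < ‖∑ w ∈ coloured (s + 1) s₃ B, (stdAddChar (-(ξ * rhsMod p c₂ c₃ W w)) : ℂ)‖}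
          : Finset (ZMod p))
      ⊆ ({ξ : ZMod p | lam * (Y * X)
        < ‖phaseSum B (fun y : ℤ => ((-(W : ℤ) * c₂ 0 * y ^ 2 : ℤ) : ZMod p)) ξ‖
        * ‖phaseSum D (fun z : ℤ => ((b * z : ℤ) : ZMod p)) ξ‖} : Finset (ZMod p)) := by
    intro ξ hξ
    rw [Finset.mem_filter] at hξ ⊢
    refine ⟨Finset.mem_univ _, ?_⟩
    have h1 := hξ.2
    rw [sum_coloured_eq_prod, Fin.prod_univ_succ, mul_assoc, norm_mul] at h1
    have h2 := mul_le_mul_of_nonneg_left (hV ξ) (norm_nonneg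
      (phaseSum B (fun y : ℤ => ((-(W : ℤ) * c₂ 0 * y ^ 2 : ℤ) : ZMod p)) ξ))
    have h3 := lt_of_lt_of_le h1 h2
    have h4 : lam * (Y : ℝ) ^ (s + 1 + s₃) = lam * (Y * X) * Y ^ e := by
      rw [show s + 1 + s₃ = (s + s₃) + 1 by ring, pow_succ, ← hXe]
      ring
    rw [h4] at h3
    exact lt_of_mul_lt_mul_right (h3.trans_eq (by ring)) (by positivity : (0 : ℝ) ≤ (Y : ℝ) ^ e)
  refine (Nat.cast_le.mpr (Finset.card_le_card hsub)).trans (hl.trans ?_)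
  gcongr

/-- The number of solutions is stable under replacing a weight function by one with nearby Fourier
transform. -/
theorem modCount_error {n s₂ s₃ : ℕ} (hs : 3 ≤ n + 2 + s₂) (c₁ : Fin (n + 2) → ℤ)
    (c₂ : Fin s₂ → ℤ) (c₃ : Fin s₃ → ℤ) (hc₁ : NonSingular c₁) (hc₂ : NonSingular c₂)
    (hc₃ : NonSingular c₃) (e₀ : ℝ) (he₀ : 0 < e₀) :
    ∃ σ : ℝ, 0 < σ ∧ ∀ W : ℕ, 0 < W → (W = 1 ∨ 0 < s₃) → ∀ (N Y p : ℕ) [Fact p.Prime]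
      (B : Finset ℤ) (f F : ZMod p → ℝ),
      Y = Nat.sqrt (N / W) → W ≤ Y → sizeBound c₁ c₂ c₃ * N < p → p ≤ 2 * (sizeBound c₁ c₂ c₃ * N) →
      B ⊆ Icc 1 (Y : ℤ) → (∀ x, |f x| ≤ 1) →
      (∀ ξ, ‖fourierSum (fun x => (F x : ℂ)) ξ‖ ≤ ‖fourierSum (fun x => (f x : ℂ)) ξ‖) →
      (∀ ξ, ‖fourierSum (fun x => (f x : ℂ)) ξ - fourierSum (fun x => (F x : ℂ)) ξ‖ ≤ 2 * σ * p) →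
      |modCount c₁ c₂ c₃ W B f - modCount c₁ c₂ c₃ W B F|
        ≤ e₀ * (p : ℝ) ^ (n + 1) * (Y : ℝ) ^ (s₂ + s₃) := by
  have main : ∃ σ : ℝ, 0 < σ ∧ ∀ W : ℕ, 0 < W → (W = 1 ∨ 0 < s₃) → ∀ (N Y p : ℕ) [Fact p.Prime]
      (B : Finset ℤ) (f F : ZMod p → ℂ),
      Y = Nat.sqrt (N / W) → W ≤ Y → sizeBound c₁ c₂ c₃ * N < p → p ≤ 2 * (sizeBound c₁ c₂ c₃ * N) →
      B ⊆ Icc 1 (Y : ℤ) → (∀ x, ‖f x‖ ≤ 1) → (∀ k, (c₁ k : ZMod p) ≠ 0) →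
      (∀ ξ, ‖fourierSum F ξ‖ ≤ ‖fourierSum f ξ‖) →
      (∀ ξ, ‖fourierSum f ξ - fourierSum F ξ‖ ≤ 2 * σ * p) →
      ‖∑ ξ : ZMod p, (∏ k, fourierSum f ((c₁ k : ZMod p) * ξ)
          - ∏ k, fourierSum F ((c₁ k : ZMod p) * ξ))
        * ∑ w ∈ coloured s₂ s₃ B, (stdAddChar (-(ξ * rhsMod p c₂ c₃ W w)) : ℂ)‖
        ≤ e₀ * (Y : ℝ) ^ (s₂ + s₃) * (p : ℝ) ^ (n + 2) := by
    -- For exactly two `x` variables the hypothesis `hs` supplies a quadratic variable, and the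
    -- level-set bound is used. With `lam = e₀ / 8` and `σ = e₀ / (8 K)` the two error terms are `e₀
    -- / 2` each.
    rcases Nat.eq_zero_or_pos n with rfl | hn
    · obtain ⟨K, hK, hcard⟩ := card_large_coloured_le c₁ c₂ c₃ hc₂ hc₃ (by omega) (e₀ / 8)
        (by positivity)
      refine ⟨e₀ / (8 * K), by positivity, ?_⟩
      intro W hW hWs N Y p _ B f F hY hWY hp1 hp2 hB hf hc hF hσ
      refine (count_error_of_two f F hf hF _ hσ (fun k => (c₁ k : ZMod p)) hc _
        ((Y : ℝ) ^ (s₂ + s₃)) (norm_sum_coloured_le c₂ c₃ W Y B hB) (e₀ / 8) K (by positivity)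
        (hcard W hW hWs N Y p B hY hWY hp1 hp2 hB)).trans (le_of_eq ?_)
      field_simp
      ring
    · refine ⟨e₀ / (2 * ((n + 2 : ℕ) : ℝ)), by positivity, ?_⟩
      intro W hW hWs N Y p _ B f F hY hWY hp1 hp2 hB hf hc hF hσ
      refine (count_error_of_three_le (by omega) f F hf hF _ hσ (fun k => (c₁ k : ZMod p)) hc _
        ((Y : ℝ) ^ (s₂ + s₃)) (norm_sum_coloured_le c₂ c₃ W Y B hB)).trans (le_of_eq ?_)
      field_simp
  obtain ⟨σ, hσ0, hmain⟩ := main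
  refine ⟨σ, hσ0, fun W hW hWs N Y p hp B f F hY hWY hp1 hp2 hB hf hF hσ => ?_⟩
  have hp0 : (0 : ℝ) < p := by exact_mod_cast hp.out.pos
  have hY0 : 0 < Y := lt_of_lt_of_le hW hWY
  have hN0 : 0 < N := by
    have := (sqrt_div_bounds hW hY hY0).1
    have : 0 < W * Y ^ 2 := by positivity
    omega
  have hc : ∀ k, (c₁ k : ZMod p) ≠ 0 := by
    intro k h
    rw [ZMod.intCast_zmod_eq_zero_iff_dvd] at h
    refine hc₁ k (Int.eq_zero_of_abs_lt_dvd h ?_)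
    rw [Int.abs_eq_natAbs]
    have := (natAbs_lt_sizeBound c₁ c₂ c₃).1 k
    have h2 : sizeBound c₁ c₂ c₃ ≤ sizeBound c₁ c₂ c₃ * N := Nat.le_mul_of_pos_right _ hN0
    exact_mod_cast (by omega : (c₁ k).natAbs < p)
  have h := hmain W hW hWs N Y p B (fun x => (f x : ℂ)) (fun x => (F x : ℂ)) hY hWY hp1 hp2 hB
    (by simpa using hf) hc hF hσ
  have hcount : ∀ g : ZMod p → ℝ, (p : ℂ) * ((modCount c₁ c₂ c₃ W B g : ℝ) : ℂ)
      = ∑ ξ : ZMod p, (∏ k, fourierSum (fun x => (g x : ℂ)) ((c₁ k : ZMod p) * ξ))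
        * ∑ w ∈ coloured s₂ s₃ B, (stdAddChar (-(ξ * rhsMod p c₂ c₃ W w)) : ℂ) := by
    intro g
    rw [← weighted_count_eq]
    simp only [modCount, Complex.ofReal_sum, apply_ite Complex.ofReal, Complex.ofReal_prod,
      Complex.ofReal_zero]
  have hdiff : (p : ℂ) * ((modCount c₁ c₂ c₃ W B f - modCount c₁ c₂ c₃ W B F : ℝ) : ℂ)
      = ∑ ξ : ZMod p, (∏ k, fourierSum (fun x => (f x : ℂ)) ((c₁ k : ZMod p) * ξ)
          - ∏ k, fourierSum (fun x => (F x : ℂ)) ((c₁ k : ZMod p) * ξ))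
        * ∑ w ∈ coloured s₂ s₃ B, (stdAddChar (-(ξ * rhsMod p c₂ c₃ W w)) : ℂ) := by
    push_cast
    rw [mul_sub, hcount, hcount, ← Finset.sum_sub_distrib]
    refine Finset.sum_congr rfl fun ξ _ => ?_
    ring
  rw [← hdiff, norm_mul, Complex.norm_natCast, Complex.norm_real, Real.norm_eq_abs] at h
  refine le_of_mul_le_mul_left (h.trans (le_of_eq ?_)) hp0
  ring

end Error

/-! ### Passage between integers and residues; density of Bohr sets and size of spectra. -/

section Transfer

theorem abs_linForm_le {s : ℕ} (c x : Fin s → ℤ) (M : ℤ) (hx : ∀ k, |x k| ≤ M) :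
    |linForm c x| ≤ (∑ k, (c k).natAbs : ℕ) * M := by
  unfold linForm
  refine (Finset.abs_sum_le_sum_abs _ _).trans ?_
  push_cast
  rw [Finset.sum_mul]
  refine Finset.sum_le_sum fun k _ => ?_
  rw [abs_mul]
  have := hx k
  gcongr

/-- The indicator function modulo `p` of a set of integers between `0` and `p - 1`. -/
noncomputable def residueIndicator (p : ℕ) (A : Finset ℤ) (x : ZMod p) : ℝ :=
  if ((x.val : ℕ) : ℤ) ∈ A then 1 else 0

theorem residueIndicator_nonneg (p : ℕ) (A : Finset ℤ) (x : ZMod p) :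
    0 ≤ residueIndicator p A x := by
  unfold residueIndicator; split_ifs <;> norm_num

theorem residueIndicator_le_one (p : ℕ) (A : Finset ℤ) (x : ZMod p) :
    residueIndicator p A x ≤ 1 := by
  unfold residueIndicator; split_ifs <;> norm_num

theorem card_le_sum_residueIndicator {p : ℕ} [NeZero p] (A : Finset ℤ) (N : ℕ) (hN : N < p)
    (hA : A ⊆ Icc 1 (N : ℤ)) : (A.card : ℝ) ≤ ∑ x, residueIndicator p A x := by
  unfold residueIndicator
  rw [Finset.sum_boole]
  rw [Nat.cast_le]
  have hval : ∀ a ∈ A, (((a : ZMod p).val : ℕ) : ℤ) = a := by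
    intro a ha
    have := Finset.mem_Icc.mp (hA ha)
    rw [ZMod.val_intCast]
    exact Int.emod_eq_of_lt (by omega) (by omega)
  refine Finset.card_le_card_of_injOn (fun a => (a : ZMod p)) ?_ ?_
  · intro a ha
    rw [Finset.mem_coe] at ha ⊢
    rw [Finset.mem_filter]
    exact ⟨Finset.mem_univ _, by rw [hval a ha]; exact ha⟩
  · intro a ha b hb h
    rw [← hval a ha, ← hval b hb]
    simp only at h
    rw [h]

/-- Solutions modulo `p` lift to solutions in integers. -/
theorem modCount_le_solutionCount {s₁ s₂ s₃ : ℕ} (c₁ : Fin s₁ → ℤ) (c₂ : Fin s₂ → ℤ)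
    (c₃ : Fin s₃ → ℤ) {p : ℕ} [NeZero p] (W N Y : ℕ) (A B C : Finset ℤ) (hA : A ⊆ Icc 1 (N : ℤ))
    (hB : B ⊆ Icc 1 (Y : ℤ)) (hBC : B ⊆ C) (hYN : W * Y ^ 2 ≤ N) (hYN' : Y ≤ N) (hN : 0 < N)
    (hp : sizeBound c₁ c₂ c₃ * N < p) :
    modCount c₁ c₂ c₃ W B (residueIndicator p A) ≤ (solutionCount c₁ c₂ c₃ W A C : ℝ) := by
  have hcount : modCount c₁ c₂ c₃ W B (residueIndicator p A)
      = (#{q ∈ coloured s₂ s₃ B ×ˢ (univ : Finset (Fin s₁ → ZMod p)) |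
        (∑ k, (c₁ k : ZMod p) * q.2 k = rhsMod p c₂ c₃ W q.1)
          ∧ ∀ k, (((q.2 k).val : ℕ) : ℤ) ∈ A} : ℝ) := by
    rw [Finset.card_filter, Finset.sum_product]
    unfold modCount residueIndicator
    push_cast
    refine Finset.sum_congr rfl fun w _ => Finset.sum_congr rfl fun x _ => ?_
    rw [Finset.prod_boole]
    simp only [Finset.mem_univ, forall_true_left]
    rw [ite_and]
  rw [hcount, Nat.cast_le, solutionCount]
  refine Finset.card_le_card_of_injOn
    (fun q => ((fun k => (((q.2 k).val : ℕ) : ℤ)), (q.1.1, q.1.2))) ?_ ?_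
  · rintro ⟨w, x⟩ hq
    simp only [coloured, Finset.coe_filter, Finset.mem_product, Fintype.mem_piFinset,
      Set.mem_ofPred_eq] at hq ⊢
    obtain ⟨⟨⟨hy, hz⟩, -⟩, heq, hx⟩ := hq
    refine ⟨⟨hx, fun k => hBC (hy k), fun k => hBC (hz k)⟩, ?_⟩
    rw [← sub_eq_zero]
    have hdvd : ((linForm c₁ (fun k => (((x k).val : ℕ) : ℤ))
        - ((W : ℤ) * linForm c₂ (fun j => w.1 j ^ 2) + linForm c₃ w.2) : ℤ) : ZMod p) = 0 := by
      rw [Int.cast_sub, sub_eq_zero]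
      refine Eq.trans ?_ heq
      unfold linForm
      push_cast
      refine Finset.sum_congr rfl fun k _ => ?_
      rw [ZMod.natCast_zmod_val]
    rw [ZMod.intCast_zmod_eq_zero_iff_dvd] at hdvd
    -- A multiple of `p` of absolute value at most a sum of coefficients times `N`, hence below `p`,
    -- is zero.
    refine Int.eq_zero_of_abs_lt_dvd hdvd ?_
    have hxb : ∀ k, |(((x k).val : ℕ) : ℤ)| ≤ N := by
      intro k
      have := Finset.mem_Icc.mp (hA (hx k))
      rw [abs_le]; omega
    have hyb : ∀ k, |w.1 k ^ 2| ≤ (Y : ℤ) ^ 2 := by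
      intro k
      have := Finset.mem_Icc.mp (hB (hy k))
      rw [abs_of_nonneg (sq_nonneg _)]
      exact pow_le_pow_left₀ (by linarith) this.2 2
    have hzb : ∀ k, |w.2 k| ≤ N := by
      intro k
      have := Finset.mem_Icc.mp (hB (hz k))
      rw [abs_le]; omega
    have h1 := abs_linForm_le c₁ _ N hxb
    have h2 := abs_linForm_le c₂ _ (Y ^ 2) hyb
    have h3 := abs_linForm_le c₃ _ N hzb
    have hYNz : (W : ℤ) * Y ^ 2 ≤ N := by exact_mod_cast hYN
    have h2' : |(W : ℤ) * linForm c₂ (fun j => w.1 j ^ 2)|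
        ≤ (∑ k, (c₂ k).natAbs : ℕ) * (N : ℤ) := by
      rw [abs_mul, Nat.abs_cast]
      calc (W : ℤ) * |linForm c₂ (fun j => w.1 j ^ 2)|
          ≤ W * ((∑ k, (c₂ k).natAbs : ℕ) * (Y : ℤ) ^ 2) := by gcongr
        _ = (∑ k, (c₂ k).natAbs : ℕ) * ((W : ℤ) * Y ^ 2) := by ring
        _ ≤ _ := by gcongr
    have hpz : ((sizeBound c₁ c₂ c₃ : ℕ) : ℤ) * N < p := by exact_mod_cast hp
    calc _ ≤ |linForm c₁ (fun k => (((x k).val : ℕ) : ℤ))|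
          + (|(W : ℤ) * linForm c₂ (fun j => w.1 j ^ 2)| + |linForm c₃ w.2|) :=
        (abs_sub _ _).trans (by gcongr; exact abs_add_le _ _)
      _ ≤ ((∑ k, (c₁ k).natAbs : ℕ) : ℤ) * N
          + ((∑ k, (c₂ k).natAbs : ℕ) * (N : ℤ) + (∑ k, (c₃ k).natAbs : ℕ) * (N : ℤ)) := by
        gcongr
      _ = (((∑ k, (c₁ k).natAbs) + (∑ k, (c₂ k).natAbs) + (∑ k, (c₃ k).natAbs) : ℕ) : ℤ) * N := by
        push_cast; ring
      _ ≤ ((sizeBound c₁ c₂ c₃ : ℕ) : ℤ) * N := by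
        gcongr
        unfold sizeBound
        omega
      _ < p := hpz
  · rintro ⟨w, x⟩ - ⟨w', x'⟩ - h
    simp only [Prod.mk.injEq] at h ⊢
    refine ⟨Prod.ext h.2.1 h.2.2, funext fun k => ?_⟩
    have := congrFun h.1 k
    simp only [Nat.cast_inj] at this
    exact ZMod.val_injective p this

/-- Bohr sets of bounded rank and radius have positive density. -/
theorem exists_bohrSet (K : ℕ) (ρ : ℝ) (hρ : 0 < ρ) :
    ∃ β : ℝ, 0 < β ∧ ∃ p₀ : ℕ, ∀ (p : ℕ) [Fact p.Prime] (Λ : Finset (ZMod p)), Λ.card ≤ K →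
      p₀ ≤ p → ∃ B : Finset (ZMod p), β * p ≤ B.card ∧
        ∀ b ∈ B, ∀ ξ ∈ Λ, ‖(stdAddChar (ξ * b) : ℂ) - 1‖ ≤ ρ := by
  obtain ⟨D, hD, Y₀, h⟩ := recurrence_density K ρ hρ
  refine ⟨D / 2, by positivity, Y₀ + 1, fun p hp Λ hΛ hp₀ => ?_⟩
  -- The linear half of the recurrence statement with `Y = p - 1`, the longest range starting at `1`
  -- on which distinct integers that are all nonzero modulo `p` stay distinct. As `p - 1 ≥ p / 2`,
  -- half the density survives.
  have h1 := h p Λ hΛ (p - 1) (by omega)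
  have h2 := hp.out.two_le
  refine ⟨(recurrenceSet Λ ρ (p - 1)).image fun y : ℕ => (y : ZMod p), ?_, ?_⟩
  · rw [Finset.card_image_of_injOn]
    · refine le_trans ?_ h1
      have : (p : ℝ) / 2 ≤ ((p - 1 : ℕ) : ℝ) := by
        rw [Nat.cast_sub (by omega)]
        have : (2 : ℝ) ≤ p := by exact_mod_cast h2
        push_cast
        linarith
      calc D / 2 * p = D * (p / 2) := by ring
        _ ≤ _ := by gcongr
    · intro x hx y hy hxy
      rw [Finset.mem_coe, recurrenceSet, Finset.mem_filter, Finset.mem_Icc] at hx hy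
      have := congrArg ZMod.val hxy
      simp only at this
      rwa [ZMod.val_natCast_of_lt (by omega), ZMod.val_natCast_of_lt (by omega)] at this
  · intro b hb ξ hξ
    obtain ⟨y, hy, rfl⟩ := Finset.mem_image.mp hb
    exact ((Finset.mem_filter.mp hy).2 ξ hξ).2

/-- The frequencies at which one of the functions `f i` has a Fourier coefficient of size at least
`τ p`. -/
noncomputable def largeSpectrum {r p : ℕ} [NeZero p] (f : Fin r → ZMod p → ℝ) (τ : ℝ) :
    Finset (ZMod p) :=
  univ.filter fun ξ => ∃ i, τ * p ≤ ‖fourierSum (fun x => (f i x : ℂ)) ξ‖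

/-- Parseval bounds the number of large coefficients of each `f i` independently of `p`, so the Bohr
sets built from them have bounded rank. -/
theorem card_largeSpectrum_le {r p : ℕ} [NeZero p] (f : Fin r → ZMod p → ℝ)
    (hf : ∀ i x, |f i x| ≤ 1) (τ : ℝ) (hτ : 0 < τ) :
    (largeSpectrum f τ).card ≤ ⌈(r : ℝ) / τ ^ 2⌉₊ := by
  have hp0 : (0 : ℝ) < p := by exact_mod_cast NeZero.pos p
  have h1 : ∀ ξ ∈ largeSpectrum f τ,
      (τ * p) ^ 2 ≤ ∑ i, ‖fourierSum (fun x => (f i x : ℂ)) ξ‖ ^ 2 := by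
    intro ξ hξ
    obtain ⟨i, hi⟩ := (Finset.mem_filter.mp hξ).2
    calc (τ * p) ^ 2 ≤ ‖fourierSum (fun x => (f i x : ℂ)) ξ‖ ^ 2 := by gcongr
      _ ≤ _ := Finset.single_le_sum
          (f := fun i => ‖fourierSum (fun x => (f i x : ℂ)) ξ‖ ^ 2)
          (fun _ _ => sq_nonneg _) (Finset.mem_univ i)
  have h2 := Finset.card_nsmul_le_sum _ _ _ h1
  have h3 : ∑ ξ ∈ largeSpectrum f τ, ∑ i, ‖fourierSum (fun x => (f i x : ℂ)) ξ‖ ^ 2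
      ≤ r * (p : ℝ) ^ 2 := by
    refine (Finset.sum_le_univ_sum_of_nonneg fun ξ =>
      Finset.sum_nonneg fun i _ => sq_nonneg _).trans ?_
    rw [Finset.sum_comm]
    refine (Finset.sum_le_sum fun i _ => sum_norm_sq_fourierSum_le _ (by simpa using hf i)).trans ?_
    simp
  rw [nsmul_eq_mul] at h2
  have h4 : ((largeSpectrum f τ).card : ℝ) ≤ r / τ ^ 2 := by
    rw [le_div_iff₀ (by positivity)]
    refine le_of_mul_le_mul_right ?_ (by positivity : (0 : ℝ) < (p : ℝ) ^ 2)
    calc _ = ((largeSpectrum f τ).card : ℝ) * (τ * p) ^ 2 := by ring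
      _ ≤ _ := h2.trans h3
  exact_mod_cast h4.trans (Nat.le_ceil _)

theorem norm_stdAddChar_neg_sub_one {p : ℕ} [NeZero p] (a : ZMod p) :
    ‖(stdAddChar (-a) : ℂ) - 1‖ = ‖(stdAddChar a : ℂ) - 1‖ := by
  rw [← conj_stdAddChar, ← map_one (starRingEnd ℂ), ← map_sub, RCLike.norm_conj, map_one]

theorem norm_stdAddChar_add_sub_one_le {p : ℕ} [NeZero p] (a b : ZMod p) :
    ‖(stdAddChar (a + b) : ℂ) - 1‖ ≤ ‖(stdAddChar a : ℂ) - 1‖ + ‖(stdAddChar b : ℂ) - 1‖ := by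
  rw [AddChar.map_add_eq_mul]
  have e : ∀ u v : ℂ, u * v - 1 = (u - 1) * v + (v - 1) := fun u v => by ring
  rw [e]
  refine (norm_add_le _ _).trans (le_of_eq ?_)
  rw [norm_mul, norm_stdAddChar b, mul_one]

theorem norm_stdAddChar_sum_sub_one_le {p : ℕ} [NeZero p] {ι : Type*} (S : Finset ι)
    (a : ι → ZMod p) (ρ : ℝ) (h : ∀ i ∈ S, ‖(stdAddChar (a i) : ℂ) - 1‖ ≤ ρ) :
    ‖(stdAddChar (∑ i ∈ S, a i) : ℂ) - 1‖ ≤ S.card * ρ := by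
  classical
  induction S using Finset.induction_on with
  | empty => simp
  | insert i S hi ih =>
    rw [Finset.sum_insert hi, Finset.card_insert_of_notMem hi]
    refine (norm_stdAddChar_add_sub_one_le _ _).trans ?_
    have h1 := h i (Finset.mem_insert_self _ _)
    have h2 := ih fun j hj => h j (Finset.mem_insert_of_mem hj)
    push_cast
    linarith

end Transfer

/-! ### Choice of parameters and the main theorem. -/

section Main

/-- Cauchy–Schwarz: Parseval gives almost invariance in mean square, while the counting argument
uses it in mean. -/
theorem sum_abs_le_of_sum_sq_le {p : ℕ} [NeZero p] (g : ZMod p → ℝ) (ε : ℝ) (hε : 0 ≤ ε)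
    (h : ∑ x, g x ^ 2 ≤ p * ε ^ 2) : ∑ x, |g x| ≤ ε * p := by
  have h1 := sq_sum_le_card_mul_sum_sq (s := (univ : Finset (ZMod p))) (f := fun x => |g x|)
  simp only [sq_abs] at h1
  rw [Finset.card_univ, ZMod.card] at h1
  refine abs_le_of_sq_le_sq' ?_ (by positivity) |>.2
  calc (∑ x, |g x|) ^ 2 ≤ p * ∑ x, g x ^ 2 := h1
    _ ≤ p * (p * ε ^ 2) := by gcongr
    _ = (ε * p) ^ 2 := by ring

/-- The frequency multipliers that arise on solving the equation for its first variable. -/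
def multiplier {n s₂ s₃ : ℕ} (p : ℕ) (c₁ : Fin (n + 2) → ℤ) (c₂ : Fin s₂ → ℤ) (c₃ : Fin s₃ → ℤ)
    (W : ℕ) : Unit ⊕ Fin n ⊕ Fin s₂ ⊕ Fin s₃ → ZMod p :=
  Sum.elim (fun _ => 1) (Sum.elim (fun k => (c₁ 0 : ZMod p)⁻¹ * c₁ k.succ.succ)
    (Sum.elim (fun l => (c₁ 0 : ZMod p)⁻¹ * (W * c₂ l)) (fun l => (c₁ 0 : ZMod p)⁻¹ * c₃ l)))

/-- If all variables but the first recur at the dilates of `ξ` by the multipliers, then so does the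
first one at `ξ`. -/
theorem norm_stdAddChar_first_variable_le {n s₂ s₃ p : ℕ} [NeZero p] (c₁ : Fin (n + 2) → ℤ)
    (c₂ : Fin s₂ → ℤ) (c₃ : Fin s₃ → ℤ) (W : ℕ) (ξ : ZMod p) (ρ : ℝ) (u : Fin n → ZMod p)
    (w : (Fin s₂ → ℤ) × (Fin s₃ → ℤ))
    (hu : ∀ k i, ‖(stdAddChar (ξ * multiplier p c₁ c₂ c₃ W i * u k) : ℂ) - 1‖ ≤ ρ)
    (hy : ∀ k i, ‖(stdAddChar (ξ * multiplier p c₁ c₂ c₃ W i * (w.1 k : ZMod p) ^ 2) : ℂ) - 1‖ ≤ ρ)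
    (hz : ∀ k i, ‖(stdAddChar (ξ * multiplier p c₁ c₂ c₃ W i * (w.2 k : ZMod p)) : ℂ) - 1‖ ≤ ρ) :
    ‖(stdAddChar (ξ * ((c₁ 0 : ZMod p)⁻¹ * (rhsMod p c₂ c₃ W w
      - ∑ k : Fin n, (c₁ k.succ.succ : ZMod p) * u k))) : ℂ) - 1‖ ≤ (n + s₂ + s₃) * ρ := by
  have e : ξ * ((c₁ 0 : ZMod p)⁻¹ * (rhsMod p c₂ c₃ W w
      - ∑ k : Fin n, (c₁ k.succ.succ : ZMod p) * u k))
      = (∑ l, ξ * multiplier p c₁ c₂ c₃ W (.inr (.inr (.inl l))) * (w.1 l : ZMod p) ^ 2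
        + ∑ l, ξ * multiplier p c₁ c₂ c₃ W (.inr (.inr (.inr l))) * (w.2 l : ZMod p))
        + -∑ k, ξ * multiplier p c₁ c₂ c₃ W (.inr (.inl k)) * u k := by
    simp only [multiplier, Sum.elim_inr, Sum.elim_inl, rhsMod, linForm]
    push_cast
    rw [← sub_eq_add_neg, mul_sub, mul_sub, mul_add, mul_add]
    simp only [Finset.mul_sum]
    congr 1
    · congr 1 <;> refine Finset.sum_congr rfl fun _ _ => ?_ <;> ring
    · refine Finset.sum_congr rfl fun _ _ => ?_
      ring
  rw [e]
  refine (norm_stdAddChar_add_sub_one_le _ _).trans ?_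
  rw [norm_stdAddChar_neg_sub_one]
  have h1 := norm_stdAddChar_sum_sub_one_le univ _ ρ fun l (_ : l ∈ univ) =>
    hy l (.inr (.inr (.inl l)))
  have h2 := norm_stdAddChar_sum_sub_one_le univ _ ρ fun l (_ : l ∈ univ) =>
    hz l (.inr (.inr (.inr l)))
  have h3 := norm_stdAddChar_sum_sub_one_le univ _ ρ fun l (_ : l ∈ univ) =>
    hu l (.inr (.inl l))
  have h4 := norm_stdAddChar_add_sub_one_le
    (∑ l, ξ * multiplier p c₁ c₂ c₃ W (.inr (.inr (.inl l))) * (w.1 l : ZMod p) ^ 2)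
    (∑ l, ξ * multiplier p c₁ c₂ c₃ W (.inr (.inr (.inr l))) * (w.2 l : ZMod p))
  rw [Finset.card_univ, Fintype.card_fin] at h1 h2 h3
  linarith

/-- A finite colouring of the elements of `G` not below `κ Y` has a colour class of positive
density in `[1, Y]`, if `G` has density more than `κ`. -/
theorem exists_dense_colour {r : ℕ} (hr : 0 < r) (C : Fin r → Finset ℤ) (G : Finset ℕ) (Y : ℕ)
    (D κ : ℝ) (hκ0 : 0 ≤ κ) (hκ : κ ≤ D / 2) (hGY : G ⊆ Icc 1 Y) (hG : D * Y ≤ G.card)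
    (hC : ∀ y : ℤ, κ * Y ≤ y → y ≤ Y → ∃ j, y ∈ C j) :
    ∃ (j : Fin r) (B : Finset ℤ), B ⊆ C j ∧ D * Y / (2 * r) ≤ B.card ∧
      ∀ y ∈ B, ∃ g ∈ G, y = (g : ℤ) := by
  set G' := G.filter fun y : ℕ => κ * Y ≤ y with hG'
  have hG'card : D * Y / 2 ≤ G'.card := by
    have h1 : G.card ≤ G'.card + (Icc 1 ⌊κ * Y⌋₊).card := by
      rw [← Finset.card_filter_add_card_filter_not (s := G) (fun y : ℕ => κ * Y ≤ y)]
      refine Nat.add_le_add_left (Finset.card_le_card fun y hy => ?_) _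
      rw [Finset.mem_filter] at hy
      rw [Finset.mem_Icc]
      exact ⟨(Finset.mem_Icc.mp (hGY hy.1)).1, Nat.le_floor (not_le.mp hy.2).le⟩
    rw [Nat.card_Icc, Nat.add_sub_cancel] at h1
    have h2 : (G.card : ℝ) ≤ G'.card + (⌊κ * Y⌋₊ : ℝ) := by exact_mod_cast h1
    have h3 : (⌊κ * Y⌋₊ : ℝ) ≤ κ * Y := Nat.floor_le (by positivity)
    have h4 : κ * Y ≤ D / 2 * Y := by gcongr
    linarith
  set I : Finset ℤ := G'.image fun y : ℕ => (y : ℤ) with hI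
  have hIcard : I.card = G'.card := Finset.card_image_of_injective _ Nat.cast_injective
  have hcover : I ⊆ univ.biUnion fun j => I.filter (· ∈ C j) := by
    intro y hy
    obtain ⟨g, hg, rfl⟩ := Finset.mem_image.mp hy
    have hg2 := Finset.mem_filter.mp hg
    obtain ⟨j, hj⟩ := hC (g : ℤ) (by exact_mod_cast hg2.2)
      (by exact_mod_cast (Finset.mem_Icc.mp (hGY hg2.1)).2)
    exact Finset.mem_biUnion.mpr ⟨j, Finset.mem_univ _, Finset.mem_filter.mpr ⟨hy, hj⟩⟩
  have : Nonempty (Fin r) := ⟨⟨0, hr⟩⟩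
  obtain ⟨j, -, hj⟩ := Finset.exists_max_image (univ : Finset (Fin r))
    (fun j => (I.filter (· ∈ C j)).card) Finset.univ_nonempty
  have hle := (Finset.card_le_card hcover).trans
    (Finset.card_biUnion_le_card_mul _ _ _ fun k hk => hj k hk)
  rw [Finset.card_univ, Fintype.card_fin, hIcard] at hle
  refine ⟨j, I.filter (· ∈ C j), fun y hy => (Finset.mem_filter.mp hy).2, ?_, fun y hy => ?_⟩
  · have hrR : (0 : ℝ) < r := by exact_mod_cast hr
    have : (G'.card : ℝ) ≤ r * (I.filter (· ∈ C j)).card := by exact_mod_cast hle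
    rw [div_le_iff₀ (by positivity)]
    linarith
  · obtain ⟨g, hg, rfl⟩ := Finset.mem_image.mp (Finset.mem_filter.mp hy).1
    exact ⟨g, (Finset.mem_filter.mp hg).1, rfl⟩

/-- The counting theorem modulo a prime, for sets with few Fourier coefficients of intermediate
size. -/
theorem count_of_sparse_band {n s₂ s₃ : ℕ} (hs : 3 ≤ n + 2 + s₂) (c₁ : Fin (n + 2) → ℤ)
    (c₂ : Fin s₂ → ℤ) (c₃ : Fin s₃ → ℤ) (hc₁ : NonSingular c₁) (hc₂ : NonSingular c₂)
    (hc₃ : NonSingular c₃) (hL₁ : linForm c₁ (fun _ => 1) = 0) (δ : ℝ) (hδ : 0 < δ) (r : ℕ)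
    (hr : 0 < r) :
    ∃ ε : ℝ, 0 < ε ∧ ∀ τ : ℝ, 0 < τ → ∃ ω : ℝ, 0 < ω ∧ ∃ κ : ℝ, 0 < κ ∧
      ∀ W : ℕ, 0 < W → (W = 1 ∨ 0 < s₃) → ∃ N₀ : ℕ, ∀ N : ℕ, N₀ ≤ N →
        ∀ (Y p : ℕ) [Fact p.Prime], Y = Nat.sqrt (N / W) → sizeBound c₁ c₂ c₃ * N < p →
        p ≤ 2 * (sizeBound c₁ c₂ c₃ * N) →
        ∀ A : Fin r → Finset ℤ, (∀ i, A i ⊆ Icc 1 (N : ℤ)) →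
          (∀ i, δ * (N : ℝ) ≤ ((A i).card : ℝ)) →
        ∀ C : Fin r → Finset ℤ, (∀ y : ℤ, κ * Y ≤ y → y ≤ Y → ∃ j, y ∈ C j) →
        (∀ i, ∑ ξ : ZMod p with
            ω * p ≤ ‖fourierSum (fun x => (residueIndicator p (A i) x : ℂ)) ξ‖ ∧
            ‖fourierSum (fun x => (residueIndicator p (A i) x : ℂ)) ξ‖ < τ * p,
          ‖fourierSum (fun x => (residueIndicator p (A i) x : ℂ)) ξ‖ ^ 2 ≤ ε * (p : ℝ) ^ 2) →
        ∃ j, ∀ i, κ * (p : ℝ) ^ (n + 1) * (Y : ℝ) ^ (s₂ + s₃)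
          ≤ (solutionCount c₁ c₂ c₃ W (A i) (C j) : ℝ) := by
  set S := sizeBound c₁ c₂ c₃ with hS
  have hS0 : 0 < S := by rw [hS]; unfold sizeBound; omega
  have hSR : (0 : ℝ) < S := by exact_mod_cast hS0
  have hrR : (0 : ℝ) < r := by exact_mod_cast hr
  -- A density of `δ` in `[1, N]` is at least `d` in `ZMod p`, because `p ≤ 2 S N`. The next
  -- constant makes the loss `(n + 2) * e₁` half of the main term `d ^ (n + 2)`.
  set d := δ / (2 * S) with hd
  have hd0 : 0 < d := by positivity
  set e₁ := d ^ (n + 2) / (2 * (n + 2)) with he₁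
  have he₁0 : 0 < e₁ := by positivity
  -- With `ρ = e₁ / 2` and `ω = e₁ √β' / 4` below, the three terms of the invariance estimate are
  -- `e₁ ^ 2 / 4` each, together less than `e₁ ^ 2`.
  refine ⟨e₁ ^ 2 / 16, by positivity, fun τ hτ => ?_⟩
  -- The number of multipliers. It also exceeds the number of terms in the shift of the first
  -- variable, so phases within `ρ / q` add up to at most `ρ`.
  set q := 1 + n + s₂ + s₃ with hq
  have hqR : (0 : ℝ) < (q : ℝ) := by exact_mod_cast (by omega : 0 < q)
  set ρ := e₁ / 2 with hρ
  have hρq : 0 < ρ / q := by positivity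
  obtain ⟨D, hD, Y₀, hrec⟩ := recurrence_density (⌈(r : ℝ) / τ ^ 2⌉₊ * q) (ρ / q) hρq
  obtain ⟨β, hβ, p₀, hbohr⟩ := exists_bohrSet (⌈(r : ℝ) / τ ^ 2⌉₊ * q) (ρ / q) hρq
  -- The constant in the main term: density of coloured tuples, times choices of shifts in the Bohr
  -- set, times half the power of the density. It depends on `τ` through `D` and `β`, and `σ`, `β'`
  -- and `ω` depend on it in turn.
  set m := (D / (2 * r)) ^ (s₂ + s₃) * β ^ n * (d ^ (n + 2) / 2) with hm
  have hm0 : 0 < m := by positivity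
  obtain ⟨σ, hσ, herr⟩ := modCount_error hs c₁ c₂ c₃ hc₁ hc₂ hc₃ (m / 2) (by positivity)
  obtain ⟨β', hβ', p₁, hbohr'⟩ := exists_bohrSet ⌈(r : ℝ) / σ ^ 2⌉₊ σ hσ
  -- The bound `m / 2` is what the error leaves of the main term; `D / 2` ensures that discarding
  -- integers below `κ Y` keeps half of the recurrence set.
  refine ⟨e₁ * √β' / 4, by positivity, min (m / 2) (D / 2), by positivity, fun W hW hWs => ?_⟩
  refine ⟨W * (W + Y₀ + 1) ^ 2 + p₀ + p₁ + 1, fun N hN Y p hp hY hp1 hp2 A hA hAcard C hC hband =>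
    ?_⟩
  have hNp : N < p := lt_of_le_of_lt (Nat.le_mul_of_pos_left _ hS0) hp1
  have hN0 : 0 < N := by omega
  have hYbig : W + Y₀ + 1 ≤ Y := by
    rw [hY, Nat.le_sqrt, Nat.le_div_iff_mul_le hW]
    calc (W + Y₀ + 1) * (W + Y₀ + 1) * W = W * (W + Y₀ + 1) ^ 2 := by ring
      _ ≤ N := by omega
  have hY0 : 0 < Y := by omega
  obtain ⟨hb1, -⟩ := sqrt_div_bounds hW hY hY0
  have hYN : Y ≤ N := by nlinarith
  have hp0 : (0 : ℝ) < p := by exact_mod_cast hp.out.pos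
  have hYR : (0 : ℝ) < Y := by exact_mod_cast hY0
  set f : Fin r → ZMod p → ℝ := fun i => residueIndicator p (A i) with hf
  have hfabs : ∀ i x, |f i x| ≤ 1 := fun i x => by
    rw [abs_of_nonneg (residueIndicator_nonneg _ _ _)]
    exact residueIndicator_le_one _ _ _
  set Λ := largeSpectrum f τ with hΛ
  have hΛcard := card_largeSpectrum_le f hfabs τ hτ
  -- Dilating the coarse spectra of all sets by all multipliers makes recurrence at `Λ'` control the
  -- solved-for variable at `Λ`, for every `i` at once.
  set Λ' : Finset (ZMod p) := (Λ ×ˢ (univ : Finset (Unit ⊕ Fin n ⊕ Fin s₂ ⊕ Fin s₃))).image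
    (fun t => t.1 * multiplier p c₁ c₂ c₃ W t.2) with hΛ'
  have hΛ'mem : ∀ ξ ∈ Λ, ∀ i, ξ * multiplier p c₁ c₂ c₃ W i ∈ Λ' := fun ξ hξ i =>
    Finset.mem_image.mpr ⟨(ξ, i), Finset.mem_product.mpr ⟨hξ, Finset.mem_univ _⟩, rfl⟩
  have hΛ'card : Λ'.card ≤ ⌈(r : ℝ) / τ ^ 2⌉₊ * q := by
    refine Finset.card_image_le.trans ?_
    rw [Finset.card_product]
    refine Nat.mul_le_mul hΛcard (le_of_eq ?_)
    simp [hq]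
    ring
  obtain ⟨B₁, hB₁card, hB₁⟩ := hbohr p Λ' hΛ'card (by omega)
  obtain ⟨B₂, hB₂card, hB₂⟩ := hbohr' p (largeSpectrum f σ)
    (card_largeSpectrum_le f hfabs σ hσ) (by omega)
  have hB₂ne : B₂.Nonempty := by
    rw [← Finset.card_pos]
    have : (0 : ℝ) < B₂.card := lt_of_lt_of_le (by positivity) hB₂card
    exact_mod_cast this
  set F : Fin r → ZMod p → ℝ := fun i => translateAverage B₂ (f i) with hF
  have hF0 : ∀ i x, 0 ≤ F i x := fun i x =>
    translateAverage_nonneg _ _ (fun _ => residueIndicator_nonneg _ _ _) _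
  have hF1 : ∀ i x, F i x ≤ 1 := fun i x =>
    translateAverage_le_one _ _ (fun _ => residueIndicator_le_one _ _ _) _
  have hinv : ∀ t : ZMod p, (∀ ξ ∈ Λ, ‖(stdAddChar (ξ * t) : ℂ) - 1‖ ≤ ρ) →
      ∀ i, ∑ x, |F i (x + t) - F i x| ≤ e₁ * p := by
    intro t ht i
    refine sum_abs_le_of_sum_sq_le _ _ he₁0.le ?_
    refine (sum_sq_translateAverage_sub_le (f i) (hfabs i) B₂ τ (e₁ * √β' / 4) ρ (e₁ ^ 2 / 16) β'
      hβ' hB₂card (hband i) t fun ξ hξ => ht ξ ?_).trans ?_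
    · exact Finset.mem_filter.mpr ⟨Finset.mem_univ _, i, hξ⟩
    · have h1 : (e₁ * √β' / 4) ^ 2 = e₁ ^ 2 * β' / 16 := by
        rw [div_pow, mul_pow, Real.sq_sqrt hβ'.le]; norm_num
      rw [h1, hρ]
      have h2 : (e₁ / 2) ^ 2 + 4 * (e₁ ^ 2 / 16) + 4 * (e₁ ^ 2 * β' / 16) / β' = 3 / 4 * e₁ ^ 2 := by
        field_simp; ring
      rw [h2]
      gcongr
      nlinarith [sq_nonneg e₁]
  -- The colour is fixed before `i`: `Λ'` already takes all the sets into account.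
  obtain ⟨j, B, hBC, hBcard, hBG⟩ := exists_dense_colour hr C (recurrenceSet Λ' (ρ / q) Y) Y D
    (min (m / 2) (D / 2)) (by positivity) (min_le_right _ _) (Finset.filter_subset _ _)
    (hrec p Λ' hΛ'card Y (by omega)) hC
  refine ⟨j, fun i => ?_⟩
  have hBY : B ⊆ Icc 1 (Y : ℤ) := by
    intro y hy
    obtain ⟨g, hg, rfl⟩ := hBG y hy
    have := Finset.mem_Icc.mp (Finset.mem_filter.mp hg).1
    rw [Finset.mem_Icc]
    omega
  have hBrec : ∀ y ∈ B, ∀ ξ ∈ Λ', ‖(stdAddChar (ξ * (y : ZMod p) ^ 2) : ℂ) - 1‖ ≤ ρ / q ∧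
      ‖(stdAddChar (ξ * (y : ZMod p)) : ℂ) - 1‖ ≤ ρ / q := by
    intro y hy ξ hξ
    obtain ⟨g, hg, rfl⟩ := hBG y hy
    have := (Finset.mem_filter.mp hg).2 ξ hξ
    simpa using this
  have hqρ : ((n : ℝ) + s₂ + s₃) * (ρ / q) ≤ ρ := by
    rw [mul_div_assoc', div_le_iff₀ hqR, hq]
    push_cast
    nlinarith [hρq, he₁0]
  have hρq' : ρ / q ≤ ρ := by
    refine div_le_self (by positivity) ?_
    exact_mod_cast (by omega : 1 ≤ q)
  have hsum : ∑ k, (c₁ k : ZMod p) = 0 := by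
    have := congrArg (Int.cast : ℤ → ZMod p) hL₁
    simpa [linForm] using this
  have hc0 : (c₁ 0 : ZMod p) ≠ 0 := by
    intro h
    rw [ZMod.intCast_zmod_eq_zero_iff_dvd] at h
    refine hc₁ 0 (Int.eq_zero_of_abs_lt_dvd h ?_)
    rw [Int.abs_eq_natAbs]
    have h1 := (natAbs_lt_sizeBound c₁ c₂ c₃).1 0
    have h2 : S ≤ S * N := Nat.le_mul_of_pos_right _ hN0
    exact_mod_cast (by omega : (c₁ 0).natAbs < p)
  have havg : d * p ≤ ∑ x, F i x := by
    rw [hF, sum_translateAverage B₂ hB₂ne]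
    refine le_trans ?_ (card_le_sum_residueIndicator (A i) N hNp (hA i))
    refine le_trans ?_ (hAcard i)
    have : (p : ℝ) ≤ 2 * (S * N) := by exact_mod_cast hp2
    calc d * p ≤ d * (2 * (S * N)) := by gcongr
      _ = δ * N := by rw [hd]; field_simp
  have hmain : ∀ w ∈ coloured s₂ s₃ B, (β * p) ^ n * (d ^ (n + 2) / 2 * p)
      ≤ ∑ x : Fin (n + 2) → ZMod p,
        if ∑ k, (c₁ k : ZMod p) * x k = rhsMod p c₂ c₃ W w then ∏ k, F i (x k) else 0 := by
    intro w hw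
    rw [coloured, Finset.mem_product, Fintype.mem_piFinset, Fintype.mem_piFinset] at hw
    have h1 := almost_invariant_count_le (F i) (hF0 i) (hF1 i) (fun k => (c₁ k : ZMod p)) hc0 hsum
      B₁ (rhsMod p c₂ c₃ W w) e₁ d hd0.le he₁0.le havg
      (fun b hb => hinv b (fun ξ hξ => by
        have h2 := hB₁ b hb _ (hΛ'mem ξ hξ (.inl ()))
        simp only [multiplier, Sum.elim_inl, mul_one] at h2
        exact h2.trans hρq') i)
      (fun u hu => hinv _ (fun ξ hξ => (norm_stdAddChar_first_variable_le c₁ c₂ c₃ W ξ (ρ / q) u w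
        (fun k l => hB₁ _ (hu k) _ (hΛ'mem ξ hξ l))
        (fun k l => (hBrec _ (hw.1 k) _ (hΛ'mem ξ hξ l)).1)
        (fun k l => (hBrec _ (hw.2 k) _ (hΛ'mem ξ hξ l)).2)).trans hqρ) i)
    refine le_trans ?_ h1
    have h2 : d ^ (n + 2) - (n + 2) * e₁ = d ^ (n + 2) / 2 := by
      rw [he₁]; field_simp; ring
    rw [h2]
    gcongr
  have hlow : m * (p : ℝ) ^ (n + 1) * (Y : ℝ) ^ (s₂ + s₃) ≤ modCount c₁ c₂ c₃ W B (F i) := by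
    unfold modCount
    refine le_trans ?_ (Finset.card_nsmul_le_sum _ _ _ hmain)
    rw [nsmul_eq_mul, card_coloured]
    push_cast
    calc m * (p : ℝ) ^ (n + 1) * (Y : ℝ) ^ (s₂ + s₃)
        = (D * Y / (2 * r)) ^ (s₂ + s₃) * ((β * p) ^ n * (d ^ (n + 2) / 2 * p)) := by
          rw [hm, mul_div_right_comm, mul_pow (D / (2 * r)), mul_pow β, pow_succ]
          ring
      _ ≤ _ := by gcongr
  have herr' := herr W hW hWs N Y p B (f i) (F i) hY (by omega) hp1 hp2 hBY (hfabs i)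
    (fun ξ => by
      rw [hF, fourierSum_translateAverage, norm_mul]
      exact mul_le_of_le_one_right (norm_nonneg _) (norm_uniformFourier_le_one _ _))
    (norm_fourierSum_sub_translateAverage_le (f i) (hfabs i) B₂ hB₂ne σ hσ.le
      fun b hb ξ hξ => hB₂ b hb ξ (Finset.mem_filter.mpr ⟨Finset.mem_univ _, i, hξ⟩))
  have hsol := modCount_le_solutionCount c₁ c₂ c₃ W N Y (A i) B (C j) (hA i) hBY hBC hb1 hYN hN0 hp1
  have h1 := (abs_le.mp herr').1
  have h2 : min (m / 2) (D / 2) * (p : ℝ) ^ (n + 1) * (Y : ℝ) ^ (s₂ + s₃)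
      ≤ m / 2 * (p : ℝ) ^ (n + 1) * (Y : ℝ) ^ (s₂ + s₃) := by
    gcongr
    exact min_le_left _ _
  linarith

theorem exists_pos_forall_le (n : ℕ) (κ : ℕ → ℝ) (hκ : ∀ k, 0 < κ k) :
    ∃ η, 0 < η ∧ ∀ k < n, η ≤ κ k := by
  induction n with
  | zero => exact ⟨1, one_pos, fun k hk => absurd hk (Nat.not_lt_zero k)⟩
  | succ n ih =>
    obtain ⟨η, hη, h⟩ := ih
    refine ⟨min η (κ n), lt_min hη (hκ n), fun k hk => ?_⟩
    rcases Nat.lt_succ_iff_lt_or_eq.mp hk with h' | rfl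
    · exact (min_le_left _ _).trans (h k h')
    · exact min_le_right _ _

theorem mainTheorem7
    (s₁ s₂ s₃ : ℕ) (hs₁ : 2 ≤ s₁) (hs₁₂ : 3 ≤ s₁ + s₂)
    (c₁ : Fin s₁ → ℤ) (c₂ : Fin s₂ → ℤ) (c₃ : Fin s₃ → ℤ)
    (hc₁ : NonSingular c₁) (hc₂ : NonSingular c₂) (hc₃ : NonSingular c₃)
    (hL₁ : linForm c₁ (fun _ => 1) = 0)
    (δ : ℝ) (hδ : 0 < δ) (r : ℕ) (hr : 0 < r) :
    ∃ η : ℝ, 0 < η ∧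
      ∀ W : ℕ, 0 < W → (W = 1 ∨ 0 < s₃) →
        ∃ N₀ : ℕ, ∀ N : ℕ, N₀ ≤ N →
          ∀ A : Fin r → Finset ℤ,
            (∀ i, A i ⊆ Finset.Icc 1 (N : ℤ)) →
            (∀ i, δ * (N : ℝ) ≤ ((A i).card : ℝ)) →
          ∀ C : Fin r → Finset ℤ,
            (⋃ j, (C j : Set ℤ)) =
              {n : ℤ | η * Real.sqrt ((N : ℝ) / W) ≤ (n : ℝ) ∧
                (n : ℝ) ≤ Real.sqrt ((N : ℝ) / W)} →
            ∃ j, ∀ i,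
              η * (N : ℝ) ^ ((s₁ : ℝ) + ((s₂ : ℝ) + s₃) / 2 - 1) *
                  (W : ℝ) ^ (-(((s₂ : ℝ) + s₃) / 2))
                ≤ (solutionCount c₁ c₂ c₃ W (A i) (C j) : ℝ) := by
  obtain ⟨n, rfl⟩ : ∃ n, s₁ = n + 2 := ⟨s₁ - 2, by omega⟩
  obtain ⟨ε, hε, hcore⟩ := count_of_sparse_band hs₁₂ c₁ c₂ c₃ hc₁ hc₂ hc₃ hL₁ δ hδ r hr
  -- The constants become functions of the scale `τ`; `ω` is then the function defining the bands.
  choose! ω hω κ hκ N₁ hN₁ using hcore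
  obtain ⟨M, τ, hτ, hsparse⟩ := exists_sparse_band ω hω r ε hε
  -- Which scale is sparse depends on the sets, but there are only `M` candidates, fixed in advance.
  obtain ⟨κ₀, hκ₀, hκ₀le⟩ := exists_pos_forall_le M (fun k => κ (τ k)) fun k => hκ _ (hτ k)
  have hη0 : 0 < κ₀ / 2 ^ (s₂ + s₃ + 1) := by positivity
  -- The factor `2 ^ (s₂ + s₃)` pays for `√(N / W) ≤ 2 Y` in the count. The further factor `2` pays
  -- for the same inequality at the lower end of the coloured interval.
  refine ⟨κ₀ / 2 ^ (s₂ + s₃ + 1), hη0, fun W hW hWs => ?_⟩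
  set η := κ₀ / 2 ^ (s₂ + s₃ + 1) with hη
  -- The sum dominates the threshold of every candidate scale; adding `W` makes `Y` positive.
  refine ⟨(∑ k ∈ Finset.range M, N₁ (τ k) W) + W, fun N hN A hA hAcard C hC => ?_⟩
  set S := sizeBound c₁ c₂ c₃ with hS
  have hS0 : 0 < S := by rw [hS]; unfold sizeBound; omega
  have hN0 : 0 < N := by omega
  -- Bertrand's postulate.
  obtain ⟨p, hpp, hp1, hp2⟩ := Nat.exists_prime_lt_and_le_two_mul (S * N) (by positivity)
  have : Fact p.Prime := ⟨hpp⟩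
  have hp0 : (0 : ℝ) < p := by exact_mod_cast hpp.pos
  -- The normalised coefficients of all the sets form one family of square sum at most `r`, so a
  -- single band is sparse for every set.
  set a : Fin r × ZMod p → ℝ := fun t =>
    ‖fourierSum (fun x => (residueIndicator p (A t.1) x : ℂ)) t.2‖ / p with ha
  have hfabs : ∀ i x, |residueIndicator p (A i) x| ≤ 1 := fun i x => by
    rw [abs_of_nonneg (residueIndicator_nonneg _ _ _)]
    exact residueIndicator_le_one _ _ _
  have hatot : ∑ t ∈ (univ : Finset (Fin r × ZMod p)), a t ^ 2 ≤ (r : ℝ) := by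
    rw [← Finset.univ_product_univ, Finset.sum_product]
    have h1 : ∀ i : Fin r, ∑ ξ : ZMod p, a (i, ξ) ^ 2 ≤ 1 := by
      intro i
      simp only [ha, div_pow]
      rw [← Finset.sum_div, div_le_one (by positivity)]
      exact sum_norm_sq_fourierSum_le _ (by simpa using hfabs i)
    refine (Finset.sum_le_sum fun i _ => h1 i).trans ?_
    simp
  obtain ⟨k, hkM, hk⟩ := hsparse univ a hatot
  set Y := Nat.sqrt (N / W) with hY
  have hNk : N₁ (τ k) W ≤ N := by
    have := Finset.single_le_sum (f := fun k => N₁ (τ k) W) (fun _ _ => Nat.zero_le _)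
      (Finset.mem_range.mpr hkM)
    omega
  have hY0 : 0 < Y := by
    rw [hY, Nat.sqrt_pos]
    exact Nat.div_pos (by omega) hW
  obtain ⟨hb1, hb2⟩ := sqrt_div_bounds hW hY hY0
  have hWR : (0 : ℝ) < W := by exact_mod_cast hW
  have hYle : (Y : ℝ) ≤ √((N : ℝ) / W) := by
    refine Real.le_sqrt_of_sq_le ?_
    rw [le_div_iff₀ hWR, mul_comm]
    exact_mod_cast hb1
  have hleY : √((N : ℝ) / W) ≤ 2 * Y := by
    refine Real.sqrt_le_iff.mpr ⟨by positivity, ?_⟩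
    rw [div_le_iff₀ hWR]
    calc (N : ℝ) ≤ 4 * (W * Y ^ 2) := by exact_mod_cast hb2
      _ = _ := by ring
  have hκk : κ₀ ≤ κ (τ k) := hκ₀le k hkM
  have hηκ : η * 2 ≤ κ₀ := by
    rw [hη, div_mul_eq_mul_div, div_le_iff₀ (by positivity), pow_succ]
    have : (1 : ℝ) ≤ 2 ^ (s₂ + s₃) := one_le_pow₀ (by norm_num)
    nlinarith
  have hcov : ∀ y : ℤ, κ (τ k) * Y ≤ y → y ≤ Y → ∃ j, y ∈ C j := by
    intro y hy1 hy2
    have hmem : y ∈ (⋃ j, (C j : Set ℤ)) := by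
      rw [hC]
      refine ⟨?_, ?_⟩
      · calc η * √((N : ℝ) / W) ≤ η * (2 * Y) := by gcongr
          _ = η * 2 * Y := by ring
          _ ≤ κ (τ k) * Y := by gcongr; linarith
          _ ≤ y := hy1
      · refine le_trans ?_ hYle
        exact_mod_cast hy2
    simpa using hmem
  obtain ⟨j, hj⟩ := hN₁ (τ k) (hτ k) W hW hWs N hNk Y p hY hp1 hp2 A hA hAcard C hcov (by
    intro i
    have h1 : ∑ ξ : ZMod p with
            ω (τ k) * p ≤ ‖fourierSum (fun x => (residueIndicator p (A i) x : ℂ)) ξ‖ ∧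
            ‖fourierSum (fun x => (residueIndicator p (A i) x : ℂ)) ξ‖ < τ k * p,
          a (i, ξ) ^ 2 ≤ ε := by
      refine le_trans ?_ hk
      rw [Finset.sum_filter, Finset.sum_filter, ← Finset.univ_product_univ, Finset.sum_product]
      refine le_trans (le_of_eq ?_) (Finset.single_le_sum
        (f := fun i => ∑ ξ, if ω (τ k) ≤ a (i, ξ) ∧ a (i, ξ) < τ k then a (i, ξ) ^ 2 else 0)
        (fun i _ => Finset.sum_nonneg fun ξ _ => by split_ifs <;> positivity) (Finset.mem_univ i))
      refine Finset.sum_congr rfl fun ξ _ => if_congr ?_ rfl rfl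
      simp only [ha]
      rw [le_div_iff₀ hp0, div_lt_iff₀ hp0]
    simp only [ha, div_pow] at h1
    rw [← Finset.sum_div, div_le_iff₀ (by positivity)] at h1
    exact h1)
  refine ⟨j, fun i => le_trans ?_ (hj i)⟩
  have hNR : (0 : ℝ) < N := by exact_mod_cast hN0
  have hNp : (N : ℝ) ≤ p := by
    have : N ≤ S * N := Nat.le_mul_of_pos_left _ hS0
    exact_mod_cast (by omega : N ≤ p)
  have hpow : (N : ℝ) ^ (((n + 2 : ℕ) : ℝ) + ((s₂ : ℝ) + s₃) / 2 - 1)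
      * (W : ℝ) ^ (-(((s₂ : ℝ) + s₃) / 2)) = (N : ℝ) ^ (n + 1) * √((N : ℝ) / W) ^ (s₂ + s₃) := by
    have e1 : ((n + 2 : ℕ) : ℝ) + ((s₂ : ℝ) + s₃) / 2 - 1
        = ((n + 1 : ℕ) : ℝ) + ((s₂ : ℝ) + s₃) / 2 := by push_cast; ring
    have e2 : √((N : ℝ) / W) ^ (s₂ + s₃) = ((N : ℝ) / W) ^ (((s₂ : ℝ) + s₃) / 2) := by
      rw [Real.sqrt_eq_rpow, ← Real.rpow_natCast, ← Real.rpow_mul (by positivity)]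
      congr 1
      push_cast
      ring
    rw [e1, e2, Real.rpow_add hNR, Real.rpow_natCast, Real.rpow_neg hWR.le,
      Real.div_rpow hNR.le hWR.le]
    field_simp
  calc η * (N : ℝ) ^ (((n + 2 : ℕ) : ℝ) + ((s₂ : ℝ) + s₃) / 2 - 1)
        * (W : ℝ) ^ (-(((s₂ : ℝ) + s₃) / 2))
      = η * ((N : ℝ) ^ (n + 1) * √((N : ℝ) / W) ^ (s₂ + s₃)) := by rw [mul_assoc, hpow]
    _ ≤ η * ((p : ℝ) ^ (n + 1) * (2 * Y) ^ (s₂ + s₃)) := by gcongr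
    _ = (η * 2 ^ (s₂ + s₃)) * (p : ℝ) ^ (n + 1) * (Y : ℝ) ^ (s₂ + s₃) := by
        rw [mul_pow]; ring
    _ ≤ κ (τ k) * (p : ℝ) ^ (n + 1) * (Y : ℝ) ^ (s₂ + s₃) := by
        gcongr
        refine le_trans ?_ hκk
        rw [hη, pow_succ]
        have h2 : (0 : ℝ) < 2 ^ (s₂ + s₃) := by positivity
        rw [div_mul_eq_mul_div, div_le_iff₀ (by positivity)]
        nlinarith

end Main
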